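/- Let $d\in\{2,3\}$ and let $T\subset\mathbb R^d$ be a nondegenerate closed $d$-simplex with vertices $p_1,\dots,p_{d+1}$, numbered as follows. - $d=2$: $\overline{p_2p_3}$ is the longest edge and $h_2\le h_1$, where $h_1=|p_1-p_2|$, $h_2=|p_1-p_3|$. - $d=3$: a shortest edge $L_{\min}$ of $T$ is $\overline{p_1p_3}$ (type (i)) or $\overline{p_2p_3}$ (type (ii)); $\overline{p_1p_2}$ is the longest of the four edges sharing exactly one endpoint with $L_{\min}$; with respect to the perpendicular bisecting plane of $\overline{p_1p_2}$, $p_4$ lies in the closed half-space of $p_1$, and $p_3$ lies in the closed half-space of $p_1$ for type (i), of $p_2$ for type (ii). Put $h_1=|p_1-p_2|$, $h_2=|L_{\min}|$, $h_3=|p_1-p_4|$. Let $\Phi_T(\tilde x)=A_T\tilde x+b_T$ with $A_T\in O(d)$, $b_T\in\mathbb R^d$ and $p_i=\Phi_T(\tilde p_i)$ for all $i$, where $\tilde T=\Phi_T^{-1}(T)$ is in standard position, that is, - $d=2$: $\tilde p_1=0$, $\tilde p_2=(h_1,0)$, $\tilde p_3=(h_2s,h_2t)$ with $s^2+t^2=1$,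 $t>0$; - $d=3$: $\tilde p_1=0$, $\tilde p_2=(h_1,0,0)$, $\tilde p_4=h_3(s_{21},s_{22},t_2)$, and $\tilde p_3=(h_2s_1,h_2t_1,0)$ for type (i), $\tilde p_3=(h_1-h_2s_1,h_2t_1,0)$ for type (ii), with $s_1^2+t_1^2=1$, $s_1,t_1>0$, $h_2s_1\le h_1/2$, $s_{21}^2+s_{22}^2+t_2^2=1$, $t_2>0$, $h_3s_{21}\le h_1/2$. Put $\tilde{\mathscr H}_1=h_1$, $\tilde{\mathscr H}_2=h_2t$ if $d=2$, and $\tilde{\mathscr H}_1=h_1$, $\tilde{\mathscr H}_2=h_2t_1$, $\tilde{\mathscr H}_3=h_3t_2$ if $d=3$. Let $r_i=(p_{i+1}-p_1)/|p_{i+1}-p_1|$ for $1\le i\le d$, except that $r_2=(p_3-p_2)/|p_3-p_2|$ for $d=3$, type (ii). Let $\lambda_i$ be the barycentric coordinates of $T$, $F_i$ the face opposite $p_i$ with unit outer normal $n_i$, and $S_{i,j}$ the $(d-2)$-dimensional subsimplex without the vertices $p_i,p_j$. The Morley interpolant of $\varphi$ is $$I_T^M\varphi=\sum_{1\le i<j\le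 d+1}\Big(\frac1{|S_{i,j}|}\int_{S_{i,j}}\varphi\,ds\Big)\theta^{(1)}_{i,j}+\sum_{i=1}^{d+1}\Big(\frac1{|F_i|}\int_{F_i}\frac{\partial\varphi}{\partial n_i}\,ds\Big)\theta^{(2)}_i,$$ where the mean over $S_{i,j}$ is the value at the remaining vertex if $d=2$, and $$\theta^{(1)}_{i,j}=1-(d-1)(\lambda_i+\lambda_j)+d(d-1)\lambda_i\lambda_j-(d-1)\,\nabla\lambda_i\cdot\nabla\lambda_j\sum_{k=i,j}\frac{\lambda_k(d\lambda_k-2)}{2|\nabla\lambda_k|^2},\qquad \theta^{(2)}_i=\frac{\lambda_i(d\lambda_i-2)}{2|\nabla\lambda_i|}.$$ Sobolev spaces on $T$ are those on its interior, and $|f|_{W^{k,p}}=\big(\sum_{|\alpha|=k}\|\partial^\alpha f\|_{L^p}^p\big)^{1/p}$. **Theorem.** Let $p,q\in[1,\infty)$ satisfy $1-\frac dp\ge-\frac dq$ (that is, $W^{1,p}(T)\hookrightarrow L^q(T)$). 1. There is a constant $c=c(d,p,q)>0$ such that for all $T$ as above (no shape-regularity is assumed) and all $\varphi\in W^{3,p}(T)\cap\mathcal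 C^1(T)$, one has $I_T^M\varphi-\varphi\in W^{2,q}(T)$ and $$|I_T^M\varphi-\varphi|_{W^{2,q}(T)}\le c\,|T|^{\frac1q-\frac1p}\sum_{i=1}^d h_i\Big|\frac{\partial\varphi}{\partial r_i}\Big|_{W^{2,p}(T)}.$$ 2. For every $M>0$ there is a constant $c=c(d,p,q,M)>0$ such that for all $T$ as above which, if $d=3$, satisfy $|s_{22}|\le M\,h_2t_1/h_3$ (no condition if $d=2$), and all $\varphi\in W^{3,p}(T)\cap\mathcal C^1(T)$, $$|I_T^M\varphi-\varphi|_{W^{2,q}(T)}\le c\,|T|^{\frac1q-\frac1p}\sum_{i=1}^d\tilde{\mathscr H}_i\Big|\frac{\partial(\varphi\circ\Phi_T)}{\partial\tilde x_i}\Big|_{W^{2,p}(\Phi_T^{-1}(T))}.$$ -/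

import Mathlib

open MeasureTheory
open scoped ContDiff

noncomputable section

namespace Morley

/-- The Euclidean space `ℝ^d`. -/
abbrev E (d : ℕ) : Type := EuclideanSpace ℝ (Fin d)

/-! ### Sobolev spaces on an open set, through weak derivatives -/

/-- The order `|α|` of a multi-index `α`. -/
def order {d : ℕ} (α : Fin d → ℕ) : ℕ := ∑ i, α i

/-- The multi-index of the first partial derivative `∂/∂x_i`. -/
def unitIndex {d : ℕ} (i : Fin d) : Fin d → ℕ := Pi.single i 1

/-- The classical partial derivative `∂g/∂x_i`. -/
def pderiv {d : ℕ} (i : Fin d) (g : E d → ℝ) : E d → ℝ :=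
  fun x => fderiv ℝ g x (EuclideanSpace.single i 1)

/-- The classical derivative `∂^α g = ∂_1^{α_1} ⋯ ∂_d^{α_d} g` (used for test functions). -/
def multiDeriv {d : ℕ} (α : Fin d → ℕ) (g : E d → ℝ) : E d → ℝ :=
  (List.finRange d).foldr (fun i f => (pderiv i)^[α i] f) g

/-- `g` is a weak derivative `∂^α f` on the open set `Ω`. -/
def HasWeakDeriv {d : ℕ} (Ω : Set (E d)) (α : Fin d → ℕ) (f g : E d → ℝ) : Prop :=
  LocallyIntegrableOn f Ω ∧ LocallyIntegrableOn g Ω ∧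
    ∀ η : E d → ℝ, ContDiff ℝ ∞ η → HasCompactSupport η → tsupport η ⊆ Ω →
      ∫ x in Ω, f x * multiDeriv α η x = (-1 : ℝ) ^ order α * ∫ x in Ω, g x * η x

open Classical in
/-- The weak derivative `∂^α f` on `Ω` (unique up to a null set of `Ω`; `0` if there is none). -/
def weakDeriv {d : ℕ} (Ω : Set (E d)) (α : Fin d → ℕ) (f : E d → ℝ) : E d → ℝ :=
  if h : ∃ g, HasWeakDeriv Ω α f g then h.choose else 0

/-- `f ∈ W^{k,p}(Ω)`, for real `p ≥ 1`. -/
def MemSobolev {d : ℕ} (k : ℕ) (p : ℝ) (Ω : Set (E d)) (f : E d → ℝ) : Prop :=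
  ∀ α : Fin d → ℕ, order α ≤ k →
    ∃ g, HasWeakDeriv Ω α f g ∧ MemLp g (ENNReal.ofReal p) (volume.restrict Ω)

/-- The seminorm `|f|_{W^{k,p}(Ω)} = (∑_{|α| = k} ‖∂^α f‖_{L^p(Ω)}^p)^{1/p}`, for real `p ≥ 1`. -/
def sobolevSeminorm {d : ℕ} (k : ℕ) (p : ℝ) (Ω : Set (E d)) (f : E d → ℝ) : ℝ :=
  (∑ α ∈ Finset.piAntidiag (Finset.univ : Finset (Fin d)) k,
    ∫ x in Ω, |weakDeriv Ω α f x| ^ p) ^ (1 / p)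

/-- The directional derivative `∂f/∂r = ∑_j r_j ∂f/∂x_j` on `Ω`. -/
def dirDeriv {d : ℕ} (Ω : Set (E d)) (r : E d) (f : E d → ℝ) : E d → ℝ :=
  fun x => ∑ j, r j * weakDeriv Ω (unitIndex j) f x

/-! ### Simplices and the Morley interpolation

A nondegenerate simplex with an ordering of its vertices is given by an affine basis `T` of `ℝ^d`:
the vertices are `T 0, …, T d`. -/

/-- Nondegenerate `d`-simplices in `ℝ^d` with ordered vertices. -/
abbrev Simplex (d : ℕ) : Type := AffineBasis (Fin (d + 1)) ℝ (E d)

variable {d : ℕ}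

/-- The closed simplex. -/
def body (T : Simplex d) : Set (E d) := convexHull ℝ (Set.range T)

/-- The measure `|T|`. -/
def vol (T : Simplex d) : ℝ := volume.real (body T)

/-- The face `F_i` opposite to the vertex `T i`. -/
def face (T : Simplex d) (i : Fin (d + 1)) : Set (E d) := convexHull ℝ (T '' {i}ᶜ)

/-- The `(d-2)`-dimensional subsimplex `S_{i,j}` without the vertices `T i` and `T j`. -/
def subface (T : Simplex d) (i j : Fin (d + 1)) : Set (E d) := convexHull ℝ (T '' {i, j}ᶜ)

/-- The barycentric coordinate `λ_i`. -/
def bary (T : Simplex d) (i : Fin (d + 1)) : E d → ℝ := fun x => T.coord i x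

/-- The (constant) gradient `∇λ_i`. -/
def baryGrad (T : Simplex d) (i : Fin (d + 1)) : E d := gradient (bary T i) (T i)

/-- The unit outer normal to `F_i`: as `λ_i` vanishes on `F_i` and is positive at the opposite
vertex, it is the normalization of `-∇λ_i`. -/
def outerNormal (T : Simplex d) (i : Fin (d + 1)) : E d := -(‖baryGrad T i‖⁻¹ • baryGrad T i)

/-- `χ^{(1)}_{i,j}(f)`: the mean value of `f` over `S_{i,j}` with respect to the
`(d-2)`-dimensional measure; for `d = 2` this is the value at the remaining vertex. -/
def dofSub (T : Simplex d) (i j : Fin (d + 1)) (f : E d → ℝ) : ℝ :=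
  ⨍ x in subface T i j, f x ∂(Measure.euclideanHausdorffMeasure (d - 2))

/-- `χ^{(2)}_i(f)`: the mean value over `F_i` of the outer normal derivative of `f`, a `C^1`
function on the closed simplex. -/
def dofNormal (T : Simplex d) (i : Fin (d + 1)) (f : E d → ℝ) : ℝ :=
  ⨍ x in face T i, fderivWithin ℝ f (body T) x (outerNormal T i)
    ∂(Measure.euclideanHausdorffMeasure (d - 1))

/-- The nodal basis function `θ^{(1)}_{i,j}`. -/
def thetaSub (T : Simplex d) (i j : Fin (d + 1)) : E d → ℝ := fun x =>
  1 - ((d : ℝ) - 1) * (bary T i x + bary T j x) + d * ((d : ℝ) - 1) * bary T i x * bary T j x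
    - ((d : ℝ) - 1) * inner ℝ (baryGrad T i) (baryGrad T j) *
      (bary T i x * (d * bary T i x - 2) / (2 * ‖baryGrad T i‖ ^ 2)
        + bary T j x * (d * bary T j x - 2) / (2 * ‖baryGrad T j‖ ^ 2))

/-- The nodal basis function `θ^{(2)}_i`. -/
def thetaNormal (T : Simplex d) (i : Fin (d + 1)) : E d → ℝ := fun x =>
  bary T i x * (d * bary T i x - 2) / (2 * ‖baryGrad T i‖)

/-- The local Morley interpolation operator `I_T^M`. -/
def interp (T : Simplex d) (f : E d → ℝ) : E d → ℝ := fun x =>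
  (∑ i, ∑ j ∈ Finset.Ioi i, dofSub T i j f * thetaSub T i j x)
    + ∑ i, dofNormal T i f * thetaNormal T i x

/-! ### The anisotropic parametrization of simplices -/

/-- The parameters of a simplex in standard position: triangles, and tetrahedra of
types (i) and (ii). -/
inductive Shape : ℕ → Type
  | tri (h₁ h₂ s t : ℝ) : Shape 2
  | tetI (h₁ h₂ h₃ s₁ t₁ s₂₁ s₂₂ t₂ : ℝ) : Shape 3
  | tetII (h₁ h₂ h₃ s₁ t₁ s₂₁ s₂₂ t₂ : ℝ) : Shape 3

namespace Shape

/-- The lengths `h_1, …, h_d`. -/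
def h : {d : ℕ} → Shape d → Fin d → ℝ
  | _, tri h₁ h₂ _ _ => ![h₁, h₂]
  | _, tetI h₁ h₂ h₃ _ _ _ _ _ => ![h₁, h₂, h₃]
  | _, tetII h₁ h₂ h₃ _ _ _ _ _ => ![h₁, h₂, h₃]

/-- The parameters `ℋ̃_1, …, ℋ̃_d`. -/
def hTilde : {d : ℕ} → Shape d → Fin d → ℝ
  | _, tri h₁ h₂ _ t => ![h₁, h₂ * t]
  | _, tetI h₁ h₂ h₃ _ t₁ _ _ t₂ => ![h₁, h₂ * t₁, h₃ * t₂]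
  | _, tetII h₁ h₂ h₃ _ t₁ _ _ t₂ => ![h₁, h₂ * t₁, h₃ * t₂]

/-- The constraints on the parameters. -/
def Admissible : {d : ℕ} → Shape d → Prop
  | _, tri h₁ h₂ s t => 0 < h₁ ∧ 0 < h₂ ∧ s ^ 2 + t ^ 2 = 1 ∧ 0 < t
  | _, tetI h₁ h₂ h₃ s₁ t₁ s₂₁ s₂₂ t₂ | _, tetII h₁ h₂ h₃ s₁ t₁ s₂₁ s₂₂ t₂ =>
      0 < h₁ ∧ 0 < h₂ ∧ 0 < h₃ ∧
      s₁ ^ 2 + t₁ ^ 2 = 1 ∧ 0 < s₁ ∧ 0 < t₁ ∧ h₂ * s₁ ≤ h₁ / 2 ∧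
      s₂₁ ^ 2 + s₂₂ ^ 2 + t₂ ^ 2 = 1 ∧ 0 < t₂ ∧ h₃ * s₂₁ ≤ h₁ / 2

/-- The vertices `p̃_1, …, p̃_{d+1}` of the simplex `T̃` in standard position. -/
def vertex : {d : ℕ} → Shape d → Fin (d + 1) → E d
  | _, tri h₁ h₂ s t => ![!₂[0, 0], !₂[h₁, 0], !₂[h₂ * s, h₂ * t]]
  | _, tetI h₁ h₂ h₃ s₁ t₁ s₂₁ s₂₂ t₂ =>
      ![!₂[0, 0, 0], !₂[h₁, 0, 0], !₂[h₂ * s₁, h₂ * t₁, 0], !₂[h₃ * s₂₁, h₃ * s₂₂, h₃ * t₂]]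
  | _, tetII h₁ h₂ h₃ s₁ t₁ s₂₁ s₂₂ t₂ =>
      ![!₂[0, 0, 0], !₂[h₁, 0, 0], !₂[h₁ - h₂ * s₁, h₂ * t₁, 0], !₂[h₃ * s₂₁, h₃ * s₂₂, h₃ * t₂]]

/-- The index of the vertex at which the edge in direction `r_i` starts (it ends at `p_{i+1}`):
always `p_1`, except that `r_2` starts at `p_2` for type (ii). -/
def startVertex : {d : ℕ} → Shape d → Fin d → Fin (d + 1)
  | _, tri _ _ _ _ => ![0, 0]
  | _, tetI _ _ _ _ _ _ _ _ => ![0, 0, 0]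
  | _, tetII _ _ _ _ _ _ _ _ => ![0, 1, 0]

/-- The unit vectors `r_1, …, r_d` along edges of the simplex with vertices `p`. -/
def edgeDir {d : ℕ} (S : Shape d) (p : Fin (d + 1) → E d) (i : Fin d) : E d :=
  ‖p i.succ - p (S.startVertex i)‖⁻¹ • (p i.succ - p (S.startVertex i))

end Shape

/-- The edge with endpoints `p a`, `p b` is a shortest edge. -/
def IsShortestEdge (p : Fin (d + 1) → E d) (a b : Fin (d + 1)) : Prop :=
  ∀ i j, i ≠ j → dist (p a) (p b) ≤ dist (p i) (p j)

/-- The edge with endpoints `p 0`, `p 1` is at least as long as every other edge that shares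
exactly one endpoint with the edge from `p a` to `p b`. -/
def IsLongestAdjacent (p : Fin 4 → E 3) (a b : Fin 4) : Prop :=
  ∀ j, j ≠ a → j ≠ b → dist (p a) (p j) ≤ dist (p 0) (p 1) ∧ dist (p b) (p j) ≤ dist (p 0) (p 1)

/-- `p i` lies in the closed half-space of the points at least as close to `p a` as to `p b`,
bounded by the perpendicular bisecting plane of the edge from `p a` to `p b`. -/
def SameSide (p : Fin (d + 1) → E d) (a b i : Fin (d + 1)) : Prop :=
  dist (p i) (p a) ≤ dist (p i) (p b)

/-- The convention on the numbering of the vertices.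
Triangles: `p_2 p_3` is the longest edge and `h_2 ≤ h_1`.
Tetrahedra: the shortest edge is `p_1 p_3` (type (i)) or `p_2 p_3` (type (ii)); `p_1 p_2` is the
longest among the four edges adjacent to it; `p_4` is on the side of `p_1` of the bisecting plane
of `p_1 p_2`, and `p_3` is on the side of `p_1` (type (i)) or of `p_2` (type (ii)). -/
def NumberingCondition : {d : ℕ} → Shape d → (Fin (d + 1) → E d) → Prop
  | _, .tri h₁ h₂ _ _, p =>
      dist (p 0) (p 1) ≤ dist (p 1) (p 2) ∧ dist (p 0) (p 2) ≤ dist (p 1) (p 2) ∧ h₂ ≤ h₁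
  | _, .tetI _ _ _ _ _ _ _ _, p =>
      IsShortestEdge p 0 2 ∧ IsLongestAdjacent p 0 2 ∧ SameSide p 0 1 3 ∧ SameSide p 0 1 2
  | _, .tetII _ _ _ _ _ _ _ _, p =>
      IsShortestEdge p 1 2 ∧ IsLongestAdjacent p 1 2 ∧ SameSide p 0 1 3 ∧ SameSide p 1 0 2

/-- The simplex `T` with vertices `p_i` is the image of the simplex in standard position with
parameters `S` under the isometry `Φ = Φ_T : x̃ ↦ A_T x̃ + b_T`, `A_T ∈ O(d)`, with
`p_i = Φ_T(p̃_i)`, and its vertices are numbered according to the convention. -/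
structure IsConfiguration (S : Shape d) (T : Simplex d) (Φ : E d ≃ᵃⁱ[ℝ] E d) : Prop where
  admissible : S.Admissible
  vertex_eq : ∀ i, T i = Φ (S.vertex i)
  numbering : NumberingCondition S T

/-- The geometric assumption on `T̃` with constant `M`: no condition for triangles, and
`|s_{22}| ≤ M h_2 t_1 / h_3` for tetrahedra. -/
def GeometricAssumption (M : ℝ) : {d : ℕ} → Shape d → Prop
  | _, .tri _ _ _ _ => True
  | _, .tetI _ h₂ h₃ _ t₁ _ s₂₂ _ | _, .tetII _ h₂ h₃ _ t₁ _ s₂₂ _ => |s₂₂| ≤ M * (h₂ * t₁ / h₃)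

end Morley

end

open Morley

/-! The estimate rests on two facts, neither of which involves the shape of the simplex.

(1) The interpolant has exactly the averaged second derivatives of `φ`. It is a quadratic
polynomial, and its constant derivative in directions `v`, `w` is the mean of the corresponding
derivative of `φ` over `T` (`average_dirDeriv₂`). By the divergence theorem, the mean of `∂_w ∂_v φ`
over `T` is `-d ∑ (∇λ_i · w)` times the mean of `∂_v φ` over `F_i`. On `F_i` the vector `v` splits
into a normal part, whose mean is a Morley degree of freedom, and a tangential part, whose mean
reduces in the same way to means over the `S_{i,j}`. The resulting expression
(`average_secondDeriv`) coincides with the one found by differentiating the nodal functions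
(`fderiv_fderiv_interp_apply`), so neither unisolvence nor duality of the nodal basis enters.

(2) A Sobolev-Poincaré inequality with a constant independent of `T`
(`exists_lpNorm_sub_average_le`): the `L^q` norm of `v` minus its mean is at most `C |T|^(1/q -
1/p)` times the sum of the `L^p` norms of the derivatives of `v` along the unnormalized edge vectors
at the first vertex. The affine map from the reference simplex turns coordinate derivatives into
exactly these edge derivatives and scales both norms by powers of `|T|`. On the reference simplex
the inequality is proved by the Gagliardo-Nirenberg argument, an integration along segments, and
mollification.

Applying (2) to the second derivatives of `φ` bounds the error by third derivatives along the edges.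
It remains to expand the edge vectors (`exists_sobolevSeminorm_interp_sub_le`): in the unit vectors
`r_i` with coefficients at most `h_i` for the first claim, and in the rotated coordinate vectors
with coefficients at most `(1 + M) ℋ̃_i` for the second. Only this last step uses the numbering of
the vertices and the geometric assumption. -/

set_option linter.unusedSectionVars false

namespace Morley

/-! ### Weak directional derivatives and affine changes of variables -/

section WeakDirDeriv

variable {F G : Type*} [NormedAddCommGroup F] [NormedSpace ℝ F] [FiniteDimensional ℝ F]
  [MeasureSpace F] [BorelSpace F] [(volume : Measure F).IsAddHaarMeasure]
  [NormedAddCommGroup G] [NormedSpace ℝ G] [FiniteDimensional ℝ G]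
  [MeasureSpace G] [BorelSpace G] [(volume : Measure G).IsAddHaarMeasure]

/-- `g` is the weak derivative of `f` in the direction `v` on the open set `Ω`. -/
def WeakDirDeriv (Ω : Set F) (v : F) (f g : F → ℝ) : Prop :=
  LocallyIntegrableOn f Ω ∧ LocallyIntegrableOn g Ω ∧
    ∀ η : F → ℝ, ContDiff ℝ ∞ η → HasCompactSupport η → tsupport η ⊆ Ω →
      ∫ x in Ω, f x * fderiv ℝ η x v = -∫ x in Ω, g x * η x

theorem integrable_mul_of_tsupport_subset {Ω : Set F} {f η : F → ℝ}
    (hf : LocallyIntegrableOn f Ω) (hη : Continuous η) (hc : HasCompactSupport η)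
    (hs : tsupport η ⊆ Ω) : Integrable (fun x => f x * η x) := by
  have h1 : IntegrableOn f (tsupport η) := hf.integrableOn_compact_subset hs hc
  have h2 : IntegrableOn (fun x => f x * η x) (tsupport η) :=
    h1.mul_continuousOn hη.continuousOn hc
  refine (integrableOn_iff_integrable_of_support_subset ?_).1 h2
  intro x hx
  apply subset_tsupport
  intro h
  exact hx (by simp [h])

theorem setIntegral_mul_of_tsupport_subset {Ω : Set F} {f η : F → ℝ} (hs : tsupport η ⊆ Ω) :
    ∫ x in Ω, f x * η x = ∫ x, f x * η x := by
  refine setIntegral_eq_integral_of_forall_compl_eq_zero fun x hx => ?_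
  rw [image_eq_zero_of_notMem_tsupport fun h => hx (hs h), mul_zero]

theorem testFunction_fderiv {η : F → ℝ} (hη : ContDiff ℝ ∞ η) (hc : HasCompactSupport η) (v : F) :
    ContDiff ℝ ∞ (fun x => fderiv ℝ η x v) ∧ HasCompactSupport (fun x => fderiv ℝ η x v) ∧
      tsupport (fun x => fderiv ℝ η x v) ⊆ tsupport η := by
  refine ⟨?_, hc.fderiv_apply ℝ v, tsupport_fderiv_apply_subset ℝ v⟩
  exact (hη.fderiv_right (m := ∞) (by simp)).clm_apply contDiff_const

namespace WeakDirDeriv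

variable {Ω : Set F} {v : F} {f g f' g' : F → ℝ}

theorem sum_left {ι : Type*} (s : Finset ι) {V : ι → F} {c : ι → ℝ} {g : ι → F → ℝ}
    (hf : LocallyIntegrableOn f Ω)
    (h : ∀ i ∈ s, WeakDirDeriv Ω (V i) f (g i)) :
    WeakDirDeriv Ω (∑ i ∈ s, c i • V i) f (fun x => ∑ i ∈ s, c i * g i x) := by
  have hloc : LocallyIntegrableOn (fun x => ∑ i ∈ s, c i * g i x) Ω := by
    intro x hx
    choose! u hu hu' using fun i (hi : i ∈ s) => (h i hi).2.1 x hx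
    refine ⟨⋂ i ∈ s, u i, (Filter.biInter_finset_mem s).2 hu, ?_⟩
    refine integrable_finsetSum _ fun i hi => Integrable.const_mul ?_ _
    exact (hu' i hi).mono_set (Set.biInter_subset_of_mem hi)
  refine ⟨hf, hloc, fun η hη hc hs => ?_⟩
  have e1 : ∀ i ∈ s, Integrable (fun x => f x * fderiv ℝ η x (V i)) (volume.restrict Ω) := by
    intro i _
    obtain ⟨a, b, c⟩ := testFunction_fderiv hη hc (V i)
    exact (integrable_mul_of_tsupport_subset hf a.continuous b (c.trans hs)).restrict
  have e2 : ∀ i ∈ s, Integrable (fun x => g i x * η x) (volume.restrict Ω) := fun i hi =>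
    (integrable_mul_of_tsupport_subset (h i hi).2.1 hη.continuous hc hs).restrict
  calc ∫ x in Ω, f x * fderiv ℝ η x (∑ i ∈ s, c i • V i)
      = ∫ x in Ω, ∑ i ∈ s, c i * (f x * fderiv ℝ η x (V i)) := by
        congr 1; ext x; simp only [map_sum, map_smul, smul_eq_mul, Finset.mul_sum]
        exact Finset.sum_congr rfl fun i _ => by ring
    _ = ∑ i ∈ s, c i * ∫ x in Ω, f x * fderiv ℝ η x (V i) := by
        rw [integral_finsetSum _ fun i hi => (e1 i hi).const_mul _]
        simp only [integral_const_mul]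
    _ = -∑ i ∈ s, c i * ∫ x in Ω, g i x * η x := by
        rw [← Finset.sum_neg_distrib]
        exact Finset.sum_congr rfl fun i hi => by rw [(h i hi).2.2 η hη hc hs]; ring
    _ = -∫ x in Ω, ∑ i ∈ s, c i * (g i x * η x) := by
        rw [integral_finsetSum _ fun i hi => (e2 i hi).const_mul _]
        simp only [integral_const_mul]
    _ = _ := by
        congr 2; ext x; rw [Finset.sum_mul]; exact Finset.sum_congr rfl fun i _ => by ring

theorem sum_right {ι : Type*} (s : Finset ι) {c : ι → ℝ} {f g : ι → F → ℝ}
    (h : ∀ i ∈ s, WeakDirDeriv Ω v (f i) (g i)) :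
    WeakDirDeriv Ω v (fun x => ∑ i ∈ s, c i * f i x) (fun x => ∑ i ∈ s, c i * g i x) := by
  have hloc : ∀ k : ι → F → ℝ, (∀ i ∈ s, LocallyIntegrableOn (k i) Ω) →
      LocallyIntegrableOn (fun x => ∑ i ∈ s, c i * k i x) Ω := by
    intro k hk x hx
    choose! u hu hu' using fun i (hi : i ∈ s) => hk i hi x hx
    refine ⟨⋂ i ∈ s, u i, (Filter.biInter_finset_mem s).2 hu, ?_⟩
    refine integrable_finsetSum _ fun i hi => Integrable.const_mul ?_ _
    exact (hu' i hi).mono_set (Set.biInter_subset_of_mem hi)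
  refine ⟨hloc f fun i hi => (h i hi).1, hloc g fun i hi => (h i hi).2.1, fun η hη hc hs => ?_⟩
  obtain ⟨a, b, c'⟩ := testFunction_fderiv hη hc v
  have e1 : ∀ i ∈ s, Integrable (fun x => f i x * fderiv ℝ η x v) (volume.restrict Ω) :=
    fun i hi =>
    (integrable_mul_of_tsupport_subset (h i hi).1 a.continuous b (c'.trans hs)).restrict
  have e2 : ∀ i ∈ s, Integrable (fun x => g i x * η x) (volume.restrict Ω) := fun i hi =>
    (integrable_mul_of_tsupport_subset (h i hi).2.1 hη.continuous hc hs).restrict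
  simp only [Finset.sum_mul, mul_assoc]
  rw [integral_finsetSum _ fun i hi => (e1 i hi).const_mul _,
    integral_finsetSum _ fun i hi => (e2 i hi).const_mul _, ← Finset.sum_neg_distrib]
  refine Finset.sum_congr rfl fun i hi => ?_
  rw [integral_const_mul, integral_const_mul, (h i hi).2.2 η hη hc hs]; ring

theorem _root_.Morley.ae_eq_of_forall_setIntegral_mul_eq (hΩ : IsOpen Ω)
    (hg : LocallyIntegrableOn g Ω) (hg' : LocallyIntegrableOn g' Ω)
    (h : ∀ η : F → ℝ, ContDiff ℝ ∞ η → HasCompactSupport η → tsupport η ⊆ Ω →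
      ∫ x in Ω, g x * η x = ∫ x in Ω, g' x * η x) : g =ᵐ[volume.restrict Ω] g' := by
  have key := hΩ.ae_eq_zero_of_integral_contDiff_smul_eq_zero (μ := volume) (hg.sub hg') ?_
  · filter_upwards [(ae_restrict_iff' hΩ.measurableSet).2 key] with x hx
    exact sub_eq_zero.1 hx
  intro η hη hc hs
  have := h η hη hc hs
  rw [setIntegral_mul_of_tsupport_subset hs, setIntegral_mul_of_tsupport_subset hs] at this
  simp only [Pi.sub_apply, smul_eq_mul, mul_comm (η _), sub_mul]
  rw [integral_sub (integrable_mul_of_tsupport_subset hg hη.continuous hc hs)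
    (integrable_mul_of_tsupport_subset hg' hη.continuous hc hs), this, sub_self]

theorem ae_eq (hΩ : IsOpen Ω) (h : WeakDirDeriv Ω v f g) (h' : WeakDirDeriv Ω v f g') :
    g =ᵐ[volume.restrict Ω] g' := by
  refine ae_eq_of_forall_setIntegral_mul_eq hΩ h.2.1 h'.2.1 fun η hη hc hs => ?_
  have := (h.2.2 η hη hc hs).symm.trans (h'.2.2 η hη hc hs)
  linarith

theorem _root_.Morley.locallyIntegrableOn_congr_ae
    (hf : f =ᵐ[volume.restrict Ω] f')
    (h : LocallyIntegrableOn f Ω) : LocallyIntegrableOn f' Ω := by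
  intro x hx
  obtain ⟨u, hu, hu'⟩ := h x hx
  refine ⟨u ∩ Ω, Filter.inter_mem hu self_mem_nhdsWithin, ?_⟩
  exact (hu'.mono_set Set.inter_subset_left).congr
    (ae_mono (Measure.restrict_mono Set.inter_subset_right le_rfl) hf)

theorem congr_ae (h : WeakDirDeriv Ω v f g) (hf : f =ᵐ[volume.restrict Ω] f')
    (hg : g =ᵐ[volume.restrict Ω] g') : WeakDirDeriv Ω v f' g' := by
  refine ⟨locallyIntegrableOn_congr_ae hf h.1,
    locallyIntegrableOn_congr_ae hg h.2.1, fun η hη hc hs => ?_⟩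
  have e1 : ∫ x in Ω, f' x * fderiv ℝ η x v = ∫ x in Ω, f x * fderiv ℝ η x v :=
    integral_congr_ae (by filter_upwards [hf] with x hx; rw [hx])
  have e2 : ∫ x in Ω, g' x * η x = ∫ x in Ω, g x * η x :=
    integral_congr_ae (by filter_upwards [hg] with x hx; rw [hx])
  rw [e1, e2, h.2.2 η hη hc hs]

theorem of_contDiffOn (hΩ : IsOpen Ω) (hf : ContDiffOn ℝ 1 f Ω) (v : F) :
    WeakDirDeriv Ω v f (fun x => fderiv ℝ f x v) := by
  have hd : ContinuousOn (fun x => fderiv ℝ f x v) Ω :=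
    (hf.continuousOn_fderiv_of_isOpen hΩ le_rfl).clm_apply continuousOn_const
  have l1 := hf.continuousOn.locallyIntegrableOn (μ := volume) hΩ.measurableSet
  have l2 := hd.locallyIntegrableOn (μ := volume) hΩ.measurableSet
  refine ⟨l1, l2, fun η hη hc hs => ?_⟩
  obtain ⟨a, b, c⟩ := testFunction_fderiv hη hc v
  rw [setIntegral_mul_of_tsupport_subset hs, setIntegral_mul_of_tsupport_subset (c.trans hs)]
  refine integral_mul_fderiv_eq_neg_fderiv_mul_of_integrable
    (integrable_mul_of_tsupport_subset l2 hη.continuous hc hs)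
    (integrable_mul_of_tsupport_subset l1 a.continuous b (c.trans hs))
    (integrable_mul_of_tsupport_subset l1 hη.continuous hc hs) (fun x hx => ?_)
    (fun x _ => (hη.differentiable (by simp)).differentiableAt)
  exact (hf.differentiableOn (by simp)).differentiableAt (hΩ.mem_nhds (hs hx))

end WeakDirDeriv

theorem continuous_affineEquiv (Ψ : F ≃ᵃ[ℝ] G) : Continuous Ψ :=
  Ψ.toAffineMap.continuous_of_finiteDimensional

theorem affineEquiv_eq_add (Ψ : F ≃ᵃ[ℝ] G) :
    (Ψ : F → G) = (fun y => y + Ψ 0) ∘ Ψ.linear.toContinuousLinearEquiv := by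
  ext x
  have := Ψ.map_vadd 0 x
  simpa using this

theorem hasFDerivAt_affineEquiv (Ψ : F ≃ᵃ[ℝ] G) (x : F) :
    HasFDerivAt Ψ (Ψ.linear.toContinuousLinearEquiv : F →L[ℝ] G) x := by
  rw [affineEquiv_eq_add Ψ]
  exact (Ψ.linear.toContinuousLinearEquiv.hasFDerivAt).add_const _

theorem contDiff_affineEquiv {n : WithTop ℕ∞} (Ψ : F ≃ᵃ[ℝ] G) : ContDiff ℝ n Ψ := by
  rw [affineEquiv_eq_add Ψ]
  exact (contDiff_id.add contDiff_const).comp Ψ.linear.toContinuousLinearEquiv.contDiff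

/-- Uniqueness of Haar measure. The factor need not be computed as a determinant: it cancels in
averages, and elsewhere it is recovered by comparing the volumes of two known sets. -/
theorem exists_map_affineEquiv_volume (Ψ : F ≃ᵃ[ℝ] G) :
    ∃ c : ENNReal, c ≠ 0 ∧ c ≠ ⊤ ∧ Measure.map Ψ (volume : Measure F) = c • volume := by
  let L : F ≃L[ℝ] G := Ψ.linear.toContinuousLinearEquiv
  have : (Measure.map L (volume : Measure F)).IsAddHaarMeasure :=
    L.isAddHaarMeasure_map volume
  have h := Measure.isAddLeftInvariant_eq_smul (Measure.map L volume) (volume : Measure G)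
  have h0 := Measure.addHaarScalarFactor_pos_of_isAddHaarMeasure (Measure.map L volume)
    (volume : Measure G)
  refine ⟨_, ENNReal.coe_ne_zero.2 h0.ne', ENNReal.coe_ne_top, ?_⟩
  rw [affineEquiv_eq_add Ψ, ← Measure.map_map (measurable_add_const _) L.continuous.measurable]
  conv_lhs => rw [h]
  rw [Measure.map_smul, map_add_right_eq_self]
  rfl

theorem measurableEmbedding_affineEquiv (Ψ : F ≃ᵃ[ℝ] G) : MeasurableEmbedding Ψ :=
  (AffineEquiv.toContinuousAffineEquiv Ψ).toHomeomorph.measurableEmbedding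

theorem setIntegral_comp_affineEquiv (Ψ : F ≃ᵃ[ℝ] G) {c : ENNReal}
    (h : Measure.map Ψ (volume : Measure F) = c • volume) (s : Set G) (f : G → ℝ) :
    ∫ x in Ψ ⁻¹' s, f (Ψ x) = c.toReal * ∫ y in s, f y := by
  rw [← (measurableEmbedding_affineEquiv Ψ).setIntegral_map, h, Measure.restrict_smul,
    integral_smul_measure, smul_eq_mul]

theorem locallyIntegrableOn_comp_affineEquiv (Ψ : F ≃ᵃ[ℝ] G) {Ω : Set G} {f : G → ℝ}
    (hf : LocallyIntegrableOn f Ω) : LocallyIntegrableOn (f ∘ Ψ) (Ψ ⁻¹' Ω) := by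
  obtain ⟨c, h0, h1, h⟩ := exists_map_affineEquiv_volume Ψ
  intro x hx
  obtain ⟨u, hu, hu'⟩ := hf (Ψ x) hx
  refine ⟨Ψ ⁻¹' u, ?_, ?_⟩
  · exact (continuous_affineEquiv Ψ).continuousWithinAt.preimage_mem_nhdsWithin'' hu rfl
  · rw [IntegrableOn, ← (measurableEmbedding_affineEquiv Ψ).integrable_map_iff,
      ← (measurableEmbedding_affineEquiv Ψ).restrict_map, h, Measure.restrict_smul]
    exact hu'.smul_measure h1

/-- Test functions are transported by `Ψ.symm`, and both sides of the identity acquire the same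
volume factor. The direction moves by the linear part, which is why directional rather than partial
derivatives are the convenient notion. -/
theorem WeakDirDeriv.comp_affineEquiv (Ψ : F ≃ᵃ[ℝ] G) {Ω : Set G} {v : F} {f g : G → ℝ}
    (h : WeakDirDeriv Ω (Ψ.linear v) f g) : WeakDirDeriv (Ψ ⁻¹' Ω) v (f ∘ Ψ) (g ∘ Ψ) := by
  obtain ⟨c, h0, h1, hc⟩ := exists_map_affineEquiv_volume Ψ
  refine ⟨locallyIntegrableOn_comp_affineEquiv Ψ h.1,
    locallyIntegrableOn_comp_affineEquiv Ψ h.2.1, fun η hη hηc hs => ?_⟩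
  let e : F ≃ᴬ[ℝ] G := AffineEquiv.toContinuousAffineEquiv Ψ
  have hsymm : ContDiff ℝ ∞ Ψ.symm := contDiff_affineEquiv Ψ.symm
  set ζ : G → ℝ := η ∘ Ψ.symm with hζ
  have ηζ : ∀ x, η x = ζ (Ψ x) := fun x => by simp [hζ]
  have hζ1 : ContDiff ℝ ∞ ζ := hη.comp hsymm
  have hsupp : tsupport ζ = Ψ.symm ⁻¹' tsupport η := by
    exact tsupport_comp_eq_preimage η e.symm.toHomeomorph
  have hζ2 : HasCompactSupport ζ := hηc.comp_homeomorph e.symm.toHomeomorph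
  have hζ3 : tsupport ζ ⊆ Ω := by
    rw [hsupp]
    intro y hy
    simpa using hs hy
  have hd : ∀ x, fderiv ℝ η x v = fderiv ℝ ζ (Ψ x) (Ψ.linear v) := by
    intro x
    have h2 : HasFDerivAt (ζ ∘ Ψ) ((fderiv ℝ ζ (Ψ x)).comp
        (Ψ.linear.toContinuousLinearEquiv : F →L[ℝ] G)) x :=
      (hζ1.differentiable (by simp) _).hasFDerivAt.comp x (hasFDerivAt_affineEquiv Ψ x)
    have h3 : ζ ∘ Ψ = η := by ext x; simp [hζ]
    rw [h3] at h2
    rw [h2.fderiv]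
    rfl
  have key := h.2.2 ζ hζ1 hζ2 hζ3
  have a1 := setIntegral_comp_affineEquiv Ψ hc Ω (fun y => f y * fderiv ℝ ζ y (Ψ.linear v))
  have a2 := setIntegral_comp_affineEquiv Ψ hc Ω (fun y => g y * ζ y)
  simp only [hd, ηζ, Function.comp_apply]
  rw [a1, a2, key]; ring

theorem MemLp.comp_affineEquiv (Ψ : F ≃ᵃ[ℝ] G) {s : Set G} {f : G → ℝ} {p : ENNReal}
    (hf : MemLp f p (volume.restrict s)) : MemLp (f ∘ Ψ) p (volume.restrict (Ψ ⁻¹' s)) := by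
  obtain ⟨c, h0, h1, h⟩ := exists_map_affineEquiv_volume Ψ
  have he := measurableEmbedding_affineEquiv Ψ
  rw [← he.memLp_map_measure_iff, ← he.restrict_map, h, Measure.restrict_smul]
  exact hf.smul_measure h1

end WeakDirDeriv
end Morley

namespace Morley

/-! ### Multi-index derivatives as iterated directional derivatives -/

section MultiIndex
variable {d : ℕ} {Ω : Set (E d)}

theorem pderiv_contDiff {g : E d → ℝ} (hg : ContDiff ℝ ∞ g) (i : Fin d) :
    ContDiff ℝ ∞ (pderiv i g) :=
  (hg.fderiv_right (m := ∞) (by simp)).clm_apply contDiff_const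

theorem pderiv_comm {g : E d → ℝ} (hg : ContDiff ℝ ∞ g) (i j : Fin d) :
    pderiv i (pderiv j g) = pderiv j (pderiv i g) := by
  have key : ∀ (v w : E d) (x : E d), fderiv ℝ (fun y => fderiv ℝ g y v) x w =
      fderiv ℝ (fderiv ℝ g) x w v := by
    intro v w x
    have h1 : DifferentiableAt ℝ (fderiv ℝ g) x :=
      ((hg.fderiv_right (m := ∞) (by simp)).differentiable (by simp)) x
    rw [fderiv_clm_apply h1 (differentiableAt_const _)]
    simp
  ext x
  have hs : IsSymmSndFDerivAt ℝ g x := hg.contDiffAt.isSymmSndFDerivAt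
    (by simp only [minSmoothness_of_isRCLikeNormedField]; exact WithTop.coe_le_coe.2 le_top)
  unfold pderiv
  rw [key, key, hs.eq]

theorem iterate_pderiv_contDiff {g : E d → ℝ} (hg : ContDiff ℝ ∞ g) (i : Fin d) (n : ℕ) :
    ContDiff ℝ ∞ ((pderiv i)^[n] g) := by
  induction n generalizing g with
  | zero => exact hg
  | succ n ih => exact ih (pderiv_contDiff hg i)

theorem iterate_pderiv_comm {g : E d → ℝ} (hg : ContDiff ℝ ∞ g) (i j : Fin d) (n : ℕ) :
    (pderiv i)^[n] (pderiv j g) = pderiv j ((pderiv i)^[n] g) := by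
  induction n generalizing g with
  | zero => rfl
  | succ n ih =>
    rw [Function.iterate_succ_apply, pderiv_comm hg, ih (pderiv_contDiff hg i)]
    rfl

theorem foldr_pderiv_contDiff (l : List (Fin d)) (α : Fin d → ℕ) {g : E d → ℝ}
    (hg : ContDiff ℝ ∞ g) : ContDiff ℝ ∞ (l.foldr (fun i f => (pderiv i)^[α i] f) g) := by
  induction l with
  | nil => exact hg
  | cons j l ih => exact iterate_pderiv_contDiff ih j _

theorem foldr_pderiv_comm (l : List (Fin d)) (α : Fin d → ℕ) {g : E d → ℝ}
    (hg : ContDiff ℝ ∞ g) (i : Fin d) :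
    l.foldr (fun i f => (pderiv i)^[α i] f) (pderiv i g) =
      pderiv i (l.foldr (fun i f => (pderiv i)^[α i] f) g) := by
  induction l with
  | nil => rfl
  | cons j l ih =>
    simp only [List.foldr_cons]
    rw [ih, iterate_pderiv_comm (foldr_pderiv_contDiff l α hg)]

/-- The extra `pderiv i` sits at the position of `i` in the list and is pulled to the front by
symmetry of second derivatives; `Nodup` ensures that it is counted once. -/
theorem foldr_pderiv_add_unitIndex (l : List (Fin d)) (hl : l.Nodup) (α : Fin d → ℕ)
    {g : E d → ℝ} (hg : ContDiff ℝ ∞ g) (i : Fin d) :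
    l.foldr (fun k f => (pderiv k)^[(α + unitIndex i) k] f) g =
      if i ∈ l then pderiv i (l.foldr (fun k f => (pderiv k)^[α k] f) g)
      else l.foldr (fun k f => (pderiv k)^[α k] f) g := by
  induction l with
  | nil => simp
  | cons j l ih =>
    rw [List.nodup_cons] at hl
    have ih := ih hl.2
    simp only [List.foldr_cons, ih]
    have hc := foldr_pderiv_contDiff l α hg
    by_cases hij : j = i
    · subst hij
      simp only [hl.1, if_false, List.mem_cons, true_or, if_true]
      simp only [Pi.add_apply, unitIndex, Pi.single_eq_same, Function.iterate_succ_apply']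
    · have : (α + unitIndex i) j = α j := by simp [unitIndex, Pi.single_eq_of_ne hij]
      rw [this]
      by_cases hil : i ∈ l
      · simp only [hil, if_true, List.mem_cons, or_true]
        rw [iterate_pderiv_comm hc]
      · have : ¬ i ∈ j :: l := by simp [hil, Ne.symm hij]
        simp [hil, this]

theorem multiDeriv_contDiff (α : Fin d → ℕ) {g : E d → ℝ} (hg : ContDiff ℝ ∞ g) :
    ContDiff ℝ ∞ (multiDeriv α g) := foldr_pderiv_contDiff _ α hg

theorem multiDeriv_pderiv (α : Fin d → ℕ) {g : E d → ℝ} (hg : ContDiff ℝ ∞ g) (i : Fin d) :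
    multiDeriv α (pderiv i g) = pderiv i (multiDeriv α g) := foldr_pderiv_comm _ α hg i

theorem multiDeriv_add_unitIndex (α : Fin d → ℕ) {g : E d → ℝ} (hg : ContDiff ℝ ∞ g)
    (i : Fin d) : multiDeriv (α + unitIndex i) g = pderiv i (multiDeriv α g) := by
  have := foldr_pderiv_add_unitIndex (List.finRange d) (List.nodup_finRange d) α hg i
  simpa [multiDeriv] using this

theorem multiDeriv_zero (g : E d → ℝ) : multiDeriv 0 g = g := by
  have : ∀ l : List (Fin d), l.foldr (fun i f => (pderiv i)^[(0 : Fin d → ℕ) i] f) g = g := by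
    intro l
    induction l with
    | nil => rfl
    | cons j l ih => simp
  exact this _

theorem order_add (α β : Fin d → ℕ) : order (α + β) = order α + order β := by
  simp [order, Finset.sum_add_distrib]

theorem order_unitIndex (i : Fin d) : order (unitIndex i) = 1 := by
  simp [order, unitIndex]

theorem order_zero : order (0 : Fin d → ℕ) = 0 := by simp [order]

theorem exists_eq_add_unitIndex {α : Fin d → ℕ} {k : ℕ} (h : order α = k + 1) :
    ∃ (β : Fin d → ℕ) (i : Fin d), order β = k ∧ α = β + unitIndex i := by
  obtain ⟨i, hi⟩ : ∃ i, α i ≠ 0 := by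
    by_contra! hc
    simp [order, hc] at h
  have e : α = (α - unitIndex i) + unitIndex i := by
    ext j
    by_cases hj : j = i
    · subst hj; simp [unitIndex]; omega
    · simp [unitIndex, Pi.single_eq_of_ne hj]
  refine ⟨α - unitIndex i, i, ?_, e⟩
  have := order_add (α - unitIndex i) (unitIndex i)
  rw [← e, h, order_unitIndex] at this
  omega

theorem tsupport_multiDeriv_subset (α : Fin d → ℕ) (η : E d → ℝ) :
    tsupport (multiDeriv α η) ⊆ tsupport η := by
  have h1 : ∀ (i : Fin d) (n : ℕ) (f : E d → ℝ), tsupport ((pderiv i)^[n] f) ⊆ tsupport f := by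
    intro i n
    induction n with
    | zero => intro f; rfl
    | succ n ih => intro f; exact (ih _).trans (tsupport_fderiv_apply_subset ℝ _)
  have h2 : ∀ l : List (Fin d),
      tsupport (l.foldr (fun i f => (pderiv i)^[α i] f) η) ⊆ tsupport η := by
    intro l
    induction l with
    | nil => rfl
    | cons j l ih => exact (h1 _ _ _).trans ih
  exact h2 _

theorem testFunction_multiDeriv (α : Fin d → ℕ) {η : E d → ℝ} (hη : ContDiff ℝ ∞ η)
    (hc : HasCompactSupport η) :
    ContDiff ℝ ∞ (multiDeriv α η) ∧ HasCompactSupport (multiDeriv α η) ∧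
      tsupport (multiDeriv α η) ⊆ tsupport η :=
  ⟨multiDeriv_contDiff α hη, hc.of_isClosed_subset (isClosed_tsupport _)
    (tsupport_multiDeriv_subset α η), tsupport_multiDeriv_subset α η⟩

theorem hasWeakDeriv_zero {f : E d → ℝ} (hf : LocallyIntegrableOn f Ω) :
    HasWeakDeriv Ω 0 f f :=
  ⟨hf, hf, fun η _ _ _ => by simp [multiDeriv_zero, order_zero]⟩

namespace HasWeakDeriv

variable {α : Fin d → ℕ} {i : Fin d} {f g g' f' : E d → ℝ}

/-- Testing `∂^α f` against `∂_i η` and `∂^(α + e_i) f` against `η` gives the same left side; the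
signs differ by one factor `-1`. Together with the converse `comp_weakDirDeriv` this allows
derivatives to be taken one direction at a time. -/
theorem weakDirDeriv (h : HasWeakDeriv Ω α f g) (h' : HasWeakDeriv Ω (α + unitIndex i) f g') :
    WeakDirDeriv Ω (EuclideanSpace.single i 1) g g' := by
  refine ⟨h.2.1, h'.2.1, fun η hη hc hs => ?_⟩
  obtain ⟨a, b, c⟩ := testFunction_fderiv hη hc (EuclideanSpace.single i (1 : ℝ))
  have h1 := h.2.2 _ a b (c.trans hs)
  have h2 := h'.2.2 η hη hc hs
  have e : multiDeriv α (fun x => fderiv ℝ η x (EuclideanSpace.single i 1)) =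
      multiDeriv (α + unitIndex i) η := by
    rw [multiDeriv_add_unitIndex α hη, ← multiDeriv_pderiv α hη]; rfl
  rw [e, h2, order_add, order_unitIndex, pow_succ] at h1
  have h3 : ((-1 : ℝ) ^ order α) ≠ 0 := by simp
  apply mul_left_cancel₀ h3
  linear_combination -h1

theorem comp_weakDirDeriv (h : HasWeakDeriv Ω α f g)
    (h' : WeakDirDeriv Ω (EuclideanSpace.single i 1) g g') :
    HasWeakDeriv Ω (α + unitIndex i) f g' := by
  refine ⟨h.1, h'.2.1, fun η hη hc hs => ?_⟩
  obtain ⟨a, b, c⟩ := testFunction_fderiv hη hc (EuclideanSpace.single i (1 : ℝ))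
  have h1 := h.2.2 _ a b (c.trans hs)
  have e : multiDeriv α (fun x => fderiv ℝ η x (EuclideanSpace.single i 1)) =
      multiDeriv (α + unitIndex i) η := by
    rw [multiDeriv_add_unitIndex α hη, ← multiDeriv_pderiv α hη]; rfl
  rw [← e, h1, h'.2.2 η hη hc hs, order_add, order_unitIndex, pow_succ]
  ring

theorem ae_eq (hΩ : IsOpen Ω) (h : HasWeakDeriv Ω α f g) (h' : HasWeakDeriv Ω α f g') :
    g =ᵐ[volume.restrict Ω] g' := by
  refine ae_eq_of_forall_setIntegral_mul_eq hΩ h.2.1 h'.2.1 fun η hη hc hs => ?_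
  have := (h.2.2 η hη hc hs).symm.trans (h'.2.2 η hη hc hs)
  exact mul_left_cancel₀ (by simp) this

theorem congr_ae (h : HasWeakDeriv Ω α f g) (hf : f =ᵐ[volume.restrict Ω] f')
    (hg : g =ᵐ[volume.restrict Ω] g') : HasWeakDeriv Ω α f' g' := by
  refine ⟨locallyIntegrableOn_congr_ae hf h.1, locallyIntegrableOn_congr_ae hg h.2.1,
    fun η hη hc hs => ?_⟩
  have e1 : ∫ x in Ω, f' x * multiDeriv α η x = ∫ x in Ω, f x * multiDeriv α η x :=
    integral_congr_ae (by filter_upwards [hf] with x hx; rw [hx])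
  have e2 : ∫ x in Ω, g' x * η x = ∫ x in Ω, g x * η x :=
    integral_congr_ae (by filter_upwards [hg] with x hx; rw [hx])
  rw [e1, e2, h.2.2 η hη hc hs]

theorem hasWeakDeriv_weakDeriv (h : HasWeakDeriv Ω α f g) :
    HasWeakDeriv Ω α f (weakDeriv Ω α f) := by
  have hex : ∃ g, HasWeakDeriv Ω α f g := ⟨g, h⟩
  rw [weakDeriv, dif_pos hex]
  exact hex.choose_spec

theorem weakDeriv_ae_eq (hΩ : IsOpen Ω) (h : HasWeakDeriv Ω α f g) :
    weakDeriv Ω α f =ᵐ[volume.restrict Ω] g :=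
  h.hasWeakDeriv_weakDeriv.ae_eq hΩ h

theorem sub (h : HasWeakDeriv Ω α f g) (h' : HasWeakDeriv Ω α f' g') :
    HasWeakDeriv Ω α (fun x => f x - f' x) (fun x => g x - g' x) := by
  refine ⟨h.1.sub h'.1, h.2.1.sub h'.2.1, fun η hη hc hs => ?_⟩
  obtain ⟨a, b, c⟩ := testFunction_multiDeriv α hη hc
  simp only [sub_mul]
  have i1 : ∀ f : E d → ℝ, LocallyIntegrableOn f Ω →
      Integrable (fun x => f x * multiDeriv α η x) (volume.restrict Ω) := fun f hf =>
    (integrable_mul_of_tsupport_subset hf a.continuous b (c.trans hs)).restrict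
  have i2 : ∀ f : E d → ℝ, LocallyIntegrableOn f Ω →
      Integrable (fun x => f x * η x) (volume.restrict Ω) := fun f hf =>
    (integrable_mul_of_tsupport_subset hf hη.continuous hc hs).restrict
  rw [integral_sub (i1 _ h.1) (i1 _ h'.1), integral_sub (i2 _ h.2.1) (i2 _ h'.2.1), h.2.2 η hη hc hs,
    h'.2.2 η hη hc hs]
  ring

end HasWeakDeriv

theorem hasWeakDeriv_unitIndex_iff {i : Fin d} {f g : E d → ℝ} :
    HasWeakDeriv Ω (unitIndex i) f g ↔ WeakDirDeriv Ω (EuclideanSpace.single i 1) f g := by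
  constructor
  · intro h
    exact (hasWeakDeriv_zero h.1).weakDirDeriv (by simpa using h)
  · intro h
    simpa using (hasWeakDeriv_zero h.1).comp_weakDirDeriv h

theorem hasWeakDeriv_of_contDiff {f : E d → ℝ} (hΩ : IsOpen Ω) (hf : ContDiff ℝ ∞ f)
    (α : Fin d → ℕ) : HasWeakDeriv Ω α f (multiDeriv α f) := by
  induction hk : order α generalizing α with
  | zero =>
    have : α = 0 := by
      ext i
      simpa using (Finset.sum_eq_zero_iff.1 hk) i (Finset.mem_univ i)
    subst this
    rw [multiDeriv_zero]
    exact hasWeakDeriv_zero (hf.continuous.locallyIntegrable.locallyIntegrableOn Ω)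
  | succ k ih =>
    obtain ⟨β, i, hβ, rfl⟩ := exists_eq_add_unitIndex hk
    rw [multiDeriv_add_unitIndex β hf]
    refine (ih β hβ).comp_weakDirDeriv ?_
    exact WeakDirDeriv.of_contDiffOn hΩ
      ((multiDeriv_contDiff β hf).of_le (by simp)).contDiffOn _

end MultiIndex
end Morley

/-! ### The reference simplex -/

namespace Morley

/-- The simplex `{x ∈ ℝ^k | x_i ≥ 0, ∑ x_i ≤ 1}`. -/
def cornerSimplex (k : ℕ) : Set (Fin k → ℝ) := {x | (∀ i, 0 ≤ x i) ∧ ∑ i, x i ≤ 1}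

theorem isClosed_cornerSimplex (k : ℕ) : IsClosed (cornerSimplex k) := by
  have : cornerSimplex k = (⋂ i, {x | 0 ≤ x i}) ∩ {x | ∑ i, x i ≤ 1} := by
    ext x; simp [cornerSimplex]
  rw [this]
  refine (isClosed_iInter fun i => ?_).inter ?_
  · exact isClosed_le continuous_const (continuous_apply i)
  · exact isClosed_le (by fun_prop) continuous_const

theorem cornerSimplex_le_one {k : ℕ} {x : Fin k → ℝ} (hx : x ∈ cornerSimplex k) (i : Fin k) :
    x i ≤ 1 :=
  (Finset.single_le_sum (fun j _ => hx.1 j) (Finset.mem_univ i)).trans hx.2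

theorem isCompact_cornerSimplex (k : ℕ) : IsCompact (cornerSimplex k) := by
  refine (isCompact_Icc (a := (0 : Fin k → ℝ)) (b := 1)).of_isClosed_subset
    (isClosed_cornerSimplex k) fun x hx => ⟨fun i => hx.1 i, fun i => cornerSimplex_le_one hx i⟩

theorem convex_cornerSimplex (k : ℕ) : Convex ℝ (cornerSimplex k) := by
  intro x hx y hy a b ha hb hab
  refine ⟨fun i => ?_, ?_⟩
  · have := hx.1 i; have := hy.1 i
    simp only [Pi.add_apply, Pi.smul_apply, smul_eq_mul]; positivity
  · simp only [Pi.add_apply, Pi.smul_apply, smul_eq_mul, Finset.sum_add_distrib, ← Finset.mul_sum]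
    nlinarith [hx.2, hy.2]

/-- The open simplex `{x ∈ ℝ^k | x_i > 0, ∑ x_i < 1}`. -/
def openCornerSimplex (k : ℕ) : Set (Fin k → ℝ) := {x | (∀ i, 0 < x i) ∧ ∑ i, x i < 1}

theorem isOpen_openCornerSimplex (k : ℕ) : IsOpen (openCornerSimplex k) := by
  have : openCornerSimplex k = (⋂ i, {x | 0 < x i}) ∩ {x | ∑ i, x i < 1} := by
    ext x; simp [openCornerSimplex]
  rw [this]
  refine (isOpen_iInter_of_finite fun i => ?_).inter ?_
  · exact isOpen_lt continuous_const (continuous_apply i)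
  · exact isOpen_lt (by fun_prop) continuous_const

theorem openCornerSimplex_subset (k : ℕ) : openCornerSimplex k ⊆ cornerSimplex k :=
  fun _ hx => ⟨fun i => (hx.1 i).le, hx.2.le⟩

theorem barycenter_mem_openCornerSimplex (k : ℕ) :
    (fun _ => 1 / ((k : ℝ) + 1)) ∈ openCornerSimplex k := by
  refine ⟨fun i => by positivity, ?_⟩
  simp only [Finset.sum_const, Finset.card_univ, Fintype.card_fin, nsmul_eq_mul]
  rw [mul_one_div, div_lt_one (by positivity)]
  linarith

theorem interior_cornerSimplex (k : ℕ) : interior (cornerSimplex k) = openCornerSimplex k := by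
  apply subset_antisymm
  · intro x hx
    rw [mem_interior_iff_mem_nhds] at hx
    -- Move `x` along the diagonal `(1, …, 1)`: a small step backwards forces positive coordinates,
    -- a small step forwards forces the sum below `1`.
    have hc : Filter.Tendsto (fun t : ℝ => fun i => x i + t) (nhds 0) (nhds x) := by
      have : Continuous (fun t : ℝ => fun i => x i + t) := by fun_prop
      simpa using this.tendsto 0
    have h1 := hc.eventually hx
    obtain ⟨ε, hε, h⟩ := Metric.eventually_nhds_iff.1 h1
    have hp := h (y := ε / 2) (by simp [abs_of_pos hε]; linarith)
    have hm := h (y := -(ε / 2)) (by simp [abs_of_pos hε]; linarith)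
    have hx' : ∀ i, 0 < x i := fun i => by have := hm.1 i; simp at this; linarith
    refine ⟨hx', ?_⟩
    rcases Nat.eq_zero_or_pos k with rfl | hk
    · simp
    · have := hp.2
      simp only [Finset.sum_add_distrib, Finset.sum_const, Finset.card_univ, Fintype.card_fin,
        nsmul_eq_mul] at this
      have hk' : (0 : ℝ) < k := by exact_mod_cast hk
      nlinarith
  · exact interior_maximal (openCornerSimplex_subset k) (isOpen_openCornerSimplex k)

theorem volume_cornerSimplex_pos (k : ℕ) : 0 < volume (cornerSimplex k) :=
  ((isOpen_openCornerSimplex k).measure_pos volume ⟨_, barycenter_mem_openCornerSimplex k⟩).trans_le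
    (measure_mono (openCornerSimplex_subset k))

theorem volume_cornerSimplex_lt_top (k : ℕ) : volume (cornerSimplex k) < ⊤ :=
  (isCompact_cornerSimplex k).measure_lt_top

instance (k : ℕ) : IsFiniteMeasure (volume.restrict (cornerSimplex k)) :=
  ⟨by simpa using volume_cornerSimplex_lt_top k⟩

theorem measurableSet_cornerSimplex (k : ℕ) : MeasurableSet (cornerSimplex k) :=
  (isClosed_cornerSimplex k).measurableSet

/-! ### Sobolev and Poincaré inequalities for `C^1` functions on the reference simplex -/

section Sobolev
variable {d : ℕ}

/-- The sum of the absolute values of the first partial derivatives. -/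
noncomputable def gradSum (v : (Fin d → ℝ) → ℝ) (x : Fin d → ℝ) : ENNReal :=
  ∑ i, ‖fderiv ℝ v x (Pi.single i 1)‖ₑ

theorem continuous_gradSum {v : (Fin d → ℝ) → ℝ} (hv : ContDiff ℝ 1 v) :
    Continuous (gradSum v) := by
  have h := hv.continuous_fderiv (by simp)
  exact continuous_finsetSum _ fun i _ => ((h.clm_apply continuous_const).enorm)

theorem enorm_sub_le_lintegral_deriv {h : ℝ → ℝ} (hh : ContDiff ℝ 1 h) {a b : ℝ} (hab : a ≤ b) :
    ‖h a - h b‖ₑ ≤ ∫⁻ s in Set.Icc a b, ‖deriv h s‖ₑ := by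
  have hc := hh.continuous_deriv le_rfl
  have h1 : ∫ s in a..b, deriv h s = h b - h a :=
    intervalIntegral.integral_deriv_eq_sub (fun x _ => (hh.differentiable (by simp)) x)
      (hc.intervalIntegrable a b)
  rw [← enorm_neg, neg_sub, ← h1, intervalIntegral.integral_of_le hab,
    ← integral_Icc_eq_integral_Ioc]
  exact enorm_integral_le_lintegral_enorm _

/-- Average `|h a| ≤ |h s| + ∫ |h'|` over `s` in the interval. -/
theorem enorm_le_lintegral_Icc {h : ℝ → ℝ} (hh : ContDiff ℝ 1 h) (a : ℝ) {δ : ℝ} (hδ : 0 < δ) :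
    ‖h a‖ₑ ≤ ∫⁻ s in Set.Icc a (a + δ), (ENNReal.ofReal δ⁻¹ * ‖h s‖ₑ + ‖deriv h s‖ₑ) := by
  set D := ∫⁻ s in Set.Icc a (a + δ), ‖deriv h s‖ₑ with hD
  have h1 : ∀ s ∈ Set.Icc a (a + δ), ‖h a‖ₑ ≤ ‖h s‖ₑ + D := by
    intro s hs
    calc ‖h a‖ₑ = ‖h s + (h a - h s)‖ₑ := by congr 1; ring
      _ ≤ ‖h s‖ₑ + ‖h a - h s‖ₑ := enorm_add_le _ _
      _ ≤ ‖h s‖ₑ + D := by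
        gcongr
        refine (enorm_sub_le_lintegral_deriv hh hs.1).trans ?_
        exact lintegral_mono_set (Set.Icc_subset_Icc_right hs.2)
  have h2 : ∫⁻ s in Set.Icc a (a + δ), ‖h a‖ₑ ≤ ∫⁻ s in Set.Icc a (a + δ), (‖h s‖ₑ + D) :=
    setLIntegral_mono' measurableSet_Icc h1
  have hm : Measurable fun s => ‖h s‖ₑ := hh.continuous.measurable.enorm
  rw [setLIntegral_const, lintegral_add_left hm, setLIntegral_const, Real.volume_Icc,
    add_sub_cancel_left] at h2
  rw [lintegral_add_left (hm.const_mul _), lintegral_const_mul _ hm, ← hD]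
  have hδ' : ENNReal.ofReal δ⁻¹ * ENNReal.ofReal δ = 1 := by
    rw [← ENNReal.ofReal_mul (by positivity), inv_mul_cancel₀ hδ.ne', ENNReal.ofReal_one]
  calc ‖h a‖ₑ = ENNReal.ofReal δ⁻¹ * (‖h a‖ₑ * ENNReal.ofReal δ) := by
        rw [mul_comm ‖h a‖ₑ, ← mul_assoc, hδ', one_mul]
    _ ≤ ENNReal.ofReal δ⁻¹ * ((∫⁻ s in Set.Icc a (a + δ), ‖h s‖ₑ) + D * ENNReal.ofReal δ) := by
        gcongr
    _ = _ := by rw [mul_add, mul_comm D, ← mul_assoc _ _ D, hδ', one_mul]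

/-- Where the barycentric coordinate of the vertex `0` is at least `1/(d+1)`, a segment of that
length in every positive coordinate direction stays in the simplex. The integrand is extended by
zero to the whole line, the form needed by the grid-lines lemma. -/
theorem enorm_le_lintegral_update {w : (Fin d → ℝ) → ℝ} (hw : ContDiff ℝ 1 w) {x : Fin d → ℝ}
    (hx : x ∈ cornerSimplex d) (hx' : ∑ i, x i + 1 / ((d : ℝ) + 1) ≤ 1) (i : Fin d) :
    ‖w x‖ₑ ≤ ∫⁻ s, (cornerSimplex d).indicator
      (fun y => ENNReal.ofReal ((d : ℝ) + 1) * ‖w y‖ₑ + gradSum w y) (Function.update x i s) := by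
  set δ : ℝ := 1 / ((d : ℝ) + 1) with hδ
  have hδ0 : 0 < δ := by positivity
  have hu : ContDiff ℝ 1 (fun s : ℝ => Function.update x i s) := contDiff_update 1 x i
  have hd : ∀ s, deriv (fun s => w (Function.update x i s)) s =
      fderiv ℝ w (Function.update x i s) (Pi.single i 1) := by
    intro s
    have h1 := (hw.differentiable (by simp) (Function.update x i s)).hasFDerivAt
    exact (h1.comp_hasDerivAt s (hasDerivAt_update x i s)).deriv
  have key := enorm_le_lintegral_Icc (hw.comp hu) (x i) hδ0
  simp only [Function.comp_def, Function.update_eq_self] at key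
  refine key.trans ?_
  rw [← lintegral_indicator measurableSet_Icc]
  refine lintegral_mono fun s => ?_
  by_cases hs : s ∈ Set.Icc (x i) (x i + δ)
  · have hmem : Function.update x i s ∈ cornerSimplex d := by
      refine ⟨fun j => ?_, ?_⟩
      · by_cases hj : j = i
        · subst hj; simpa using (hx.1 j).trans hs.1
        · simpa [hj] using hx.1 j
      · have h1 := Finset.sum_update_of_mem (Finset.mem_univ i) x s
        have h2 := Finset.add_sum_erase Finset.univ x (Finset.mem_univ i)
        rw [Finset.sdiff_singleton_eq_erase] at h1
        rw [h1]
        linarith [hs.2]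
    rw [Set.indicator_of_mem hs, Set.indicator_of_mem hmem, hd]
    gcongr
    · rw [hδ]; simp
    · exact Finset.single_le_sum
        (f := fun j => ‖fderiv ℝ w (Function.update x i s) (Pi.single j 1)‖ₑ)
        (fun _ _ => zero_le) (Finset.mem_univ i)
  · rw [Set.indicator_of_notMem hs]; exact zero_le

/-- The Gagliardo-Nirenberg argument: `|w x|` is bounded by each of the `d` line integrals through
`x`, so `|w x|^(d/(d-1))` is bounded by the product of their powers `1/(d-1)`, and
`lintegral_prod_lintegral_pow_le` integrates this product. -/
theorem lintegral_corner_rpow_le (hd : 2 ≤ d) {w : (Fin d → ℝ) → ℝ} (hw : ContDiff ℝ 1 w) :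
    ∫⁻ x in {x ∈ cornerSimplex d | ∑ i, x i + 1 / ((d : ℝ) + 1) ≤ 1},
        ‖w x‖ₑ ^ ((d : ℝ) / (d - 1)) ≤
      (∫⁻ x in cornerSimplex d, (ENNReal.ofReal ((d : ℝ) + 1) * ‖w x‖ₑ + gradSum w x)) ^
        ((d : ℝ) / (d - 1)) := by
  have hd' : (2 : ℝ) ≤ d := by exact_mod_cast hd
  have hmeas : Measurable fun y : Fin d → ℝ =>
      ENNReal.ofReal ((d : ℝ) + 1) * ‖w y‖ₑ + gradSum w y :=
    (hw.continuous.measurable.enorm.const_mul _).add (continuous_gradSum hw).measurable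
  set f := (cornerSimplex d).indicator
      (fun y => ENNReal.ofReal ((d : ℝ) + 1) * ‖w y‖ₑ + gradSum w y) with hf
  have hfm : Measurable f := hmeas.indicator (measurableSet_cornerSimplex d)
  have hconj : Real.HolderConjugate (Fintype.card (Fin d)) ((d : ℝ) / (d - 1)) := by
    rw [Fintype.card_fin, Real.holderConjugate_iff]
    refine ⟨by linarith, ?_⟩
    have : (d : ℝ) ≠ 0 := by positivity
    have : (d : ℝ) - 1 ≠ 0 := by linarith
    field_simp; ring
  have key := lintegral_prod_lintegral_pow_le (fun _ : Fin d => (volume : Measure ℝ)) hconj hfm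
  rw [← volume_pi, hf, lintegral_indicator (measurableSet_cornerSimplex d), ← hf] at key
  refine le_trans ?_ key
  refine le_trans ?_
    (setLIntegral_le_lintegral {x ∈ cornerSimplex d | ∑ i, x i + 1 / ((d : ℝ) + 1) ≤ 1} _)
  refine setLIntegral_mono' ?_ fun x hx => ?_
  · have : IsClosed {x : Fin d → ℝ | ∑ i, x i + 1 / ((d : ℝ) + 1) ≤ 1} :=
      isClosed_le (by fun_prop) continuous_const
    exact (measurableSet_cornerSimplex d).inter this.measurableSet
  · have h1 : ∀ i, ‖w x‖ₑ ≤ ∫⁻ s, f (Function.update x i s) :=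
      enorm_le_lintegral_update hw hx.1 hx.2
    calc ‖w x‖ₑ ^ ((d : ℝ) / (d - 1))
        = ∏ _i : Fin d, ‖w x‖ₑ ^ ((1 : ℝ) / ((Fintype.card (Fin d) : ℝ) - 1)) := by
          rw [Finset.prod_const, Finset.card_univ, Fintype.card_fin, ← ENNReal.rpow_natCast,
            ← ENNReal.rpow_mul]
          congr 1; ring
      _ ≤ _ := by
          refine Finset.prod_le_prod' fun i _ => ENNReal.rpow_le_rpow (h1 i) ?_
          rw [Fintype.card_fin]
          have : (0 : ℝ) < d - 1 := by linarith
          positivity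

/-- The linear part of `cornerSwap`. -/
noncomputable def cornerSwapLinear (a : Fin d) : (Fin d → ℝ) →ₗ[ℝ] (Fin d → ℝ) where
  toFun x := x - (x a + ∑ i, x i) • (Pi.single a 1 : Fin d → ℝ)
  map_add' x y := by
    simp only [Pi.add_apply, Finset.sum_add_distrib]; module
  map_smul' c x := by
    simp only [Pi.smul_apply, smul_eq_mul, ← Finset.mul_sum, RingHom.id_apply]; module

theorem cornerSwapLinear_involutive (a : Fin d) : Function.Involutive (cornerSwapLinear a) := by
  intro x
  have hs : ∑ i, (Pi.single a (1 : ℝ) : Fin d → ℝ) i = 1 := by simp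
  simp only [cornerSwapLinear, LinearMap.coe_mk, AddHom.coe_mk, Pi.sub_apply, Pi.smul_apply,
    smul_eq_mul, Finset.sum_sub_distrib, ← Finset.mul_sum, hs, Pi.single_eq_same]
  module

/-- The affine involution of `cornerSimplex d` exchanging the vertices `0` and `e_a`. -/
noncomputable def cornerSwap (a : Fin d) : (Fin d → ℝ) ≃ᵃ[ℝ] (Fin d → ℝ) :=
  (LinearEquiv.ofInvolutive (cornerSwapLinear a)
    (cornerSwapLinear_involutive a)).toAffineEquiv.trans
    (AffineEquiv.constVAdd ℝ _ (Pi.single a 1))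

theorem cornerSwap_linear (a : Fin d) (x : Fin d → ℝ) :
    (cornerSwap a).linear x = x - (x a + ∑ i, x i) • (Pi.single a 1 : Fin d → ℝ) := by
  rfl

theorem cornerSwap_apply (a : Fin d) (x : Fin d → ℝ) :
    cornerSwap a x = x + (1 - x a - ∑ i, x i) • (Pi.single a 1 : Fin d → ℝ) := by
  ext j
  simp [cornerSwap, cornerSwapLinear]
  ring

theorem sum_cornerSwap (a : Fin d) (x : Fin d → ℝ) : ∑ i, cornerSwap a x i = 1 - x a := by
  simp [cornerSwap_apply, Finset.sum_add_distrib, ← Finset.mul_sum]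

theorem cornerSwap_mem_iff (a : Fin d) (x : Fin d → ℝ) :
    cornerSwap a x ∈ cornerSimplex d ↔ x ∈ cornerSimplex d := by
  have h1 : ∀ x, x ∈ cornerSimplex d → cornerSwap a x ∈ cornerSimplex d := by
    intro x hx
    refine ⟨fun j => ?_, ?_⟩
    · rw [cornerSwap_apply]
      by_cases hj : j = a
      · subst hj; have := hx.2; simp; linarith
      · simpa [hj] using hx.1 j
    · rw [sum_cornerSwap]; linarith [hx.1 a]
  refine ⟨fun h => ?_, h1 x⟩
  have := h1 _ h
  convert this using 1
  rw [cornerSwap_apply, sum_cornerSwap, cornerSwap_apply]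
  ext j
  simp; ring

/-- An affine map preserving a set of positive finite volume has volume factor `1`. -/
theorem lintegral_comp_of_preimage_cornerSimplex (Ψ : (Fin d → ℝ) ≃ᵃ[ℝ] (Fin d → ℝ))
    (hΨ : Ψ ⁻¹' cornerSimplex d = cornerSimplex d) (s : Set (Fin d → ℝ))
    (f : (Fin d → ℝ) → ENNReal) :
    ∫⁻ x in Ψ ⁻¹' s, f (Ψ x) = ∫⁻ x in s, f x := by
  obtain ⟨c, h0, h1, h⟩ := exists_map_affineEquiv_volume Ψ
  have he := measurableEmbedding_affineEquiv Ψ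
  have hc : c = 1 := by
    have h2 : Measure.map Ψ volume (cornerSimplex d) = (c • volume) (cornerSimplex d) := by rw [h]
    rw [he.map_apply, hΨ, Measure.smul_apply, smul_eq_mul] at h2
    have h3 := volume_cornerSimplex_pos d
    have h4 := volume_cornerSimplex_lt_top d
    exact ((ENNReal.mul_eq_right h3.ne' h4.ne).1 h2.symm)
  rw [← he.lintegral_map, ← he.restrict_map, h, hc, one_smul]

end Sobolev
end Morley

namespace Morley
section Sobolev
variable {d : ℕ}

/-- The linear part sends `e_a` to `-e_a` and every other `e_i` to `e_i - e_a`. -/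
theorem gradSum_comp_cornerSwap_le {w : (Fin d → ℝ) → ℝ} (hw : ContDiff ℝ 1 w) (a : Fin d)
    (x : Fin d → ℝ) :
    gradSum (w ∘ cornerSwap a) x ≤ ENNReal.ofReal ((d : ℝ) + 1) * gradSum w (cornerSwap a x) := by
  have hle : ∀ i, ‖fderiv ℝ w (cornerSwap a x) (Pi.single i 1)‖ₑ ≤ gradSum w (cornerSwap a x) :=
    fun i => Finset.single_le_sum
      (f := fun j => ‖fderiv ℝ w (cornerSwap a x) (Pi.single j 1)‖ₑ)
        (fun _ _ => zero_le) (Finset.mem_univ i)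
  have h1 : ∀ i, ‖fderiv ℝ (w ∘ cornerSwap a) x (Pi.single i 1)‖ₑ ≤
      ‖fderiv ℝ w (cornerSwap a x) (Pi.single i 1)‖ₑ + gradSum w (cornerSwap a x) := by
    intro i
    have h2 := ((hw.differentiable (by simp) (cornerSwap a x)).hasFDerivAt).comp x
      (hasFDerivAt_affineEquiv (cornerSwap a) x)
    rw [h2.fderiv]
    have h3 : ((cornerSwap a).linear.toContinuousLinearEquiv :
        (Fin d → ℝ) →L[ℝ] (Fin d → ℝ)) (Pi.single i 1) =
        (cornerSwap a).linear (Pi.single i 1) := rfl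
    rw [ContinuousLinearMap.comp_apply, h3, cornerSwap_linear]
    by_cases hi : i = a
    · subst hi
      have : (Pi.single i 1 : Fin d → ℝ) - ((Pi.single i 1 : Fin d → ℝ) i +
          ∑ j, (Pi.single i 1 : Fin d → ℝ) j) • Pi.single i 1 = -Pi.single i 1 := by
        simp only [Pi.single_eq_same, Finset.sum_pi_single', Finset.mem_univ, if_true]
        module
      rw [this, map_neg, enorm_neg]
      exact le_self_add
    · have : (Pi.single i 1 : Fin d → ℝ) - ((Pi.single i 1 : Fin d → ℝ) a +
          ∑ j, (Pi.single i 1 : Fin d → ℝ) j) • Pi.single a 1 =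
          Pi.single i 1 + -Pi.single a 1 := by
        simp only [Pi.single_eq_of_ne (Ne.symm hi), Finset.sum_pi_single', Finset.mem_univ, if_true]
        module
      rw [this, map_add, map_neg]
      refine (enorm_add_le _ _).trans ?_
      rw [enorm_neg]
      gcongr
      exact hle a
  calc gradSum (w ∘ cornerSwap a) x ≤ ∑ i, (‖fderiv ℝ w (cornerSwap a x) (Pi.single i 1)‖ₑ +
        gradSum w (cornerSwap a x)) := Finset.sum_le_sum fun i _ => h1 i
    _ = gradSum w (cornerSwap a x) + d * gradSum w (cornerSwap a x) := by
      rw [Finset.sum_add_distrib]; simp [gradSum]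
    _ = _ := by
      rw [ENNReal.ofReal_add (by positivity) zero_le_one, ENNReal.ofReal_natCast,
        ENNReal.ofReal_one]; ring

/-- The part of the simplex where the barycentric coordinate of the vertex `0` is not small. -/
def cornerPart (d : ℕ) : Set (Fin d → ℝ) :=
  {x ∈ cornerSimplex d | ∑ i, x i + 1 / ((d : ℝ) + 1) ≤ 1}

/-- The `d + 1` barycentric coordinates sum to `1`, so one of them is at least `1/(d+1)`. -/
theorem cornerSimplex_subset_iUnion (d : ℕ) :
    cornerSimplex d ⊆ cornerPart d ∪ ⋃ a : Fin d, cornerSwap a ⁻¹' cornerPart d := by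
  intro x hx
  by_contra hc
  simp only [Set.mem_union, Set.mem_iUnion, Set.mem_preimage, not_or, not_exists, cornerPart,
    Set.mem_ofPred_eq, not_and, not_le, cornerSwap_mem_iff, sum_cornerSwap] at hc
  have h0 := hc.1 hx
  have h1 := fun a => hc.2 a hx
  have h2 : ∑ a, x a ≤ ∑ _a : Fin d, 1 / ((d : ℝ) + 1) :=
    Finset.sum_le_sum fun a _ => by linarith [h1 a]
  simp only [Finset.sum_const, Finset.card_univ, Fintype.card_fin, nsmul_eq_mul] at h2
  have h3 : (d : ℝ) * (1 / (d + 1)) + 1 / ((d : ℝ) + 1) = 1 := by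
    have : (d : ℝ) + 1 ≠ 0 := by positivity
    field_simp
  linarith

/-- The case of exponent `1`: each of the `d + 1` pieces of the cover is carried by a vertex swap to
the corner at `0`, at the cost of the factor `d + 1` on the gradient. -/
theorem lintegral_rpow_le_gradSum (hd : 2 ≤ d) {w : (Fin d → ℝ) → ℝ} (hw : ContDiff ℝ 1 w) :
    ∫⁻ x in cornerSimplex d, ‖w x‖ₑ ^ ((d : ℝ) / (d - 1)) ≤
      (d + 1) * (ENNReal.ofReal ((d : ℝ) + 1) *
        ∫⁻ x in cornerSimplex d, (‖w x‖ₑ + gradSum w x)) ^ ((d : ℝ) / (d - 1)) := by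
  have hd' : (2 : ℝ) ≤ d := by exact_mod_cast hd
  have hκ : 0 ≤ (d : ℝ) / (d - 1) := div_nonneg (by linarith) (by linarith)
  set κ := (d : ℝ) / (d - 1)
  set K := ENNReal.ofReal ((d : ℝ) + 1) with hK
  have hK1 : 1 ≤ K := by rw [hK, ENNReal.one_le_ofReal]; linarith
  have hm : Measurable fun x => ‖w x‖ₑ + gradSum w x :=
    hw.continuous.measurable.enorm.add (continuous_gradSum hw).measurable
  rw [← lintegral_const_mul _ hm]
  set R := ∫⁻ x in cornerSimplex d, K * (‖w x‖ₑ + gradSum w x)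
  have h0 : ∫⁻ x in cornerPart d, ‖w x‖ₑ ^ κ ≤ R ^ κ := by
    refine (lintegral_corner_rpow_le hd hw).trans ?_
    refine ENNReal.rpow_le_rpow (lintegral_mono fun x => ?_) hκ
    rw [mul_add]
    gcongr
    exact le_mul_of_one_le_left zero_le hK1
  have h1 : ∀ a : Fin d, ∫⁻ x in cornerSwap a ⁻¹' cornerPart d, ‖w x‖ₑ ^ κ ≤ R ^ κ := by
    intro a
    have hpre : cornerSwap a ⁻¹' cornerSimplex d = cornerSimplex d :=
      Set.ext fun x => cornerSwap_mem_iff a x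
    have hinv : ∀ x, cornerSwap a (cornerSwap a x) = x := by
      intro x
      rw [cornerSwap_apply, sum_cornerSwap, cornerSwap_apply]
      ext j
      simp; ring
    have e1 : ∫⁻ x in cornerSwap a ⁻¹' cornerPart d, ‖w x‖ₑ ^ κ =
        ∫⁻ x in cornerPart d, ‖(w ∘ cornerSwap a) x‖ₑ ^ κ := by
      rw [← lintegral_comp_of_preimage_cornerSimplex (cornerSwap a) hpre (cornerPart d)
        (fun x => ‖(w ∘ cornerSwap a) x‖ₑ ^ κ)]
      simp only [Function.comp_apply, hinv]
    rw [e1]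
    refine (lintegral_corner_rpow_le hd
      (hw.comp (contDiff_affineEquiv (cornerSwap a)))).trans ?_
    refine ENNReal.rpow_le_rpow ?_ hκ
    have e2 : R = ∫⁻ x in cornerSwap a ⁻¹' cornerSimplex d,
        K * (‖w (cornerSwap a x)‖ₑ + gradSum w (cornerSwap a x)) :=
      (lintegral_comp_of_preimage_cornerSimplex (cornerSwap a) hpre _
        (fun x => K * (‖w x‖ₑ + gradSum w x))).symm
    rw [e2, hpre]
    refine lintegral_mono fun x => ?_
    rw [mul_add]
    gcongr
    · exact le_rfl
    · exact gradSum_comp_cornerSwap_le hw a x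
  calc ∫⁻ x in cornerSimplex d, ‖w x‖ₑ ^ κ
      ≤ ∫⁻ x in cornerPart d ∪ ⋃ a : Fin d, cornerSwap a ⁻¹' cornerPart d, ‖w x‖ₑ ^ κ :=
        lintegral_mono_set (cornerSimplex_subset_iUnion d)
    _ ≤ (∫⁻ x in cornerPart d, ‖w x‖ₑ ^ κ) +
        ∫⁻ x in ⋃ a : Fin d, cornerSwap a ⁻¹' cornerPart d, ‖w x‖ₑ ^ κ :=
        lintegral_union_le _ _ _
    _ ≤ R ^ κ + ∑ _a : Fin d, R ^ κ := by
        gcongr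
        refine (lintegral_iUnion_le _ _).trans ?_
        rw [tsum_fintype]
        exact Finset.sum_le_sum fun a _ => h1 a
    _ = (d + 1) * R ^ κ := by simp; ring

/-- Chain rule; `γ > 1` keeps `|v|^γ` differentiable at the zeros of `v`. -/
theorem gradSum_abs_rpow_le {v : (Fin d → ℝ) → ℝ} (hv : ContDiff ℝ 1 v) {γ : ℝ} (hγ : 1 < γ)
    (x : Fin d → ℝ) :
    gradSum (fun x => ‖v x‖ ^ γ) x ≤ ENNReal.ofReal γ * (‖v x‖ₑ ^ (γ - 1) * gradSum v x) := by
  unfold gradSum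
  rw [Finset.mul_sum, Finset.mul_sum]
  refine Finset.sum_le_sum fun i _ => ?_
  have h1 : HasDerivAt (fun t : ℝ => ‖t‖ ^ γ) (γ * |v x| ^ (γ - 2) * v x) (v x) :=
    hasDerivAt_abs_rpow (v x) hγ
  have h2 := h1.comp_hasFDerivAt x (hv.differentiable (by simp) x).hasFDerivAt
  have h3 : fderiv ℝ (fun x => ‖v x‖ ^ γ) x = (γ * |v x| ^ (γ - 2) * v x) • fderiv ℝ v x :=
    h2.fderiv
  rw [h3, smul_apply, smul_eq_mul, enorm_mul, ← mul_assoc]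
  gcongr
  rw [enorm_mul, enorm_mul, Real.enorm_of_nonneg (by linarith : 0 ≤ γ), mul_assoc]
  gcongr
  rw [Real.enorm_of_nonneg (by positivity), ← ofReal_norm (v x), Real.norm_eq_abs,
    ← ENNReal.ofReal_mul (by positivity), ENNReal.ofReal_rpow_of_nonneg (by positivity) (by linarith)]
  apply ENNReal.ofReal_le_ofReal
  rcases eq_or_ne (v x) 0 with h | h
  · simp [h]; positivity
  · have hp : 0 < |v x| := abs_pos.2 h
    rw [← Real.rpow_add_one hp.ne']
    apply le_of_eq; congr 1; ring

end Sobolev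
end Morley

namespace Morley

theorem lintegral_rpow_rpow_le_of_le {α : Type*} [MeasurableSpace α] {μ : Measure α}
    {f : α → ENNReal} (hf : AEMeasurable f μ) {a b : ℝ} (ha : 0 < a) (hab : a ≤ b) :
    (∫⁻ x, f x ^ a ∂μ) ^ (1 / a) ≤
      (∫⁻ x, f x ^ b ∂μ) ^ (1 / b) * μ Set.univ ^ (1 / a - 1 / b) := by
  have := eLpNorm'_le_eLpNorm'_mul_rpow_measure_univ (μ := μ) (f := f) ha hab
    hf.aestronglyMeasurable
  simpa [eLpNorm'] using this

section Sobolev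
variable {d : ℕ}

theorem lintegral_enorm_rpow_lt_top {v : (Fin d → ℝ) → ℝ} (hv : Continuous v) {q : ℝ}
    (hq : 0 ≤ q) : ∫⁻ x in cornerSimplex d, ‖v x‖ₑ ^ q < ⊤ := by
  have h := (isCompact_cornerSimplex d).exists_bound_of_continuousOn hv.continuousOn
  obtain ⟨C, hC⟩ := h
  calc ∫⁻ x in cornerSimplex d, ‖v x‖ₑ ^ q
      ≤ ∫⁻ x in cornerSimplex d, ENNReal.ofReal C ^ q := by
        refine setLIntegral_mono' (measurableSet_cornerSimplex d) fun x hx => ?_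
        gcongr
        rw [← ofReal_norm]
        exact ENNReal.ofReal_le_ofReal (hC x hx)
    _ < ⊤ := by
        rw [setLIntegral_const]
        exact ENNReal.mul_lt_top (ENNReal.rpow_lt_top_of_nonneg hq ENNReal.ofReal_ne_top)
          (volume_cornerSimplex_lt_top d)

/-- The inequality for exponent `1`, applied to `|v|^γ`, followed by Hölder with exponents `p/(p-1)`
and `p`. The case `p = 1` is separate because the conjugate exponent degenerates. -/
theorem exists_sobolev_critical (hd : 2 ≤ d) {p : ℝ} (hp : 1 ≤ p) (hpd : p < d) :
    ∃ C : ENNReal, C ≠ ⊤ ∧ ∀ v : (Fin d → ℝ) → ℝ, ContDiff ℝ 1 v →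
      (∫⁻ x in cornerSimplex d, ‖v x‖ₑ ^ (d * p / (d - p))) ^ (1 / (d * p / (d - p))) ≤
        C * (∫⁻ x in cornerSimplex d, (‖v x‖ₑ + gradSum v x) ^ p) ^ (1 / p) := by
  have hd' : (2 : ℝ) ≤ d := by exact_mod_cast hd
  have hκ0 : 0 < (d : ℝ) / (d - 1) := div_pos (by linarith) (by linarith)
  have hdp : 0 < (d : ℝ) - p := by linarith
  have hd1 : 0 < (d : ℝ) - 1 := by linarith
  have hp0 : 0 < p := by linarith
  have hd0 : (0 : ℝ) < d := by linarith
  have root : ∀ {X Z : ENNReal}, X ≤ (d + 1) * Z ^ ((d : ℝ) / (d - 1)) →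
      X ^ (1 / ((d : ℝ) / (d - 1))) ≤ (d + 1) ^ (1 / ((d : ℝ) / (d - 1))) * Z := by
    intro X Z h
    calc X ^ (1 / ((d : ℝ) / (d - 1)))
        ≤ ((d + 1) * Z ^ ((d : ℝ) / (d - 1))) ^ (1 / ((d : ℝ) / (d - 1))) := by gcongr
      _ = _ := by
        rw [ENNReal.mul_rpow_of_nonneg _ _ (by positivity), ← ENNReal.rpow_mul,
          mul_one_div_cancel hκ0.ne', ENNReal.rpow_one]
  set A : ENNReal := (d + 1) ^ (1 / ((d : ℝ) / (d - 1))) with hA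
  have hAtop : A ≠ ⊤ := ENNReal.rpow_ne_top_of_nonneg (by positivity) (by simp)
  set K := ENNReal.ofReal ((d : ℝ) + 1) with hK
  rcases hp.eq_or_lt with rfl | hp1
  · refine ⟨A * K, ENNReal.mul_ne_top hAtop ENNReal.ofReal_ne_top, fun v hv => ?_⟩
    have := root (lintegral_rpow_le_gradSum hd hv)
    simp only [mul_one, ENNReal.rpow_one, ne_eq, one_ne_zero, not_false_eq_true, div_self] at this ⊢
    rwa [mul_assoc]
  -- This `γ` solves `γ d/(d-1) = (γ-1) p/(p-1)`, and the common value is the critical exponent `q`: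
  -- the same integral `X` then appears on both sides.
  set γ : ℝ := p * (d - 1) / (d - p) with hγ
  have hγ1 : 1 < γ := by
    rw [hγ, lt_div_iff₀ hdp]; nlinarith
  set q : ℝ := d * p / (d - p) with hq
  have hq0 : 0 < q := by positivity
  set κ : ℝ := (d : ℝ) / (d - 1) with hκ
  have hγκ : γ * κ = q := by rw [hγ, hκ, hq]; field_simp
  have hconj : Real.HolderConjugate (p / (p - 1)) p := by
    rw [Real.holderConjugate_iff]
    refine ⟨by rw [lt_div_iff₀ (by linarith)]; linarith, ?_⟩
    have : p - 1 ≠ 0 := by linarith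
    field_simp; ring
  have hγq : (γ - 1) * (p / (p - 1)) = q := by
    have : p - 1 ≠ 0 := by linarith
    rw [hγ, hq]; field_simp; ring
  have hexp : 1 / κ - 1 / (p / (p - 1)) = 1 / q := by
    have : p - 1 ≠ 0 := by linarith
    rw [hκ, hq]; field_simp; ring
  refine ⟨A * (K * ENNReal.ofReal γ), ENNReal.mul_ne_top hAtop
    (ENNReal.mul_ne_top ENNReal.ofReal_ne_top ENNReal.ofReal_ne_top), fun v hv => ?_⟩
  set X := ∫⁻ x in cornerSimplex d, ‖v x‖ₑ ^ q with hX
  -- Finiteness of `X`, and `X ≠ 0` below, allow the power of `X` on the right to be divided out at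
  -- the end.
  have hXtop : X ≠ ⊤ := (lintegral_enorm_rpow_lt_top hv.continuous hq0.le).ne
  rcases eq_or_ne X 0 with hX0 | hX0
  · rw [hX0, ENNReal.zero_rpow_of_pos (by positivity)]; exact zero_le
  have hw : ContDiff ℝ 1 (fun x => ‖v x‖ ^ γ) := hv.norm_rpow hγ1
  have hwe : ∀ x, ‖‖v x‖ ^ γ‖ₑ = ‖v x‖ₑ ^ γ := by
    intro x
    rw [Real.enorm_of_nonneg (by positivity), ← ofReal_norm (v x),
      ENNReal.ofReal_rpow_of_nonneg (by positivity) (by linarith)]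
  have h1 := lintegral_rpow_le_gradSum hd hw
  simp only [hwe, ← ENNReal.rpow_mul] at h1
  rw [← hκ, hγκ, ← hX] at h1
  have h2 := root h1
  have hm : Measurable fun x => ‖v x‖ₑ + gradSum v x :=
    hv.continuous.measurable.enorm.add (continuous_gradSum hv).measurable
  have hm' : Measurable fun x => ‖v x‖ₑ ^ (γ - 1) :=
    hv.continuous.measurable.enorm.pow_const _
  have h3 : ∫⁻ x in cornerSimplex d, (‖v x‖ₑ ^ γ + gradSum (fun x => ‖v x‖ ^ γ) x) ≤
      ENNReal.ofReal γ * (X ^ (1 / (p / (p - 1))) *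
        (∫⁻ x in cornerSimplex d, (‖v x‖ₑ + gradSum v x) ^ p) ^ (1 / p)) := by
    have h4 := ENNReal.lintegral_mul_le_Lp_mul_Lq (volume.restrict (cornerSimplex d)) hconj
      hm'.aemeasurable hm.aemeasurable
    simp only [← ENNReal.rpow_mul, hγq, Pi.mul_apply] at h4
    refine le_trans ?_ (mul_le_mul_right h4 (ENNReal.ofReal γ))
    have hmm : Measurable fun x => ‖v x‖ₑ ^ (γ - 1) * (‖v x‖ₑ + gradSum v x) := hm'.mul hm
    rw [← lintegral_const_mul _ hmm]
    refine lintegral_mono fun x => ?_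
    rw [mul_add, mul_add]
    gcongr
    · have h5 : ‖v x‖ₑ ^ γ = ‖v x‖ₑ ^ (γ - 1) * ‖v x‖ₑ := by
        nth_rewrite 3 [← ENNReal.rpow_one ‖v x‖ₑ]
        rw [← ENNReal.rpow_add_of_nonneg _ _ (by linarith) zero_le_one]
        congr 1; ring
      rw [h5]
      refine le_mul_of_one_le_left zero_le ?_
      rw [ENNReal.one_le_ofReal]; exact hγ1.le
    · exact gradSum_abs_rpow_le hv hγ1 x
  set Y := (∫⁻ x in cornerSimplex d, (‖v x‖ₑ + gradSum v x) ^ p) ^ (1 / p)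
  have h6 : X ^ (1 / κ) ≤ A * (K * ENNReal.ofReal γ) * Y * X ^ (1 / (p / (p - 1))) := by
    refine h2.trans ?_
    calc A * (K * ∫⁻ x in cornerSimplex d, (‖v x‖ₑ ^ γ + gradSum (fun x => ‖v x‖ ^ γ) x))
        ≤ A * (K * (ENNReal.ofReal γ * (X ^ (1 / (p / (p - 1))) * Y))) := by gcongr
      _ = _ := by ring
  rw [← hexp, ENNReal.rpow_sub _ _ hX0 hXtop]
  exact ENNReal.div_le_of_le_mul h6

/-- Reduction to the critical case on a set of finite measure: lower `p` to some `r < d` whose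
critical exponent is still at least `q`. -/
theorem exists_sobolev (hd : 2 ≤ d) {p q : ℝ} (hp : 1 ≤ p) (hq : 1 ≤ q)
    (hpq : -(d / q : ℝ) ≤ 1 - d / p) :
    ∃ C : ENNReal, C ≠ ⊤ ∧ ∀ v : (Fin d → ℝ) → ℝ, ContDiff ℝ 1 v →
      (∫⁻ x in cornerSimplex d, ‖v x‖ₑ ^ q) ^ (1 / q) ≤
        C * (∫⁻ x in cornerSimplex d, (‖v x‖ₑ + gradSum v x) ^ p) ^ (1 / p) := by
  have hd' : (2 : ℝ) ≤ d := by exact_mod_cast hd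
  have hd0 : (0 : ℝ) < d := by linarith
  have hd1 : (0 : ℝ) < d - 1 := by linarith
  have hp0 : 0 < p := by linarith
  have hq0 : 0 < q := by linarith
  -- If `q ≤ d/(d-1)` then `r = 1` suffices. Otherwise `r = dq/(d+q)` has critical exponent exactly
  -- `q`, and `r ≤ p` is the embedding condition `hpq`.
  obtain ⟨r, hr1, hrp, hrd, hqr⟩ : ∃ r : ℝ, 1 ≤ r ∧ r ≤ p ∧ r < d ∧ q ≤ d * r / (d - r) := by
    by_cases h : q * (d - 1) ≤ d
    · refine ⟨1, le_rfl, hp, by linarith, ?_⟩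
      rw [le_div_iff₀ hd1]; linarith
    · push Not at h
      have hdq : 0 < d + q := by positivity
      refine ⟨d * q / (d + q), ?_, ?_, ?_, ?_⟩
      · rw [le_div_iff₀ hdq]; linarith
      · rw [div_le_iff₀ hdq]
        have h1 : -(d / q : ℝ) * (p * q) ≤ (1 - d / p) * (p * q) :=
          mul_le_mul_of_nonneg_right hpq (by positivity)
        have h2 : -(d / q : ℝ) * (p * q) = -(d * p) := by field_simp
        have h3 : (1 - d / p) * (p * q) = p * q - d * q := by field_simp
        linarith
      · rw [div_lt_iff₀ hdq]; nlinarith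
      · have h1 : (d : ℝ) - d * q / (d + q) = d ^ 2 / (d + q) := by field_simp; ring
        rw [h1]
        apply le_of_eq
        field_simp
  obtain ⟨C, hC, h⟩ := exists_sobolev_critical hd hr1 hrd
  have hr0 : 0 < r := by linarith
  set Q := d * r / (d - r) with hQ
  set V := volume (cornerSimplex d) with hV
  have hVt : V ≠ ⊤ := (volume_cornerSimplex_lt_top d).ne
  have hV0 : V ≠ 0 := (volume_cornerSimplex_pos d).ne'
  refine ⟨C * V ^ (1 / r - 1 / p) * V ^ (1 / q - 1 / Q), ENNReal.mul_ne_top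
    (ENNReal.mul_ne_top hC (ENNReal.rpow_ne_top_of_ne_zero hV0 hVt))
    (ENNReal.rpow_ne_top_of_ne_zero hV0 hVt), fun v hv => ?_⟩
  have hm : Measurable fun x => ‖v x‖ₑ + gradSum v x :=
    hv.continuous.measurable.enorm.add (continuous_gradSum hv).measurable
  have h1 := lintegral_rpow_rpow_le_of_le (μ := volume.restrict (cornerSimplex d))
    hv.continuous.measurable.enorm.aemeasurable hq0 hqr
  have h2 := lintegral_rpow_rpow_le_of_le (μ := volume.restrict (cornerSimplex d))
    hm.aemeasurable hr0 hrp
  rw [Measure.restrict_apply_univ, ← hV] at h1 h2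
  calc _ ≤ _ := h1
    _ ≤ C * ((∫⁻ x in cornerSimplex d, (‖v x‖ₑ + gradSum v x) ^ p) ^ (1 / p) *
          V ^ (1 / r - 1 / p)) * V ^ (1 / q - 1 / Q) := by
        gcongr
        exact (h v hv).trans (by gcongr)
    _ = _ := by ring

/-- Fundamental theorem of calculus along the segment; inside the simplex each `|y i - x i|` is at
most `1`. -/
theorem enorm_sub_le_lintegral_gradSum {v : (Fin d → ℝ) → ℝ} (hv : ContDiff ℝ 1 v)
    {x y : Fin d → ℝ} (hx : x ∈ cornerSimplex d) (hy : y ∈ cornerSimplex d) :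
    ‖v x - v y‖ₑ ≤ ∫⁻ t in Set.Icc (0 : ℝ) 1, gradSum v ((1 - t) • x + t • y) := by
  have hline : ∀ t : ℝ, HasDerivAt (fun t : ℝ => (1 - t) • x + t • y) (y - x) t := by
    intro t
    have h1 := ((hasDerivAt_id t).smul_const (y - x)).const_add x
    have e : (fun t : ℝ => (1 - t) • x + t • y) = fun t : ℝ => x + id t • (y - x) := by
      funext t; simp only [id]; module
    rw [e]
    simpa using h1
  have hc : ContDiff ℝ 1 (fun t : ℝ => (1 - t) • x + t • y) := by fun_prop
  have h1 := enorm_sub_le_lintegral_deriv (hv.comp hc) zero_le_one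
  simp only [Function.comp_apply, sub_zero, one_smul, zero_smul, add_zero, sub_self,
    zero_add] at h1
  refine h1.trans (lintegral_mono fun t => ?_)
  have h2 := ((hv.differentiable (by simp) ((1 - t) • x + t • y)).hasFDerivAt).comp_hasDerivAt t
    (hline t)
  rw [h2.deriv]
  have h3 : y - x = ∑ i, (y i - x i) • (Pi.single i 1 : Fin d → ℝ) := by
    ext j; simp [Finset.sum_apply, Pi.single_apply]
  rw [h3, map_sum]
  refine (enorm_sum_le _ _).trans ?_
  refine Finset.sum_le_sum fun i _ => ?_
  rw [map_smul, smul_eq_mul, enorm_mul]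
  refine mul_le_of_le_one_left zero_le ?_
  rw [← ofReal_norm, ENNReal.ofReal_le_one, Real.norm_eq_abs, abs_le]
  have := hx.1 i; have := hy.1 i
  have := cornerSimplex_le_one hx i; have := cornerSimplex_le_one hy i
  constructor <;> linarith

/-- The Jacobian of the substitution is `a^(-d) ≤ 2^d`. -/
theorem setLIntegral_comp_smul_add_le {H : (Fin d → ℝ) → ENNReal} (hH : Measurable H) {a : ℝ}
    (ha : 1 / 2 ≤ a) (z : Fin d → ℝ) {s : Set (Fin d → ℝ)} (hs : MeasurableSet s)
    (h : ∀ x ∈ s, a • x + z ∈ s) :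
    ∫⁻ x in s, H (a • x + z) ≤ 2 ^ d * ∫⁻ x in s, H x := by
  have ha0 : 0 < a := by linarith
  set F := s.indicator H
  have hF : Measurable F := hH.indicator hs
  have h1 : ∫⁻ x in s, H (a • x + z) ≤ ∫⁻ x, F (a • x + z) := by
    rw [← lintegral_indicator hs]
    refine lintegral_mono fun x => ?_
    by_cases hx : x ∈ s
    · rw [Set.indicator_of_mem hx]
      exact (Set.indicator_of_mem (h x hx) H).ge
    · rw [Set.indicator_of_notMem hx]; exact zero_le
  have h2 : ∫⁻ x, F (a • x + z) = ENNReal.ofReal |(a ^ d)⁻¹| * ∫⁻ x, F x := by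
    have h3 := Measure.map_addHaar_smul (volume : Measure (Fin d → ℝ)) ha0.ne'
    have h4 : ∫⁻ x, F (a • x + z) =
        ∫⁻ y, F (y + z) ∂(Measure.map (fun x => a • x) (volume : Measure (Fin d → ℝ))) := by
      have hFz : Measurable fun y => F (y + z) := hF.comp (measurable_add_const z)
      rw [lintegral_map hFz (measurable_const_smul a)]
    rw [h4, h3, lintegral_smul_measure, lintegral_add_right_eq_self, Module.finrank_fin_fun,
      smul_eq_mul]
  rw [h2, lintegral_indicator hs] at h1
  refine h1.trans ?_
  gcongr
  rw [abs_of_pos (by positivity), ← inv_pow, ENNReal.ofReal_pow (by positivity)]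
  gcongr
  rw [show (2 : ENNReal) = ENNReal.ofReal 2 by simp]
  apply ENNReal.ofReal_le_ofReal
  rw [inv_le_comm₀ ha0 two_pos]; linarith

theorem lintegral_lintegral_segment_swap {G : (Fin d → ℝ) → ENNReal} (hG : Continuous G) (p : ℝ)
    {μ : Measure (Fin d → ℝ)} [SFinite μ] {ν : Measure ℝ} [SFinite ν] :
    ∫⁻ x, (∫⁻ y, (∫⁻ t, G ((1 - t) • x + t • y) ^ p ∂ν) ∂μ) ∂μ =
      ∫⁻ t, (∫⁻ x, (∫⁻ y, G ((1 - t) • x + t • y) ^ p ∂μ) ∂μ) ∂ν := by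
  have e1 : ∀ x, ∫⁻ y, (∫⁻ t, G ((1 - t) • x + t • y) ^ p ∂ν) ∂μ =
      ∫⁻ t, (∫⁻ y, G ((1 - t) • x + t • y) ^ p ∂μ) ∂ν := by
    intro x
    refine lintegral_lintegral_swap ?_
    have hc : Continuous fun z : (Fin d → ℝ) × ℝ => G ((1 - z.2) • x + z.2 • z.1) :=
      hG.comp (by fun_prop)
    exact (hc.measurable.pow_const p).aemeasurable
  simp only [e1]
  refine lintegral_lintegral_swap ?_
  have hc : Continuous fun z : ((Fin d → ℝ) × ℝ) × (Fin d → ℝ) =>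
      G ((1 - z.1.2) • z.1.1 + z.1.2 • z.2) := hG.comp (by fun_prop)
  exact ((hc.measurable.pow_const p).lintegral_prod_right' (ν := μ)).aemeasurable

/-- Poincaré's inequality on a convex set, in a form without mean values: bound `|v x - v y|` by the
gradient on the segment, apply Jensen in the parameter `t`, and exchange the integrals. -/
theorem lintegral_lintegral_enorm_sub_rpow_le {p : ℝ} (hp : 1 ≤ p) {v : (Fin d → ℝ) → ℝ}
    (hv : ContDiff ℝ 1 v) :
    ∫⁻ x in cornerSimplex d, ∫⁻ y in cornerSimplex d, ‖v x - v y‖ₑ ^ p ≤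
      volume (cornerSimplex d) * (2 ^ d * ∫⁻ x in cornerSimplex d, gradSum v x ^ p) := by
  have hp0 : 0 < p := by linarith
  have hG := continuous_gradSum hv
  set μ := volume.restrict (cornerSimplex d) with hμ
  set I := ∫⁻ x, gradSum v x ^ p ∂μ with hI
  have hmG : Measurable fun x => gradSum v x ^ p := hG.measurable.pow_const _
  have hpt : ∀ x ∈ cornerSimplex d, ∀ y ∈ cornerSimplex d, ‖v x - v y‖ₑ ^ p ≤
      ∫⁻ t in Set.Icc (0 : ℝ) 1, gradSum v ((1 - t) • x + t • y) ^ p := by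
    intro x hx y hy
    have hmeas : Measurable fun t : ℝ => gradSum v ((1 - t) • x + t • y) :=
      (hG.comp (by fun_prop)).measurable
    have h1 := lintegral_rpow_rpow_le_of_le (μ := volume.restrict (Set.Icc (0 : ℝ) 1))
      hmeas.aemeasurable zero_lt_one hp
    simp only [ENNReal.rpow_one, Measure.restrict_apply_univ, Real.volume_Icc, sub_zero,
      ENNReal.ofReal_one, ENNReal.one_rpow, mul_one, ne_eq, one_ne_zero, not_false_eq_true,
      div_self] at h1
    calc ‖v x - v y‖ₑ ^ p ≤ ((∫⁻ t in Set.Icc (0 : ℝ) 1,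
          gradSum v ((1 - t) • x + t • y) ^ p) ^ (1 / p)) ^ p := by
          gcongr
          exact (enorm_sub_le_lintegral_gradSum hv hx hy).trans h1
      _ = _ := by rw [← ENNReal.rpow_mul, one_div_mul_cancel hp0.ne', ENNReal.rpow_one]
  calc ∫⁻ x, ∫⁻ y, ‖v x - v y‖ₑ ^ p ∂μ ∂μ
      ≤ ∫⁻ x, ∫⁻ y, (∫⁻ t in Set.Icc (0 : ℝ) 1, gradSum v ((1 - t) • x + t • y) ^ p) ∂μ ∂μ :=
        setLIntegral_mono' (measurableSet_cornerSimplex d) fun x hx =>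
          setLIntegral_mono' (measurableSet_cornerSimplex d) fun y hy => hpt x hx y hy
    _ = ∫⁻ t in Set.Icc (0 : ℝ) 1, ∫⁻ x, ∫⁻ y, gradSum v ((1 - t) • x + t • y) ^ p ∂μ ∂μ :=
        lintegral_lintegral_segment_swap hG p
    _ ≤ ∫⁻ t in Set.Icc (0 : ℝ) 1, volume (cornerSimplex d) * (2 ^ d * I) := by
        refine setLIntegral_mono' measurableSet_Icc fun t ht => ?_
        have hmem : ∀ x ∈ cornerSimplex d, ∀ y ∈ cornerSimplex d,
            (1 - t) • x + t • y ∈ cornerSimplex d := fun x hx y hy =>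
          convex_cornerSimplex d hx hy (by linarith [ht.2]) ht.1 (by ring)
        have hconst : ∫⁻ _x : Fin d → ℝ, 2 ^ d * I ∂μ = volume (cornerSimplex d) * (2 ^ d * I) := by
          rw [lintegral_const, hμ, Measure.restrict_apply_univ, mul_comm]
        rw [← hconst]
        -- Substitute in the endpoint with the larger weight, `1 - t` for `x` or `t` for `y`, so
        -- that the Jacobian stays bounded by `2^d`.
        by_cases h : t ≤ 1 / 2
        · have hswap : Measurable (Function.uncurry fun x y : Fin d → ℝ =>
              gradSum v ((1 - t) • x + t • y) ^ p) := by
            have hct : Continuous fun z : (Fin d → ℝ) × (Fin d → ℝ) =>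
                gradSum v ((1 - t) • z.1 + t • z.2) := hG.comp (by fun_prop)
            exact hct.measurable.pow_const p
          rw [lintegral_lintegral_swap hswap.aemeasurable]
          refine setLIntegral_mono' (measurableSet_cornerSimplex d) fun y hy => ?_
          exact setLIntegral_comp_smul_add_le (H := fun x => gradSum v x ^ p) hmG
            (by linarith : 1 / 2 ≤ 1 - t) (t • y)
            (measurableSet_cornerSimplex d) fun x hx => hmem x hx y hy
        · refine setLIntegral_mono' (measurableSet_cornerSimplex d) fun x hx => ?_
          simp only [add_comm ((1 - t) • x)]
          refine setLIntegral_comp_smul_add_le (H := fun x => gradSum v x ^ p) hmG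
            (by linarith : 1 / 2 ≤ t) ((1 - t) • x)
            (measurableSet_cornerSimplex d) fun y hy => ?_
          rw [add_comm]
          exact hmem x hx y hy
    _ = _ := by simp

/-- Sobolev's inequality for `v` minus a constant, whose zero-order term is absorbed by Poincaré.
The double integral on the left needs no mean value and passes to limits by Fatou's lemma. -/
theorem exists_sobolev_poincare (hd : 2 ≤ d) {p q : ℝ} (hp : 1 ≤ p) (hq : 1 ≤ q)
    (hpq : -(d / q : ℝ) ≤ 1 - d / p) :
    ∃ C : ENNReal, C ≠ ⊤ ∧ ∀ v : (Fin d → ℝ) → ℝ, ContDiff ℝ 1 v →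
      ∫⁻ x in cornerSimplex d, ∫⁻ y in cornerSimplex d, ‖v x - v y‖ₑ ^ q ≤
        C * (∫⁻ x in cornerSimplex d, gradSum v x ^ p) ^ (q / p) := by
  have hp0 : 0 < p := by linarith
  have hq0 : 0 < q := by linarith
  obtain ⟨C, hC, h⟩ := exists_sobolev hd hp hq hpq
  set V := volume (cornerSimplex d) with hV
  have hVt : V ≠ ⊤ := (volume_cornerSimplex_lt_top d).ne
  have hV0 : V ≠ 0 := (volume_cornerSimplex_pos d).ne'
  set B : ENNReal := (2 ^ d) ^ (1 / p) + 1 with hB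
  have hBt : B ≠ ⊤ := by
    simp only [hB, ne_eq, ENNReal.add_eq_top, ENNReal.one_ne_top, or_false]
    exact ENNReal.rpow_ne_top_of_nonneg (by positivity) (by simp)
  refine ⟨2 ^ (q - 1) * (2 * V) * (C * B) ^ q, ?_, fun v hv => ?_⟩
  · refine ENNReal.mul_ne_top (ENNReal.mul_ne_top ?_ (ENNReal.mul_ne_top (by simp) hVt)) ?_
    · exact ENNReal.rpow_ne_top_of_nonneg (by linarith) (by simp)
    · exact ENNReal.rpow_ne_top_of_nonneg hq0.le (ENNReal.mul_ne_top hC hBt)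
  set I := ∫⁻ x in cornerSimplex d, gradSum v x ^ p with hI
  have hG := (continuous_gradSum hv).measurable
  -- Some value of a function does not exceed its mean, so a good constant to subtract is a value `v
  -- y₀` of `v` itself.
  obtain ⟨y₀, hy₀, hle⟩ : ∃ y₀ ∈ cornerSimplex d,
      ∫⁻ x in cornerSimplex d, ‖v x - v y₀‖ₑ ^ p ≤ 2 ^ d * I := by
    have hmeas : Measurable fun z : (Fin d → ℝ) × (Fin d → ℝ) => ‖v z.2 - v z.1‖ₑ ^ p := by
      have : Continuous fun z : (Fin d → ℝ) × (Fin d → ℝ) => v z.2 - v z.1 :=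
        (hv.continuous.comp continuous_snd).sub (hv.continuous.comp continuous_fst)
      exact this.measurable.enorm.pow_const _
    obtain ⟨y, hy, h1⟩ := exists_le_setLAverage (μ := volume) (s := cornerSimplex d)
      (f := fun y => ∫⁻ x in cornerSimplex d, ‖v x - v y‖ₑ ^ p) hV0 hVt
      hmeas.lintegral_prod_right.aemeasurable
    refine ⟨y, hy, h1.trans ?_⟩
    rw [setLAverage_eq, lintegral_lintegral_swap hmeas.aemeasurable]
    refine ENNReal.div_le_of_le_mul ?_
    rw [mul_comm (2 ^ d * I)]
    exact lintegral_lintegral_enorm_sub_rpow_le hp hv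
  set w := fun x => v x - v y₀ with hw
  have hwc : ContDiff ℝ 1 w := hv.sub contDiff_const
  have hgw : gradSum w = gradSum v := by
    ext x; simp [gradSum, hw, fderiv_sub_const]
  have h1 : (∫⁻ x in cornerSimplex d, ‖w x‖ₑ ^ q) ^ (1 / q) ≤ C * B * I ^ (1 / p) := by
    refine (h w hwc).trans ?_
    rw [hgw, mul_assoc]
    gcongr
    refine (ENNReal.lintegral_Lp_add_le hwc.continuous.measurable.enorm.aemeasurable
      hG.aemeasurable hp).trans ?_
    rw [hB, add_mul, one_mul, ← ENNReal.mul_rpow_of_nonneg _ _ (by positivity)]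
    gcongr
  set X := ∫⁻ x in cornerSimplex d, ‖w x‖ₑ ^ q with hX
  have h2 : X ≤ (C * B) ^ q * I ^ (q / p) := by
    calc X = (X ^ (1 / q)) ^ q := by
          rw [← ENNReal.rpow_mul, one_div_mul_cancel hq0.ne', ENNReal.rpow_one]
      _ ≤ (C * B * I ^ (1 / p)) ^ q := by gcongr
      _ = _ := by
        rw [ENNReal.mul_rpow_of_nonneg _ _ hq0.le, ← ENNReal.rpow_mul]
        congr 2; ring
  have hmw : Measurable fun x => ‖w x‖ₑ ^ q := hwc.continuous.measurable.enorm.pow_const _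
  calc ∫⁻ x in cornerSimplex d, ∫⁻ y in cornerSimplex d, ‖v x - v y‖ₑ ^ q
      ≤ ∫⁻ x in cornerSimplex d, ∫⁻ y in cornerSimplex d,
          2 ^ (q - 1) * (‖w x‖ₑ ^ q + ‖w y‖ₑ ^ q) := by
        refine lintegral_mono fun x => lintegral_mono fun y => ?_
        refine le_trans ?_ (ENNReal.rpow_add_le_mul_rpow_add_rpow _ _ hq)
        gcongr
        have : v x - v y = w x - w y := by simp [hw]
        rw [this]
        exact enorm_sub_le
    _ = 2 ^ (q - 1) * (2 * V) * X := by
        have e1 : ∀ x, ∫⁻ y in cornerSimplex d, 2 ^ (q - 1) * (‖w x‖ₑ ^ q + ‖w y‖ₑ ^ q) =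
            2 ^ (q - 1) * (‖w x‖ₑ ^ q * V + X) := by
          intro x
          have hm1 : Measurable fun y => ‖w x‖ₑ ^ q + ‖w y‖ₑ ^ q := measurable_const.add hmw
          rw [lintegral_const_mul _ hm1,
            lintegral_add_left measurable_const, setLIntegral_const]
        simp only [e1]
        have hm2 : Measurable fun x => ‖w x‖ₑ ^ q * V + X :=
          (hmw.mul_const _).add measurable_const
        rw [lintegral_const_mul _ hm2,
          lintegral_add_right _ measurable_const, lintegral_mul_const _ hmw, setLIntegral_const]
        ring
    _ ≤ 2 ^ (q - 1) * (2 * V) * ((C * B) ^ q * I ^ (q / p)) := by gcongr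
    _ = _ := by ring

end Sobolev
end Morley

open scoped Convolution

namespace Morley

/-! ### Mollification, and the passage to weakly differentiable functions -/

section Mollifier
variable {F : Type*} [NormedAddCommGroup F] [NormedSpace ℝ F] [FiniteDimensional ℝ F]
  [MeasureSpace F] [BorelSpace F] [(volume : Measure F).IsAddHaarMeasure]

/-- The mollification of `f` by a normalized bump function. -/
noncomputable def mollify (φ : ContDiffBump (0 : F)) (f : F → ℝ) : F → ℝ :=
  φ.normed volume ⋆[ContinuousLinearMap.lsmul ℝ ℝ, volume] f

theorem mollify_apply (φ : ContDiffBump (0 : F)) (f : F → ℝ) (x : F) :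
    mollify φ f x = ∫ y, φ.normed volume (x - y) * f y := by
  rw [mollify, convolution_eq_swap]
  rfl

theorem contDiff_mollify (φ : ContDiffBump (0 : F)) {f : F → ℝ} (hf : LocallyIntegrable f) :
    ContDiff ℝ 1 (mollify φ f) :=
  φ.hasCompactSupport_normed.contDiff_convolution_left (n := 1) _ φ.contDiff_normed hf

theorem fderiv_mollify (φ : ContDiffBump (0 : F)) {f : F → ℝ} (hf : LocallyIntegrable f)
    (x v : F) :
    fderiv ℝ (mollify φ f) x v = ∫ y, fderiv ℝ (φ.normed volume) (x - y) v * f y := by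
  have hc : ContDiff ℝ 1 (φ.normed (volume : Measure F)) := φ.contDiff_normed (n := 1)
  have h := φ.hasCompactSupport_normed.hasFDerivAt_convolution_left (μ := volume)
    (ContinuousLinearMap.lsmul ℝ ℝ) hc hf x
  have hex : ConvolutionExistsAt (fderiv ℝ (φ.normed (volume : Measure F))) f x
      (ContinuousLinearMap.precompL F (ContinuousLinearMap.lsmul ℝ ℝ)) volume :=
    HasCompactSupport.convolutionExists_left _ (φ.hasCompactSupport_normed.fderiv ℝ)
      (hc.continuous_fderiv (by simp)) hf x
  have h' : fderiv ℝ (mollify φ f) x = _ := h.fderiv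
  rw [h', convolution_eq_swap, ContinuousLinearMap.integral_apply]
  · rfl
  · exact hex.integrable_swap

/-- If the ball around `x` lies in `Ω`, then `y ↦ φ (x - y)` is an admissible test function. The
sign from differentiating `x - y` cancels the sign of the weak derivative. -/
theorem fderiv_mollify_indicator {Ω : Set F} (hΩ : IsOpen Ω) {f g : F → ℝ} {v : F}
    (h : WeakDirDeriv Ω v f g) (hf : IntegrableOn f Ω) (φ : ContDiffBump (0 : F)) {x : F}
    (hx : Metric.closedBall x φ.rOut ⊆ Ω) :
    fderiv ℝ (mollify φ (Ω.indicator f)) x v = mollify φ (Ω.indicator g) x := by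
  have hfi : LocallyIntegrable (Ω.indicator f) :=
    ((integrable_indicator_iff hΩ.measurableSet).2 hf).locallyIntegrable
  rw [fderiv_mollify φ hfi, mollify_apply]
  have hc : ContDiff ℝ ∞ (φ.normed (volume : Measure F)) := φ.contDiff_normed (n := ⊤)
  set η : F → ℝ := fun y => φ.normed volume (x - y) with hη
  have hηc : ContDiff ℝ ∞ η := hc.comp (contDiff_const.sub contDiff_id)
  have hsupp : tsupport η ⊆ Metric.closedBall x φ.rOut := by
    refine closure_minimal (fun y hy => ?_) Metric.isClosed_closedBall
    have h1 : x - y ∈ Function.support (φ.normed (volume : Measure F)) := hy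
    rw [φ.support_normed_eq, mem_ball_zero_iff] at h1
    rw [Metric.mem_closedBall, dist_comm, dist_eq_norm]
    exact h1.le
  have hηs : HasCompactSupport η :=
    (isCompact_closedBall x φ.rOut).of_isClosed_subset (isClosed_tsupport η) hsupp
  have hd : ∀ y, fderiv ℝ η y v = -fderiv ℝ (φ.normed volume) (x - y) v := by
    intro y
    have h1 := ((hc.differentiable (by simp) (x - y)).hasFDerivAt).comp y
      ((hasFDerivAt_id y).const_sub x)
    have h2 : fderiv ℝ η y = _ := h1.fderiv
    rw [h2]; simp
  have key := h.2.2 η hηc hηs (hsupp.trans hx)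
  have e1 : ∫ y, fderiv ℝ (φ.normed volume) (x - y) v * Ω.indicator f y =
      -∫ y in Ω, f y * fderiv ℝ η y v := by
    rw [← integral_neg, ← integral_indicator hΩ.measurableSet]
    congr 1; ext y
    by_cases hy : y ∈ Ω
    · simp only [Set.indicator_of_mem hy, hd]; ring
    · simp [Set.indicator_of_notMem hy]
  have e2 : ∫ y, φ.normed volume (x - y) * Ω.indicator g y = ∫ y in Ω, g y * η y := by
    rw [← integral_indicator hΩ.measurableSet]
    congr 1; ext y
    by_cases hy : y ∈ Ω
    · simp only [Set.indicator_of_mem hy, hη]; ring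
    · simp [Set.indicator_of_notMem hy]
  rw [e1, e2, key, neg_neg]

theorem enorm_mollify_le (φ : ContDiffBump (0 : F)) (f : F → ℝ) (x : F) :
    ‖mollify φ f x‖ₑ ≤ ∫⁻ y, ENNReal.ofReal (φ.normed volume (x - y)) * ‖f y‖ₑ := by
  rw [mollify_apply]
  refine (enorm_integral_le_lintegral_enorm _).trans (lintegral_mono fun y => ?_)
  rw [enorm_mul, Real.enorm_of_nonneg (φ.nonneg_normed _)]

theorem lintegral_ofReal_normed (φ : ContDiffBump (0 : F)) :
    ∫⁻ x, ENNReal.ofReal (φ.normed (volume : Measure F) x) = 1 := by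
  rw [← ofReal_integral_eq_lintegral_ofReal φ.integrable_normed
    (Filter.Eventually.of_forall fun x => φ.nonneg_normed x), φ.integral_normed,
    ENNReal.ofReal_one]

/-- Young's inequality for a probability kernel: Jensen for the measure `k (x - y) dy`, then
Tonelli. -/
theorem lintegral_convolution_rpow_le {k Γ : F → ENNReal} (hk : Measurable k)
    (hk1 : ∫⁻ x, k x = 1) (hΓ : Measurable Γ) {p : ℝ} (hp : 1 ≤ p) :
    ∫⁻ x, (∫⁻ y, k (x - y) * Γ y) ^ p ≤ ∫⁻ y, Γ y ^ p := by
  have hp0 : 0 < p := by linarith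
  have h1 : ∀ x, (∫⁻ y, k (x - y) * Γ y) ^ p ≤ ∫⁻ y, k (x - y) * Γ y ^ p := by
    intro x
    have hkx : Measurable fun y => k (x - y) := hk.comp (measurable_const.sub measurable_id)
    have h2 := lintegral_rpow_rpow_le_of_le (μ := (volume : Measure F).withDensity
      (fun y => k (x - y))) hΓ.aemeasurable zero_lt_one hp
    have h3 : (volume : Measure F).withDensity (fun y => k (x - y)) Set.univ = 1 := by
      rw [withDensity_apply _ MeasurableSet.univ, Measure.restrict_univ,
        lintegral_sub_left_eq_self k x, hk1]
    rw [h3, ENNReal.one_rpow, mul_one] at h2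
    simp only [ENNReal.rpow_one, div_one] at h2
    rw [lintegral_withDensity_eq_lintegral_mul _ hkx hΓ,
      lintegral_withDensity_eq_lintegral_mul _ hkx (hΓ.pow_const p)] at h2
    calc _ ≤ ((∫⁻ y, k (x - y) * Γ y ^ p) ^ (1 / p)) ^ p := by
          gcongr
          exact h2
      _ = _ := by rw [← ENNReal.rpow_mul, one_div_mul_cancel hp0.ne', ENNReal.rpow_one]
  refine (lintegral_mono h1).trans ?_
  rw [lintegral_lintegral_swap]
  · refine lintegral_mono fun y => ?_
    have hky : Measurable fun x => k (x - y) := hk.comp (measurable_id.sub measurable_const)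
    rw [lintegral_mul_const _ hky, lintegral_sub_right_eq_self k y, hk1, one_mul]
  · have : Measurable fun z : F × F => k (z.1 - z.2) * Γ z.2 ^ p :=
      (hk.comp (measurable_fst.sub measurable_snd)).mul
        ((hΓ.comp measurable_snd).pow_const p)
    exact this.aemeasurable

end Mollifier

/-- A sequence of bump functions with supports shrinking to `0`. -/
noncomputable def shrinkingBump (F : Type*) [NormedAddCommGroup F] (n : ℕ) :
    ContDiffBump (0 : F) where
  rIn := 1 / ((n : ℝ) + 1)
  rOut := 2 / ((n : ℝ) + 1)
  rIn_pos := by positivity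
  rIn_lt_rOut := by gcongr; norm_num

theorem tendsto_rOut_shrinkingBump (F : Type*) [NormedAddCommGroup F] :
    Filter.Tendsto (fun n => (shrinkingBump F n).rOut) Filter.atTop (nhds 0) := by
  have := (tendsto_one_div_add_atTop_nhds_zero_nat (𝕜 := ℝ)).const_mul 2
  simpa [shrinkingBump, mul_one_div, div_eq_mul_inv] using this

section Pi
variable {d : ℕ}

theorem gradSum_mollify_le {Ω : Set (Fin d → ℝ)} (hΩ : IsOpen Ω) {v : (Fin d → ℝ) → ℝ}
    {g : Fin d → (Fin d → ℝ) → ℝ} (h : ∀ i, WeakDirDeriv Ω (Pi.single i 1) v (g i))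
    (hv : IntegrableOn v Ω) (hg : ∀ i, Measurable (g i)) (φ : ContDiffBump (0 : Fin d → ℝ))
    {x : Fin d → ℝ} (hx : Metric.closedBall x φ.rOut ⊆ Ω) :
    gradSum (mollify φ (Ω.indicator v)) x ≤
      ∫⁻ y, ENNReal.ofReal (φ.normed volume (x - y)) * Ω.indicator (fun y => ∑ i, ‖g i y‖ₑ) y := by
  have hm : ∀ i, Measurable fun y =>
      ENNReal.ofReal (φ.normed volume (x - y)) * ‖Ω.indicator (g i) y‖ₑ := fun i =>
    ((φ.continuous_normed.measurable.comp (measurable_const.sub measurable_id)).ennreal_ofReal).mul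
      ((hg i).indicator hΩ.measurableSet).enorm
  calc gradSum (mollify φ (Ω.indicator v)) x
      = ∑ i, ‖mollify φ (Ω.indicator (g i)) x‖ₑ := by
        refine Finset.sum_congr rfl fun i _ => ?_
        rw [fderiv_mollify_indicator hΩ (h i) hv φ hx]
    _ ≤ ∑ i, ∫⁻ y, ENNReal.ofReal (φ.normed volume (x - y)) * ‖Ω.indicator (g i) y‖ₑ :=
        Finset.sum_le_sum fun i _ => enorm_mollify_le _ _ _
    _ = ∫⁻ y, ∑ i, ENNReal.ofReal (φ.normed volume (x - y)) * ‖Ω.indicator (g i) y‖ₑ := by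
        rw [lintegral_finsetSum _ fun i _ => hm i]
    _ = _ := by
        refine lintegral_congr fun y => ?_
        by_cases hy : y ∈ Ω
        · simp [Set.indicator_of_mem hy, Finset.mul_sum]
        · simp [Set.indicator_of_notMem hy]

/-- The homothety with ratio `t` centred at the barycenter of `cornerSimplex d`. -/
noncomputable def shrink (d : ℕ) (t : ℝ) (x : Fin d → ℝ) : Fin d → ℝ :=
  t • x + (1 - t) • fun _ => 1 / ((d : ℝ) + 1)

theorem shrink_mem {t : ℝ} (h0 : 0 ≤ t) (h1 : t < 1) {x : Fin d → ℝ} (hx : x ∈ cornerSimplex d) :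
    shrink d t x ∈ openCornerSimplex d := by
  have hb := barycenter_mem_openCornerSimplex d
  refine ⟨fun i => ?_, ?_⟩
  · have := hx.1 i; have h2 := hb.1 i
    simp only [shrink, Pi.add_apply, Pi.smul_apply, smul_eq_mul]
    have : 0 < (1 - t) * (1 / ((d : ℝ) + 1)) := mul_pos (by linarith) h2
    have : 0 ≤ t * x i := by positivity
    linarith
  · have h2 := hb.2
    simp only [shrink, Pi.add_apply, Pi.smul_apply, smul_eq_mul, Finset.sum_add_distrib,
      ← Finset.mul_sum] at h2 ⊢
    have h3 : t * ∑ i, x i ≤ t * 1 := mul_le_mul_of_nonneg_left hx.2 h0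
    have h4 : (1 - t) * ∑ _i : Fin d, (1 / ((d : ℝ) + 1)) < (1 - t) * 1 :=
      mul_lt_mul_of_pos_left h2 (by linarith)
    linarith

theorem continuous_shrink (d : ℕ) (t : ℝ) : Continuous (shrink d t) := by
  unfold shrink; fun_prop

/-- `shrink` as an affine equivalence. -/
noncomputable def shrinkEquiv (d : ℕ) {t : ℝ} (ht : t ≠ 0) : (Fin d → ℝ) ≃ᵃ[ℝ] (Fin d → ℝ) :=
  (LinearEquiv.smulOfNeZero ℝ (Fin d → ℝ) t ht).toAffineEquiv.trans
    (AffineEquiv.constVAdd ℝ _ ((1 - t) • fun _ => 1 / ((d : ℝ) + 1)))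

theorem coe_shrinkEquiv {t : ℝ} (ht : t ≠ 0) : ⇑(shrinkEquiv d ht) = shrink d t := by
  ext x i
  simp [shrinkEquiv, shrink, add_comm]

theorem gradSum_comp_shrink_le {w : (Fin d → ℝ) → ℝ} (hw : ContDiff ℝ 1 w) {t : ℝ} (h0 : 0 ≤ t)
    (h1 : t ≤ 1) (x : Fin d → ℝ) : gradSum (w ∘ shrink d t) x ≤ gradSum w (shrink d t x) := by
  refine Finset.sum_le_sum fun i _ => ?_
  have hs : HasFDerivAt (shrink d t) (t • ContinuousLinearMap.id ℝ (Fin d → ℝ)) x :=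
    ((hasFDerivAt_id x).const_smul t).add_const _
  have h2 := ((hw.differentiable (by simp) (shrink d t x)).hasFDerivAt).comp x hs
  rw [h2.fderiv]
  simp only [ContinuousLinearMap.comp_apply, smul_apply, ContinuousLinearMap.id_apply, map_smul,
    smul_eq_mul, enorm_mul]
  refine mul_le_of_le_one_left zero_le ?_
  rw [← ofReal_norm, ENNReal.ofReal_le_one, Real.norm_of_nonneg h0]
  exact h1

/-- Fatou's lemma in each variable. No integrability of the limit is needed, so `L^q` integrability
can be a conclusion later. -/
theorem lintegral_lintegral_enorm_sub_rpow_le_liminf {α : Type*} [MeasurableSpace α]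
    {μ : Measure α} [SFinite μ] {W : ℕ → α → ℝ} {w : α → ℝ} {q : ℝ}
    (hW : ∀ n, Measurable (W n))
    (h : ∀ᵐ x ∂μ, Filter.Tendsto (fun n => W n x) Filter.atTop (nhds (w x))) :
    ∫⁻ x, (∫⁻ y, ‖w x - w y‖ₑ ^ q ∂μ) ∂μ ≤
      Filter.liminf (fun n => ∫⁻ x, (∫⁻ y, ‖W n x - W n y‖ₑ ^ q ∂μ) ∂μ) Filter.atTop := by
  have hF : ∀ n, Measurable fun z : α × α => ‖W n z.1 - W n z.2‖ₑ ^ q := fun n =>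
    (((hW n).comp measurable_fst).sub ((hW n).comp measurable_snd)).enorm.pow_const q
  have hF1 : ∀ n x, Measurable fun y => ‖W n x - W n y‖ₑ ^ q := fun n x =>
    (measurable_const.sub (hW n)).enorm.pow_const q
  have hF2 : ∀ n, Measurable fun x => ∫⁻ y, ‖W n x - W n y‖ₑ ^ q ∂μ := fun n =>
    (hF n).lintegral_prod_right'
  have e1 : ∫⁻ x, (∫⁻ y, ‖w x - w y‖ₑ ^ q ∂μ) ∂μ = ∫⁻ x, (∫⁻ y, Filter.liminf (fun n =>
          ‖W n x - W n y‖ₑ ^ q) Filter.atTop ∂μ) ∂μ := by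
    refine lintegral_congr_ae ?_
    filter_upwards [h] with x hx
    refine lintegral_congr_ae ?_
    filter_upwards [h] with y hy
    refine (Filter.Tendsto.liminf_eq ?_).symm
    exact ((ENNReal.continuous_rpow_const (y := q)).tendsto _).comp
      ((continuous_enorm.tendsto _).comp (hx.sub hy))
  rw [e1]
  refine (lintegral_mono fun x => lintegral_liminf_le fun n => hF1 n x).trans ?_
  exact lintegral_liminf_le hF2

/-- The homothety leaves room for the mollifier: on the shrunken simplex the mollified function has
the mollified weak gradient. The factor `2^d` is the Jacobian for ratios `t ≥ 1/2`. -/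
theorem lintegral_gradSum_mollify_shrink_le {p : ℝ} (hp : 1 ≤ p)
    {v : (Fin d → ℝ) → ℝ} {g : Fin d → (Fin d → ℝ) → ℝ}
    (h : ∀ i, WeakDirDeriv (openCornerSimplex d) (Pi.single i 1) v (g i))
    (hv : IntegrableOn v (openCornerSimplex d)) (hg : ∀ i, Measurable (g i)) {t : ℝ}
    (ht : 1 / 2 ≤ t) (ht1 : t < 1) (φ : ContDiffBump (0 : Fin d → ℝ))
    (hball : ∀ x ∈ cornerSimplex d,
      Metric.closedBall (shrink d t x) φ.rOut ⊆ openCornerSimplex d) :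
    ∫⁻ x in cornerSimplex d,
        gradSum (mollify φ ((openCornerSimplex d).indicator v) ∘ shrink d t) x ^ p ≤
      2 ^ d * ∫⁻ x in openCornerSimplex d, (∑ i, ‖g i x‖ₑ) ^ p := by
  have ht0 : 0 < t := by linarith
  have hp0 : 0 < p := by linarith
  set Ω := openCornerSimplex d with hΩdef
  have hΩ : IsOpen Ω := isOpen_openCornerSimplex d
  have hvi : LocallyIntegrable (Ω.indicator v) :=
    ((integrable_indicator_iff hΩ.measurableSet).2 hv).locallyIntegrable
  set V := mollify φ (Ω.indicator v) with hV
  have hVc : ContDiff ℝ 1 V := contDiff_mollify _ hvi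
  set K := shrink d t '' cornerSimplex d with hK
  have hKm : MeasurableSet K :=
    ((isCompact_cornerSimplex d).image (continuous_shrink d t)).measurableSet
  set Γ : (Fin d → ℝ) → ENNReal := Ω.indicator (fun y => ∑ i, ‖g i y‖ₑ) with hΓ
  have hΓm : Measurable Γ :=
    (Finset.measurable_fun_sum _ fun i _ => (hg i).enorm).indicator hΩ.measurableSet
  have hΓi : ∫⁻ y, Γ y ^ p = ∫⁻ x in Ω, (∑ i, ‖g i x‖ₑ) ^ p := by
    rw [← lintegral_indicator hΩ.measurableSet]
    refine lintegral_congr fun y => ?_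
    by_cases hy : y ∈ Ω
    · simp [hΓ, Set.indicator_of_mem hy]
    · simp [hΓ, Set.indicator_of_notMem hy, hp0]
  have hm := (continuous_gradSum hVc).measurable.pow_const p
  calc ∫⁻ x in cornerSimplex d, gradSum (V ∘ shrink d t) x ^ p
      ≤ ∫⁻ x in cornerSimplex d, K.indicator (fun z => gradSum V z ^ p)
          (t • x + (1 - t) • fun _ => 1 / ((d : ℝ) + 1)) := by
        refine setLIntegral_mono' (measurableSet_cornerSimplex d) fun x hx => ?_
        have hmem : (t • x + (1 - t) • fun _ => 1 / ((d : ℝ) + 1)) ∈ K :=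
          Set.mem_image_of_mem (shrink d t) hx
        rw [Set.indicator_of_mem hmem]
        exact ENNReal.rpow_le_rpow (gradSum_comp_shrink_le hVc ht0.le ht1.le x) hp0.le
    _ ≤ 2 ^ d * ∫⁻ x in cornerSimplex d, K.indicator (fun z => gradSum V z ^ p) x :=
        setLIntegral_comp_smul_add_le (hm.indicator hKm) ht _
          (measurableSet_cornerSimplex d)
          fun x hx => openCornerSimplex_subset d (shrink_mem ht0.le ht1 hx)
    _ ≤ 2 ^ d * ∫⁻ x, K.indicator (fun z => gradSum V z ^ p) x :=
        mul_le_mul_right (lintegral_mono' Measure.restrict_le_self le_rfl) _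
    _ ≤ 2 ^ d * ∫⁻ x, (∫⁻ y, ENNReal.ofReal (φ.normed volume (x - y)) * Γ y) ^ p := by
        refine mul_le_mul_right (lintegral_mono fun x => ?_) _
        by_cases hx : x ∈ K
        · rw [Set.indicator_of_mem hx]
          obtain ⟨z, hz, rfl⟩ := hx
          exact ENNReal.rpow_le_rpow (gradSum_mollify_le hΩ h hv hg _ (hball z hz)) hp0.le
        · rw [Set.indicator_of_notMem hx]; exact zero_le
    _ ≤ 2 ^ d * ∫⁻ y, Γ y ^ p :=
        mul_le_mul_right (lintegral_convolution_rpow_le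
          (k := fun z => ENNReal.ofReal (φ.normed volume z))
          φ.continuous_normed.measurable.ennreal_ofReal (lintegral_ofReal_normed _) hΓm hp) _
    _ = _ := by rw [hΓi]

/-- For fixed `t < 1` the mollifications converge almost everywhere on the shrunken simplex, a
compact subset of the open one, with bounds independent of the mollification parameter. -/
theorem lintegral_lintegral_shrink_le {p q : ℝ} (hp : 1 ≤ p) (hq : 0 ≤ q) {C : ENNReal}
    (hC : ∀ v : (Fin d → ℝ) → ℝ, ContDiff ℝ 1 v →
      ∫⁻ x in cornerSimplex d, ∫⁻ y in cornerSimplex d, ‖v x - v y‖ₑ ^ q ≤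
        C * (∫⁻ x in cornerSimplex d, gradSum v x ^ p) ^ (q / p))
    {v : (Fin d → ℝ) → ℝ} {g : Fin d → (Fin d → ℝ) → ℝ}
    (h : ∀ i, WeakDirDeriv (openCornerSimplex d) (Pi.single i 1) v (g i))
    (hv : IntegrableOn v (openCornerSimplex d)) (hg : ∀ i, Measurable (g i)) {t : ℝ}
    (ht : 1 / 2 ≤ t) (ht1 : t < 1) :
    ∫⁻ x in cornerSimplex d, ∫⁻ y in cornerSimplex d,
      ‖v (shrink d t x) - v (shrink d t y)‖ₑ ^ q ≤
        C * (2 ^ d * ∫⁻ x in openCornerSimplex d, (∑ i, ‖g i x‖ₑ) ^ p) ^ (q / p) := by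
  have ht0 : 0 < t := by linarith
  have hp0 : 0 < p := by linarith
  set Ω := openCornerSimplex d with hΩdef
  have hΩ : IsOpen Ω := isOpen_openCornerSimplex d
  set V : ℕ → (Fin d → ℝ) → ℝ := fun n => mollify (shrinkingBump _ n) (Ω.indicator v) with hV
  have hvi : LocallyIntegrable (Ω.indicator v) :=
    ((integrable_indicator_iff hΩ.measurableSet).2 hv).locallyIntegrable
  have hVc : ∀ n, ContDiff ℝ 1 (V n) := fun n => contDiff_mollify _ hvi
  have hsc : ContDiff ℝ 1 (shrink d t) := by
    rw [← coe_shrinkEquiv ht0.ne']; exact contDiff_affineEquiv _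
  set K := shrink d t '' cornerSimplex d with hK
  have hKc : IsCompact K := (isCompact_cornerSimplex d).image (continuous_shrink d t)
  have hKΩ : K ⊆ Ω := by
    rintro _ ⟨x, hx, rfl⟩; exact shrink_mem ht0.le ht1 hx
  obtain ⟨δ, hδ, hδΩ⟩ := hKc.exists_cthickening_subset_open hΩ hKΩ
  have hev : ∀ᶠ n in Filter.atTop, (shrinkingBump (Fin d → ℝ) n).rOut < δ :=
    (tendsto_rOut_shrinkingBump _).eventually_lt_const hδ
  have hbound : ∀ᶠ n in Filter.atTop, ∫⁻ x in cornerSimplex d, ∫⁻ y in cornerSimplex d,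
      ‖V n (shrink d t x) - V n (shrink d t y)‖ₑ ^ q ≤
        C * (2 ^ d * ∫⁻ x in Ω, (∑ i, ‖g i x‖ₑ) ^ p) ^ (q / p) := by
    filter_upwards [hev] with n hn
    refine (hC (V n ∘ shrink d t) ((hVc n).comp hsc)).trans ?_
    gcongr C * ?_ ^ (q / p)
    have hball : ∀ x ∈ K, Metric.closedBall x (shrinkingBump (Fin d → ℝ) n).rOut ⊆ Ω := by
      intro x hx
      refine Set.Subset.trans ?_ hδΩ
      exact (Metric.closedBall_subset_closedBall hn.le).trans
        (Metric.closedBall_subset_cthickening hx δ)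
    exact lintegral_gradSum_mollify_shrink_le hp h hv hg ht ht1 _ fun x hx =>
      hball _ (Set.mem_image_of_mem _ hx)
  have hconv : ∀ᵐ x ∂(volume.restrict (cornerSimplex d)),
      Filter.Tendsto (fun n => V n (shrink d t x)) Filter.atTop (nhds (v (shrink d t x))) := by
    have h1 : ∀ᵐ z ∂(volume : Measure (Fin d → ℝ)),
        Filter.Tendsto (fun n => V n z) Filter.atTop (nhds (Ω.indicator v z)) :=
      ContDiffBump.ae_convolution_tendsto_right_of_locallyIntegrable
        (tendsto_rOut_shrinkingBump _) (K := 2)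
        (Filter.Eventually.of_forall fun n => by simp [shrinkingBump, div_eq_mul_inv]) hvi
    obtain ⟨c, h0, h2, hc⟩ := exists_map_affineEquiv_volume (shrinkEquiv d ht0.ne')
    have h3 : ∀ᵐ z ∂(Measure.map (shrinkEquiv d ht0.ne') (volume : Measure (Fin d → ℝ))),
        Filter.Tendsto (fun n => V n z) Filter.atTop (nhds (Ω.indicator v z)) := by
      rw [hc]; exact Measure.ae_smul_measure h1 c
    have h4 := ae_of_ae_map (continuous_affineEquiv _).measurable.aemeasurable h3
    rw [coe_shrinkEquiv] at h4
    filter_upwards [ae_restrict_of_ae h4, ae_restrict_mem (measurableSet_cornerSimplex d)]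
      with x hx hxm
    rwa [Set.indicator_of_mem (shrink_mem ht0.le ht1 hxm)] at hx
  refine (lintegral_lintegral_enorm_sub_rpow_le_liminf (q := q)
    (fun n => ((hVc n).comp hsc).continuous.measurable) hconv).trans ?_
  exact Filter.liminf_le_of_frequently_le' hbound.frequently

end Pi
end Morley

namespace Morley
section Pi
variable {d : ℕ}

/-- The image lies in the simplex itself, so the volume factor `c` of the push-forward is at least
`1`. -/
theorem setLIntegral_shrink_image_le {t : ℝ} (ht : 0 < t) (ht1 : t < 1)
    (H : (Fin d → ℝ) → ENNReal) :
    ∫⁻ x in shrink d t '' cornerSimplex d, H x ≤ ∫⁻ x in cornerSimplex d, H (shrink d t x) := by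
  have he := measurableEmbedding_affineEquiv (shrinkEquiv d ht.ne')
  obtain ⟨c, h0, h1, hc⟩ := exists_map_affineEquiv_volume (shrinkEquiv d ht.ne')
  rw [coe_shrinkEquiv] at he hc
  set K := shrink d t '' cornerSimplex d with hK
  have hpre : shrink d t ⁻¹' K = cornerSimplex d := Set.preimage_image_eq _ he.injective
  have hKs : K ⊆ cornerSimplex d := by
    rintro _ ⟨x, hx, rfl⟩
    exact openCornerSimplex_subset d (shrink_mem ht.le ht1 hx)
  have hc1 : 1 ≤ c := by
    have h2 : volume (cornerSimplex d) ≤ c * volume (cornerSimplex d) := by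
      calc volume (cornerSimplex d) = Measure.map (shrink d t) volume K := by
            rw [he.map_apply, hpre]
        _ = c * volume K := by rw [hc]; rfl
        _ ≤ _ := by gcongr
    by_contra hlt
    push Not at hlt
    have h3 := (ENNReal.mul_lt_mul_iff_left (volume_cornerSimplex_pos d).ne'
      (volume_cornerSimplex_lt_top d).ne).2 hlt
    rw [one_mul] at h3
    exact absurd h2 (not_le.2 h3)
  rw [← hpre, ← he.lintegral_map, ← he.restrict_map, hc, Measure.restrict_smul,
    lintegral_smul_measure, smul_eq_mul]
  exact le_mul_of_one_le_left zero_le hc1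

/-- The inverse homotheties tend to the identity as the ratio tends to `1`, hence eventually keep a
given interior point inside. -/
theorem openCornerSimplex_subset_iUnion_shrink (d : ℕ) :
    openCornerSimplex d ⊆
      ⋃ n : ℕ, shrink d (1 - 1 / ((n : ℝ) + 2)) '' cornerSimplex d := by
  intro x hx
  have hlim : Filter.Tendsto (fun n : ℕ => 1 - 1 / ((n : ℝ) + 2)) Filter.atTop (nhds 1) := by
    have h1 := (tendsto_one_div_add_atTop_nhds_zero_nat (𝕜 := ℝ)).comp (Filter.tendsto_add_atTop_nat 1)
    have h2 := h1.const_sub 1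
    simp only [sub_zero] at h2
    refine h2.congr fun n => ?_
    simp only [Function.comp_apply, Nat.cast_add, Nat.cast_one]
    ring
  have hcont : ContinuousAt (fun t : ℝ => t⁻¹ • (x - (1 - t) • fun _ => 1 / ((d : ℝ) + 1))) 1 := by
    refine ContinuousAt.smul (continuousAt_inv₀ one_ne_zero) ?_
    fun_prop
  have h3 := hcont.tendsto.comp hlim
  simp only [inv_one, sub_self, zero_smul, sub_zero, one_smul] at h3
  have h4 := h3.eventually ((isOpen_openCornerSimplex d).mem_nhds hx)
  obtain ⟨n, hn⟩ := h4.exists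
  refine Set.mem_iUnion.2 ⟨n, _, openCornerSimplex_subset d hn, ?_⟩
  have ht : (1 - 1 / ((n : ℝ) + 2)) ≠ 0 := by
    have : (0 : ℝ) < n + 2 := by positivity
    rw [sub_ne_zero, ne_eq, eq_comm, div_eq_one_iff_eq this.ne']
    have : (0 : ℝ) ≤ n := Nat.cast_nonneg n
    linarith
  simp only [Function.comp_apply, shrink]
  rw [smul_smul, mul_inv_cancel₀ ht, one_smul, sub_add_cancel]

theorem shrink_image_subset {s t : ℝ} (hs : 0 ≤ s) (hst : s ≤ t) (ht : 0 < t) :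
    shrink d s '' cornerSimplex d ⊆ shrink d t '' cornerSimplex d := by
  rintro _ ⟨x, hx, rfl⟩
  refine ⟨(s / t) • x + (1 - s / t) • fun _ => 1 / ((d : ℝ) + 1), ?_, ?_⟩
  · refine convex_cornerSimplex d hx
      (openCornerSimplex_subset d (barycenter_mem_openCornerSimplex d)) (by positivity) ?_ (by ring)
    rw [sub_nonneg, div_le_one ht]; exact hst
  · ext i
    simp only [shrink, Pi.add_apply, Pi.smul_apply, smul_eq_mul]
    field_simp
    ring

/-- Monotone convergence in both variables; the pair of indices `m`, `n` is dominated by the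
diagonal index `max m n`. -/
theorem setLIntegral_setLIntegral_iUnion_le {α : Type*} [MeasurableSpace α] {μ : Measure α}
    [SFinite μ] {K : ℕ → Set α} (hK : Monotone K) {F : α → α → ENNReal}
    (hF : Measurable (Function.uncurry F)) {R : ENNReal}
    (h : ∀ n, ∫⁻ x in K n, (∫⁻ y in K n, F x y ∂μ) ∂μ ≤ R) :
    ∫⁻ x in ⋃ n, K n, (∫⁻ y in ⋃ n, K n, F x y ∂μ) ∂μ ≤ R := by
  rw [setLIntegral_iUnion_of_directed _ hK.directed_le]
  refine iSup_le fun m => ?_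
  have e : ∀ x, ∫⁻ y in ⋃ n, K n, F x y ∂μ = ⨆ n, ∫⁻ y in K n, F x y ∂μ := fun x =>
    setLIntegral_iUnion_of_directed _ hK.directed_le
  simp only [e]
  rw [lintegral_iSup]
  · refine iSup_le fun n => le_trans ?_ (h (max m n))
    refine (lintegral_mono_set (hK (le_max_left m n))).trans ?_
    exact lintegral_mono fun x => lintegral_mono_set (hK (le_max_right m n))
  · exact fun n => hF.lintegral_prod_right'
  · exact fun n n' hn x => lintegral_mono_set (hK hn)

/-- The bound on the shrunken simplices is uniform in the ratio, and these simplices exhaust the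
open simplex. -/
theorem exists_sobolev_poincare_weak (hd : 2 ≤ d) {p q : ℝ} (hp : 1 ≤ p) (hq : 1 ≤ q)
    (hpq : -(d / q : ℝ) ≤ 1 - d / p) :
    ∃ C : ENNReal, C ≠ ⊤ ∧ ∀ (v : (Fin d → ℝ) → ℝ) (g : Fin d → (Fin d → ℝ) → ℝ),
      (∀ i, WeakDirDeriv (openCornerSimplex d) (Pi.single i 1) v (g i)) →
      IntegrableOn v (openCornerSimplex d) →
      ∫⁻ x in openCornerSimplex d, ∫⁻ y in openCornerSimplex d, ‖v x - v y‖ₑ ^ q ≤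
        C * (∫⁻ x in openCornerSimplex d, (∑ i, ‖g i x‖ₑ) ^ p) ^ (q / p) := by
  obtain ⟨C, hCt, hC⟩ := exists_sobolev_poincare hd hp hq hpq
  have hq0 : 0 < q := by linarith
  have hp0 : 0 < p := by linarith
  refine ⟨C * (2 ^ d) ^ (q / p), ENNReal.mul_ne_top hCt
    (ENNReal.rpow_ne_top_of_nonneg (by positivity) (by simp)), ?_⟩
  -- Proved for measurable `v` and `g`; at the end general data are replaced by measurable
  -- representatives, which changes neither weak derivatives nor integrals.
  have main : ∀ (v : (Fin d → ℝ) → ℝ) (g : Fin d → (Fin d → ℝ) → ℝ),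
      (∀ i, WeakDirDeriv (openCornerSimplex d) (Pi.single i 1) v (g i)) →
      IntegrableOn v (openCornerSimplex d) → Measurable v → (∀ i, Measurable (g i)) →
      ∫⁻ x in openCornerSimplex d, ∫⁻ y in openCornerSimplex d, ‖v x - v y‖ₑ ^ q ≤
        C * (2 ^ d) ^ (q / p) *
          (∫⁻ x in openCornerSimplex d, (∑ i, ‖g i x‖ₑ) ^ p) ^ (q / p) := by
    intro v g h hv hvm hg
    rw [mul_assoc, ← ENNReal.mul_rpow_of_nonneg _ _ (by positivity)]
    have htn : ∀ n : ℕ, 1 / 2 ≤ 1 - 1 / ((n : ℝ) + 2) ∧ 1 - 1 / ((n : ℝ) + 2) < 1 := by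
      intro n
      have h1 : 1 / ((n : ℝ) + 2) ≤ 1 / 2 := by gcongr; linarith [(Nat.cast_nonneg n : (0:ℝ) ≤ n)]
      have h2 : 0 < 1 / ((n : ℝ) + 2) := by positivity
      constructor <;> linarith
    have hmono : Monotone fun n : ℕ => shrink d (1 - 1 / ((n : ℝ) + 2)) '' cornerSimplex d := by
      intro n m hnm
      refine shrink_image_subset (by linarith [(htn n).1]) ?_ (by linarith [(htn m).1])
      have : (n : ℝ) ≤ m := by exact_mod_cast hnm
      gcongr
    have hFm : Measurable (Function.uncurry fun x y : Fin d → ℝ => ‖v x - v y‖ₑ ^ q) :=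
      ((hvm.comp measurable_fst).sub (hvm.comp measurable_snd)).enorm.pow_const q
    refine le_trans ?_ (setLIntegral_setLIntegral_iUnion_le (μ := volume) hmono hFm fun n => ?_)
    · refine (lintegral_mono_set (openCornerSimplex_subset_iUnion_shrink d)).trans ?_
      exact lintegral_mono fun x => lintegral_mono_set (openCornerSimplex_subset_iUnion_shrink d)
    · have h0 : (0 : ℝ) < 1 - 1 / ((n : ℝ) + 2) := by linarith [(htn n).1]
      refine le_trans ?_ (lintegral_lintegral_shrink_le hp hq0.le hC h hv hg (htn n).1 (htn n).2)
      refine (setLIntegral_shrink_image_le h0 (htn n).2 _).trans ?_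
      exact lintegral_mono fun x => setLIntegral_shrink_image_le h0 (htn n).2 _
  intro v g h hv
  have hvm := hv.aestronglyMeasurable.aemeasurable
  have hgm : ∀ i, AEMeasurable (g i) (volume.restrict (openCornerSimplex d)) := fun i =>
    ((h i).2.1.aestronglyMeasurable).aemeasurable
  have hgae : ∀ᵐ x ∂(volume.restrict (openCornerSimplex d)), ∀ i, g i x = (hgm i).mk (g i) x :=
    ae_all_iff.2 fun i => (hgm i).ae_eq_mk
  have := main (hvm.mk v) (fun i => (hgm i).mk (g i))
    (fun i => (h i).congr_ae hvm.ae_eq_mk (hgm i).ae_eq_mk)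
    (hv.congr hvm.ae_eq_mk) hvm.measurable_mk fun i => (hgm i).measurable_mk
  convert this using 1
  · refine lintegral_congr_ae ?_
    filter_upwards [hvm.ae_eq_mk] with x hx
    refine lintegral_congr_ae ?_
    filter_upwards [hvm.ae_eq_mk] with y hy
    rw [hx, hy]
  · congr 2
    refine lintegral_congr_ae ?_
    filter_upwards [hgae] with x hx
    simp only [hx]

end Pi

/-! ### Affine parametrization of simplices by the reference simplex -/

section SimplexMap
variable {E : Type*} [NormedAddCommGroup E] [NormedSpace ℝ E] {k : ℕ}

/-- The linear map of `ℝ^k` sending the unit vectors to the edge vectors at `P 0`. -/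
noncomputable def edgeMap (P : Fin (k + 1) → E) : (Fin k → ℝ) →ₗ[ℝ] E :=
  Fintype.linearCombination ℝ (fun i : Fin k => P i.succ - P 0)

/-- The affine map of `ℝ^k` sending the vertices of `cornerSimplex k` to the points `P i`. -/
noncomputable def simplexMap (P : Fin (k + 1) → E) (x : Fin k → ℝ) : E := P 0 + edgeMap P x

theorem edgeMap_apply (P : Fin (k + 1) → E) (x : Fin k → ℝ) :
    edgeMap P x = ∑ i, x i • (P i.succ - P 0) := by
  simp [edgeMap, Fintype.linearCombination_apply]

theorem edgeMap_single (P : Fin (k + 1) → E) (i : Fin k) :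
    edgeMap P (Pi.single i 1) = P i.succ - P 0 := by
  simp [edgeMap]

theorem simplexMap_eq_sum (P : Fin (k + 1) → E) (x : Fin k → ℝ) :
    simplexMap P x = (1 - ∑ i, x i) • P 0 + ∑ i, x i • P i.succ := by
  rw [simplexMap, edgeMap_apply]
  simp only [smul_sub, Finset.sum_sub_distrib, ← Finset.sum_smul]
  module

theorem image_simplexMap (P : Fin (k + 1) → E) :
    simplexMap P '' cornerSimplex k = convexHull ℝ (Set.range P) := by
  apply subset_antisymm
  · rintro _ ⟨x, hx, rfl⟩
    rw [simplexMap_eq_sum]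
    have h1 := (convex_convexHull ℝ (Set.range P)).sum_mem (t := Finset.univ)
      (w := (Fin.cons (1 - ∑ i, x i) x : Fin (k + 1) → ℝ)) (z := P) ?_ ?_
      (fun i _ => subset_convexHull ℝ _ (Set.mem_range_self i))
    · simpa [Fin.sum_univ_succ] using h1
    · intro i _
      refine Fin.cases ?_ (fun i => ?_) i
      · simpa using hx.2
      · simpa using hx.1 i
    · simp [Fin.sum_univ_succ]
  · refine convexHull_min ?_ ?_
    · rintro _ ⟨i, rfl⟩
      refine Fin.cases ?_ (fun i => ?_) i
      · exact ⟨0, ⟨fun _ => le_rfl, by simp⟩, by simp [simplexMap]⟩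
      · refine ⟨Pi.single i 1, ⟨fun j => ?_, by simp⟩, by simp [simplexMap, edgeMap_single]⟩
        by_cases hj : j = i
        · subst hj; simp
        · simp [hj]
    · have : simplexMap P = (AffineMap.const ℝ (Fin k → ℝ) (P 0) + (edgeMap P).toAffineMap :
          (Fin k → ℝ) →ᵃ[ℝ] E) := by ext x; simp [simplexMap]
      rw [this]
      exact (convex_cornerSimplex k).affine_image _

theorem edgeMap_injective {P : Fin (k + 1) → E} (hP : AffineIndependent ℝ P) :
    Function.Injective (edgeMap P) := by
  have h1 := (affineIndependent_iff_linearIndependent_vsub ℝ P 0).1 hP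
  have h2 : LinearIndependent ℝ (fun i : Fin k => P i.succ - P 0) := by
    refine h1.comp (fun i : Fin k => (⟨i.succ, Fin.succ_ne_zero i⟩ : {x : Fin (k + 1) // x ≠ 0})) ?_
    intro i j hij
    simpa using hij
  exact h2.fintypeLinearCombination_injective

/-- `simplexMap` as an affine equivalence onto a space of the same dimension. -/
noncomputable def simplexEquiv [FiniteDimensional ℝ E] (P : Fin (k + 1) → E)
    (hP : AffineIndependent ℝ P) (hk : Module.finrank ℝ E = k) : (Fin k → ℝ) ≃ᵃ[ℝ] E :=
  (LinearEquiv.ofInjectiveOfFinrankEq (edgeMap P) (edgeMap_injective hP)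
    (by simp [hk])).toAffineEquiv.trans (AffineEquiv.constVAdd ℝ E (P 0))

theorem coe_simplexEquiv [FiniteDimensional ℝ E] (P : Fin (k + 1) → E)
    (hP : AffineIndependent ℝ P) (hk : Module.finrank ℝ E = k) :
    ⇑(simplexEquiv P hP hk) = simplexMap P := by
  ext x
  simp [simplexEquiv, simplexMap]
  rfl

theorem simplexEquiv_linear_single [FiniteDimensional ℝ E] (P : Fin (k + 1) → E)
    (hP : AffineIndependent ℝ P) (hk : Module.finrank ℝ E = k) (i : Fin k) :
    (simplexEquiv P hP hk).linear (Pi.single i 1) = P i.succ - P 0 :=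
  edgeMap_single P i

theorem preimage_simplexEquiv [FiniteDimensional ℝ E] (P : Fin (k + 1) → E)
    (hP : AffineIndependent ℝ P) (hk : Module.finrank ℝ E = k) :
    simplexEquiv P hP hk ⁻¹' convexHull ℝ (Set.range P) = cornerSimplex k := by
  rw [← image_simplexMap, ← coe_simplexEquiv P hP hk]
  exact Set.preimage_image_eq _ (simplexEquiv P hP hk).injective

theorem preimage_simplexEquiv_interior [FiniteDimensional ℝ E] (P : Fin (k + 1) → E)
    (hP : AffineIndependent ℝ P) (hk : Module.finrank ℝ E = k) :
    simplexEquiv P hP hk ⁻¹' interior (convexHull ℝ (Set.range P)) = openCornerSimplex k := by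
  have h := (AffineEquiv.toContinuousAffineEquiv (simplexEquiv P hP hk)).toHomeomorph.preimage_interior
    (convexHull ℝ (Set.range P))
  rw [← interior_cornerSimplex, ← preimage_simplexEquiv P hP hk]
  exact h

end SimplexMap
end Morley

/-! ### The Sobolev-Poincaré inequality on arbitrary simplices -/

namespace Morley

/-- `v x` minus the mean is the mean over `y` of `v x - v y`; apply Jensen to the normalized
measure. -/
theorem eLpNorm_sub_average_rpow_le {α : Type*} [MeasurableSpace α] {μ : Measure α}
    [IsFiniteMeasure μ] [NeZero μ] {v : α → ℝ} (hv : Integrable v μ) {q : ℝ} (hq : 1 ≤ q) :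
    ∫⁻ x, ‖v x - ⨍ y, v y ∂μ‖ₑ ^ q ∂μ ≤
      (μ Set.univ)⁻¹ * ∫⁻ x, (∫⁻ y, ‖v x - v y‖ₑ ^ q ∂μ) ∂μ := by
  have hm0 : μ Set.univ ≠ 0 := by simpa using NeZero.ne μ
  have hmt : μ Set.univ ≠ ⊤ := measure_ne_top μ _
  rw [← lintegral_const_mul' _ _ (ENNReal.inv_ne_top.2 hm0)]
  refine lintegral_mono fun x => ?_
  have hi : Integrable (fun y => v x - v y) μ := (integrable_const _).sub hv
  have e1 : v x - ⨍ y, v y ∂μ = ∫ y, (v x - v y) ∂((μ Set.univ)⁻¹ • μ) := by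
    rw [integral_smul_measure, integral_sub (integrable_const _) hv, average_eq]
    simp only [integral_const, smul_eq_mul, ENNReal.toReal_inv, Measure.real]
    have : (μ Set.univ).toReal ≠ 0 := (ENNReal.toReal_pos hm0 hmt).ne'
    field_simp
  have h1 : ‖v x - ⨍ y, v y ∂μ‖ₑ ≤ ∫⁻ y, ‖v x - v y‖ₑ ∂((μ Set.univ)⁻¹ • μ) := by
    rw [e1]; exact enorm_integral_le_lintegral_enorm _
  have h2 := lintegral_rpow_rpow_le_of_le (μ := (μ Set.univ)⁻¹ • μ) (f := fun y => ‖v x - v y‖ₑ)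
    (hi.aestronglyMeasurable.enorm.smul_measure _) one_pos hq
  have h3 : ((μ Set.univ)⁻¹ • μ) Set.univ = 1 := by
    simp
  simp only [ENNReal.rpow_one, h3, ENNReal.one_rpow, mul_one, div_one] at h2
  calc ‖v x - ⨍ y, v y ∂μ‖ₑ ^ q
      ≤ ((∫⁻ y, ‖v x - v y‖ₑ ^ q ∂((μ Set.univ)⁻¹ • μ)) ^ (1 / q)) ^ q :=
        ENNReal.rpow_le_rpow (h1.trans h2) (by linarith)
    _ = ∫⁻ y, ‖v x - v y‖ₑ ^ q ∂((μ Set.univ)⁻¹ • μ) := by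
        rw [← ENNReal.rpow_mul, one_div_mul_cancel (by linarith), ENNReal.rpow_one]
    _ = _ := by rw [lintegral_smul_measure, smul_eq_mul]

theorem eLpNorm_ofReal_rpow {α : Type*} [MeasurableSpace α] {μ : Measure α} (f : α → ℝ)
    {q : ℝ} (hq : 0 < q) :
    eLpNorm f (ENNReal.ofReal q) μ = (∫⁻ x, ‖f x‖ₑ ^ q ∂μ) ^ (1 / q) := by
  rw [eLpNorm_eq_lintegral_rpow_enorm_toReal (by simpa using hq) (by simp),
    ENNReal.toReal_ofReal hq.le]

variable {d : ℕ}

instance : NeZero ((volume : Measure (Fin d → ℝ)).restrict (openCornerSimplex d)) :=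
  ⟨by
    rw [Ne, Measure.restrict_eq_zero]
    exact ((isOpen_openCornerSimplex d).measure_pos _
      ⟨_, barycenter_mem_openCornerSimplex d⟩).ne'⟩

theorem volume_openCornerSimplex_lt_top (d : ℕ) : volume (openCornerSimplex d) < ⊤ :=
  (measure_mono (openCornerSimplex_subset d)).trans_lt (volume_cornerSimplex_lt_top d)

instance : IsFiniteMeasure ((volume : Measure (Fin d → ℝ)).restrict (openCornerSimplex d)) :=
  ⟨by simpa using volume_openCornerSimplex_lt_top d⟩

/-- Sobolev-Poincaré inequality on the reference simplex. -/
theorem exists_eLpNorm_sub_average_le_ref (hd : 2 ≤ d) {p q : ℝ} (hp : 1 ≤ p) (hq : 1 ≤ q)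
    (hpq : -(d / q : ℝ) ≤ 1 - d / p) :
    ∃ C : ENNReal, C ≠ ⊤ ∧ ∀ (v : (Fin d → ℝ) → ℝ) (g : Fin d → (Fin d → ℝ) → ℝ),
      (∀ i, WeakDirDeriv (openCornerSimplex d) (Pi.single i 1) v (g i)) →
      IntegrableOn v (openCornerSimplex d) →
      eLpNorm (fun x => v x - ⨍ y in openCornerSimplex d, v y) (ENNReal.ofReal q)
          (volume.restrict (openCornerSimplex d)) ≤
        C * ∑ i, eLpNorm (g i) (ENNReal.ofReal p) (volume.restrict (openCornerSimplex d)) := by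
  obtain ⟨C, hCt, hC⟩ := exists_sobolev_poincare_weak hd hp hq hpq
  have hq0 : 0 < q := by linarith
  have hp0 : 0 < p := by linarith
  set μ := (volume : Measure (Fin d → ℝ)).restrict (openCornerSimplex d) with hμ
  have hm0 : μ Set.univ ≠ 0 := by simpa using NeZero.ne μ
  refine ⟨((μ Set.univ)⁻¹ * C) ^ (1 / q), ENNReal.rpow_ne_top_of_nonneg (by positivity)
    (ENNReal.mul_ne_top (ENNReal.inv_ne_top.2 hm0) hCt), fun v g h hv => ?_⟩
  have h1 := (eLpNorm_sub_average_rpow_le (μ := μ) hv hq).trans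
    (mul_le_mul_right (hC v g h hv) _)
  rw [← mul_assoc] at h1
  rw [eLpNorm_ofReal_rpow _ hq0]
  refine (ENNReal.rpow_le_rpow h1 (z := 1 / q) (by positivity)).trans ?_
  rw [ENNReal.mul_rpow_of_nonneg _ _ (by positivity), ← ENNReal.rpow_mul]
  have e : q / p * (1 / q) = 1 / p := by field_simp
  rw [e]
  refine mul_le_mul_right ?_ _
  have h2 : (∫⁻ x in openCornerSimplex d, (∑ i, ‖g i x‖ₑ) ^ p) ^ (1 / p) =
      eLpNorm (∑ i, fun x => ‖g i x‖) (ENNReal.ofReal p) μ := by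
    rw [eLpNorm_ofReal_rpow _ hp0]
    congr 1
    refine lintegral_congr fun x => ?_
    congr 1
    rw [Finset.sum_apply, Real.enorm_eq_ofReal (Finset.sum_nonneg fun i _ => norm_nonneg _),
      ENNReal.ofReal_sum_of_nonneg (fun i _ => norm_nonneg _)]
    exact Finset.sum_congr rfl fun i _ => (ofReal_norm (g i x)).symm
  rw [h2]
  refine (eLpNorm_sum_le (fun i _ => ((h i).2.1.aestronglyMeasurable).norm) ?_).trans ?_
  · simpa using hp
  · simp only [eLpNorm_norm]; exact le_rfl

section Body

theorem convex_body (T : Simplex d) : Convex ℝ (body T) := convex_convexHull ℝ _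

theorem isCompact_body (T : Simplex d) : IsCompact (body T) :=
  (Set.finite_range T).isCompact_convexHull ℝ

theorem interior_body_ae_eq (T : Simplex d) : interior (body T) =ᵐ[volume] body T :=
  interior_ae_eq_of_null_frontier ((convex_body T).addHaar_frontier volume)

theorem restrict_interior_body (T : Simplex d) :
    (volume : Measure (E d)).restrict (interior (body T)) = volume.restrict (body T) :=
  Measure.restrict_congr_set (interior_body_ae_eq T)

theorem interior_body_nonempty (T : Simplex d) : (interior (body T)).Nonempty := by
  have := T.interior_convexHull
  rw [body, this]
  exact ⟨Finset.univ.centroid ℝ T, fun i => by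
    rw [T.coord_apply_centroid (Finset.mem_univ i)]; simp; positivity⟩

theorem volume_body_pos (T : Simplex d) : 0 < volume (body T) :=
  (isOpen_interior.measure_pos _ (interior_body_nonempty T)).trans_le
    (measure_mono interior_subset)

theorem volume_body_lt_top (T : Simplex d) : volume (body T) < ⊤ := (isCompact_body T).measure_lt_top

theorem vol_pos (T : Simplex d) : 0 < vol T :=
  ENNReal.toReal_pos (volume_body_pos T).ne' (volume_body_lt_top T).ne

instance (T : Simplex d) : IsFiniteMeasure ((volume : Measure (E d)).restrict (interior (body T))) :=
  ⟨by simpa [restrict_interior_body] using volume_body_lt_top T⟩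

/-- Averages are invariant under affine changes of variables. -/
theorem setAverage_comp_affineEquiv {F G : Type*} [NormedAddCommGroup F] [NormedSpace ℝ F]
    [FiniteDimensional ℝ F] [MeasureSpace F] [BorelSpace F] [(volume : Measure F).IsAddHaarMeasure]
    [NormedAddCommGroup G] [NormedSpace ℝ G]
    [FiniteDimensional ℝ G] [MeasureSpace G] [BorelSpace G] [(volume : Measure G).IsAddHaarMeasure]
    (Ψ : F ≃ᵃ[ℝ] G) (s : Set G) (f : G → ℝ) :
    ⨍ x in Ψ ⁻¹' s, f (Ψ x) = ⨍ y in s, f y := by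
  obtain ⟨c, h0, ht, h⟩ := exists_map_affineEquiv_volume Ψ
  rw [setAverage_eq, setAverage_eq, setIntegral_comp_affineEquiv Ψ h]
  have e : volume (Ψ ⁻¹' s) = c * volume s := by
    rw [← (measurableEmbedding_affineEquiv Ψ).map_apply, h, Measure.smul_apply, smul_eq_mul]
  have hc : c.toReal ≠ 0 := (ENNReal.toReal_pos h0 ht).ne'
  simp only [Measure.real, e, ENNReal.toReal_mul, smul_eq_mul, mul_inv]
  field_simp

/-- Sobolev-Poincaré inequality on simplices, without a shape-regularity assumption: the
derivatives are in the direction of the edges at the vertex `T 0`. -/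
theorem exists_lpNorm_sub_average_le (hd : 2 ≤ d) {p q : ℝ} (hp : 1 ≤ p) (hq : 1 ≤ q)
    (hpq : -(d / q : ℝ) ≤ 1 - d / p) :
    ∃ C : ℝ, 0 < C ∧ ∀ (T : Simplex d) (v : E d → ℝ) (g : Fin d → E d → ℝ),
      (∀ i, WeakDirDeriv (interior (body T)) (T i.succ - T 0) v (g i)) →
      IntegrableOn v (interior (body T)) →
      (∀ i, MemLp (g i) (ENNReal.ofReal p) (volume.restrict (interior (body T)))) →
      MemLp v (ENNReal.ofReal q) (volume.restrict (interior (body T))) ∧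
      lpNorm (fun x => v x - ⨍ y in interior (body T), v y) (ENNReal.ofReal q)
          (volume.restrict (interior (body T))) ≤
        C * vol T ^ (1 / q - 1 / p) *
          ∑ i, lpNorm (g i) (ENNReal.ofReal p) (volume.restrict (interior (body T))) := by
  obtain ⟨C, hCt, hC⟩ := exists_eLpNorm_sub_average_le_ref hd hp hq hpq
  have hq0 : 0 < q := by linarith
  have hp0 : 0 < p := by linarith
  set V₀ : ENNReal := volume (openCornerSimplex d) with hV₀
  have hV₀0 : V₀ ≠ 0 := by
    have := NeZero.ne ((volume : Measure (Fin d → ℝ)).restrict (openCornerSimplex d))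
    rwa [Ne, Measure.restrict_eq_zero] at this
  have hV₀t : V₀ ≠ ⊤ := (volume_openCornerSimplex_lt_top d).ne
  have hV₀pos : 0 < V₀.toReal := ENNReal.toReal_pos hV₀0 hV₀t
  refine ⟨(C.toReal + 1) * V₀.toReal ^ (1 / p - 1 / q), by positivity, fun T v g h hv hg => ?_⟩
  have hrank : Module.finrank ℝ (E d) = d := by simp
  let Ψ := simplexEquiv T T.ind hrank
  have hΨ : Ψ ⁻¹' interior (body T) = openCornerSimplex d := preimage_simplexEquiv_interior T T.ind hrank
  obtain ⟨c, hc0, hct, hc⟩ := exists_map_affineEquiv_volume Ψ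
  have he := measurableEmbedding_affineEquiv Ψ
  set μ := (volume : Measure (E d)).restrict (interior (body T)) with hμ
  set μ₀ := (volume : Measure (Fin d → ℝ)).restrict (openCornerSimplex d) with hμ₀
  have hmap : Measure.map Ψ μ₀ = c • μ := by
    rw [hμ₀, ← hΨ, ← he.restrict_map, hc, Measure.restrict_smul]
  -- The volume factor is `c = V₀ / |T|`, which is the source of the power of `|T|` in the estimate.
  have hVc : V₀ = c * volume (body T) := by
    have := congrArg (fun m => m Set.univ) hmap
    simp only [he.map_apply, Set.preimage_univ, Measure.smul_apply, smul_eq_mul] at this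
    rw [hμ, restrict_interior_body] at this
    simpa [hμ₀] using this
  have hnorm : ∀ (r : ℝ), 0 < r → ∀ f : E d → ℝ,
      eLpNorm (f ∘ Ψ) (ENNReal.ofReal r) μ₀ = c ^ (1 / r) * eLpNorm f (ENNReal.ofReal r) μ := by
    intro r hr f
    rw [← he.eLpNorm_map_measure, hmap, eLpNorm_smul_measure_of_ne_top (by simp),
      smul_eq_mul]
    congr 2
    rw [one_div, one_div, ENNReal.toReal_inv, ENNReal.toReal_ofReal hr.le]
  have hv₀ : IntegrableOn (v ∘ Ψ) (openCornerSimplex d) := by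
    rw [IntegrableOn, ← memLp_one_iff_integrable, ← hΨ]
    exact MemLp.comp_affineEquiv Ψ (memLp_one_iff_integrable.2 hv)
  have h₀ : ∀ i, WeakDirDeriv (openCornerSimplex d) (Pi.single i 1) (v ∘ Ψ) (g i ∘ Ψ) := by
    intro i
    rw [← hΨ]
    refine WeakDirDeriv.comp_affineEquiv Ψ ?_
    rw [show Ψ.linear (Pi.single i 1) = T i.succ - T 0 from
      simplexEquiv_linear_single T T.ind hrank i]
    exact h i
  have key := hC _ _ h₀ hv₀
  have hav : ⨍ y in openCornerSimplex d, (v ∘ Ψ) y = ⨍ y in interior (body T), v y := by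
    rw [← hΨ]; exact setAverage_comp_affineEquiv Ψ _ v
  rw [hav] at key
  set m := ⨍ y in interior (body T), v y with hm
  have key2 : c ^ (1 / q) * eLpNorm (fun x => v x - m) (ENNReal.ofReal q) μ ≤
      C * (c ^ (1 / p) * ∑ i, eLpNorm (g i) (ENNReal.ofReal p) μ) := by
    rw [← hnorm q hq0 (fun x => v x - m), Finset.mul_sum]
    simp only [hnorm p hp0] at key
    exact key
  have hcq : c ^ (1 / q) ≠ 0 := by simp [ENNReal.rpow_eq_zero_iff, hc0, hct]
  have hcqt : c ^ (1 / q) ≠ ⊤ := ENNReal.rpow_ne_top_of_nonneg (by positivity) hct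
  have hcpt : c ^ (1 / p) ≠ ⊤ := ENNReal.rpow_ne_top_of_nonneg (by positivity) hct
  have hsum : ∑ i, eLpNorm (g i) (ENNReal.ofReal p) μ ≠ ⊤ :=
    ENNReal.sum_ne_top.2 fun i _ => (hg i).2.ne
  have hR : C * (c ^ (1 / p) * ∑ i, eLpNorm (g i) (ENNReal.ofReal p) μ) ≠ ⊤ :=
    ENNReal.mul_ne_top hCt (ENNReal.mul_ne_top hcpt hsum)
  have hmeas : AEStronglyMeasurable (fun x => v x - m) μ :=
    hv.aestronglyMeasurable.sub aestronglyMeasurable_const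
  -- Membership in `L^q` is not assumed: an infinite left side would contradict the finite right
  -- side of `key2`.
  have hfin : eLpNorm (fun x => v x - m) (ENNReal.ofReal q) μ < ⊤ := by
    rw [lt_top_iff_ne_top]
    intro htop
    rw [htop, ENNReal.mul_top hcq] at key2
    exact hR (top_le_iff.1 key2)
  have hmem : MemLp (fun x => v x - m) (ENNReal.ofReal q) μ := ⟨hmeas, hfin⟩
  constructor
  · simpa [Pi.add_def] using hmem.add (memLp_const m)
  · have key3 := ENNReal.toReal_mono hR key2
    simp only [ENNReal.toReal_mul, ENNReal.toReal_sum fun i _ => (hg i).2.ne,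
      ← ENNReal.toReal_rpow] at key3
    rw [toReal_eLpNorm hmeas] at key3
    simp only [fun i => toReal_eLpNorm (p := ENNReal.ofReal p) (hg i).1] at key3
    have hcpos : 0 < c.toReal := ENNReal.toReal_pos hc0 hct
    have hVr : V₀.toReal = c.toReal * vol T := by rw [hVc, ENNReal.toReal_mul]; rfl
    set Sg := ∑ i, lpNorm (g i) (ENNReal.ofReal p) μ with hSg
    have hSg0 : 0 ≤ Sg := Finset.sum_nonneg fun i _ => lpNorm_nonneg
    -- Substituting `V₀ = c |T|`, the powers of `|T|` cancel and leave exactly the ratio of the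
    -- scaling factors of the two norms.
    have e1 : V₀.toReal ^ (1 / p - 1 / q) * vol T ^ (1 / q - 1 / p) =
        c.toReal ^ (1 / p) / c.toReal ^ (1 / q) := by
      rw [hVr, Real.mul_rpow hcpos.le (vol_pos T).le, mul_assoc, ← Real.rpow_add (vol_pos T),
        Real.rpow_sub hcpos]
      simp
    calc lpNorm (fun x => v x - m) (ENNReal.ofReal q) μ
        ≤ C.toReal * (c.toReal ^ (1 / p) * Sg) / c.toReal ^ (1 / q) := by
          rw [le_div_iff₀ (by positivity), mul_comm]; exact key3
      _ = C.toReal * (c.toReal ^ (1 / p) / c.toReal ^ (1 / q)) * Sg := by ring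
      _ ≤ (C.toReal + 1) * (c.toReal ^ (1 / p) / c.toReal ^ (1 / q)) * Sg := by
          gcongr; linarith
      _ = _ := by rw [← e1]; ring

end Body
end Morley

namespace Morley

/-! ### One-dimensional cut-offs that recover boundary values -/

section Cutoff

/-- A smooth monotone cut-off vanishing for `t ≤ 1/m` and equal to `1` for `t ≥ 2/m`. -/
noncomputable def cutoff (m : ℕ) (t : ℝ) : ℝ := Real.smoothTransition (m * t - 1)

theorem contDiff_cutoff (m : ℕ) : ContDiff ℝ ∞ (cutoff m) :=
  Real.smoothTransition.contDiff.comp (by fun_prop)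

theorem monotone_cutoff (m : ℕ) : Monotone (cutoff m) := fun s t h =>
  Real.smoothTransition.monotone (by gcongr)

theorem cutoff_nonneg (m : ℕ) (t : ℝ) : 0 ≤ cutoff m t := Real.smoothTransition.nonneg _

theorem cutoff_le_one (m : ℕ) (t : ℝ) : cutoff m t ≤ 1 := Real.smoothTransition.le_one _

theorem cutoff_eq_zero {m : ℕ} {t : ℝ} (h : m * t ≤ 1) : cutoff m t = 0 :=
  Real.smoothTransition.zero_of_nonpos (by linarith)

theorem cutoff_eq_one {m : ℕ} {t : ℝ} (h : 2 ≤ m * t) : cutoff m t = 1 :=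
  Real.smoothTransition.one_of_one_le (by linarith)

theorem cutoff_zero (m : ℕ) : cutoff m 0 = 0 := cutoff_eq_zero (by simp)

theorem continuous_deriv_cutoff (m : ℕ) : Continuous (deriv (cutoff m)) :=
  (contDiff_cutoff m).continuous_deriv (by simp)

theorem deriv_cutoff_nonneg (m : ℕ) (t : ℝ) : 0 ≤ deriv (cutoff m) t :=
  (monotone_cutoff m).deriv_nonneg

theorem deriv_cutoff_eq_zero {m : ℕ} {t : ℝ} (h : 2 < m * t) : deriv (cutoff m) t = 0 := by
  have h1 : cutoff m =ᶠ[nhds t] fun _ => 1 := by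
    have : ∀ᶠ s : ℝ in nhds t, 2 < m * s :=
      (continuous_const.mul continuous_id).continuousAt.eventually (lt_mem_nhds h)
    filter_upwards [this] with s hs using cutoff_eq_one hs.le
  rw [h1.deriv_eq, deriv_const]

theorem integral_deriv_cutoff (m : ℕ) (L : ℝ) : ∫ t in (0 : ℝ)..L, deriv (cutoff m) t = cutoff m L := by
  rw [intervalIntegral.integral_deriv_eq_sub
    (fun x _ => (contDiff_cutoff m).differentiable (by simp) x)
    ((continuous_deriv_cutoff m).intervalIntegrable _ _), cutoff_zero, sub_zero]

variable {H : ℝ → ℝ} {L : ℝ}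

/-- The derivative of the monotone cut-off is nonnegative with total mass at most `1`, so the bound
is uniform in `m` and can serve as a dominating constant. -/
theorem abs_integral_mul_deriv_cutoff_le (hL : 0 ≤ L) {K : ℝ}
    (hK : ∀ t ∈ Set.Icc 0 L, |H t| ≤ K) (m : ℕ) :
    |∫ t in (0 : ℝ)..L, H t * (deriv (cutoff m) t * cutoff m (L - t))| ≤ K := by
  have hK0 : 0 ≤ K := (abs_nonneg _).trans (hK 0 ⟨le_rfl, hL⟩)
  calc |∫ t in (0 : ℝ)..L, H t * (deriv (cutoff m) t * cutoff m (L - t))|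
      ≤ ∫ t in (0 : ℝ)..L, K * deriv (cutoff m) t := by
        rw [← Real.norm_eq_abs]
        refine intervalIntegral.norm_integral_le_of_norm_le hL (Filter.Eventually.of_forall ?_)
          ((continuous_const.mul (continuous_deriv_cutoff m)).intervalIntegrable _ _)
        intro t ht
        rw [norm_mul, norm_mul, Real.norm_eq_abs, Real.norm_eq_abs, Real.norm_eq_abs,
          abs_of_nonneg (deriv_cutoff_nonneg m t), abs_of_nonneg (cutoff_nonneg m _)]
        refine mul_le_mul (hK t ⟨ht.1.le, ht.2⟩) ?_
          (mul_nonneg (deriv_cutoff_nonneg m t) (cutoff_nonneg m _)) hK0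
        exact mul_le_of_le_one_right (deriv_cutoff_nonneg m t) (cutoff_le_one m _)
    _ = K * cutoff m L := by rw [intervalIntegral.integral_const_mul, integral_deriv_cutoff]
    _ ≤ K := mul_le_of_le_one_right hK0 (cutoff_le_one m _)

/-- The derivative of the cut-off is an approximate identity concentrating at `0` from the right. -/
theorem tendsto_integral_mul_deriv_cutoff (hL : 0 < L) (hH : ContinuousOn H (Set.Icc 0 L)) :
    Filter.Tendsto (fun m : ℕ => ∫ t in (0 : ℝ)..L, H t * (deriv (cutoff m) t * cutoff m (L - t)))
      Filter.atTop (nhds (H 0)) := by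
  rw [Metric.tendsto_atTop]
  intro ε hε
  obtain ⟨δ, hδ, hδ'⟩ := Metric.continuousOn_iff.1 hH 0 ⟨le_rfl, hL.le⟩ (ε / 2) (by positivity)
  -- The derivative can be nonzero only for `t ≤ 2/m`. There `m L > 4` makes the second cut-off
  -- equal to `1`, and `m δ > 2` gives `t < δ`.
  obtain ⟨N, hN⟩ := exists_nat_gt (max (4 / L) (2 / δ))
  refine ⟨N, fun m hm => ?_⟩
  have hmN : (N : ℝ) ≤ m := by exact_mod_cast hm
  have h4 : 4 < m * L := by
    have := (le_max_left _ _).trans_lt (hN.trans_le hmN)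
    rwa [div_lt_iff₀ hL] at this
  have h2 : 2 < m * δ := by
    have := (le_max_right _ _).trans_lt (hN.trans_le hmN)
    rwa [div_lt_iff₀ hδ] at this
  have hm0 : (0 : ℝ) < m := by
    by_contra h
    have : (m : ℝ) * L ≤ 0 := mul_nonpos_of_nonpos_of_nonneg (not_lt.1 h) hL.le
    linarith
  have e1 : ∀ t ∈ Set.uIcc 0 L, H t * (deriv (cutoff m) t * cutoff m (L - t)) =
      H 0 * deriv (cutoff m) t + (H t - H 0) * deriv (cutoff m) t := by
    intro t ht
    by_cases h : 2 < m * t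
    · simp [deriv_cutoff_eq_zero h]
    · rw [cutoff_eq_one (by nlinarith)]; ring
  have hd := continuous_deriv_cutoff m
  have hi : IntervalIntegrable (fun t => (H t - H 0) * deriv (cutoff m) t) volume 0 L := by
    refine ContinuousOn.intervalIntegrable ?_
    rw [Set.uIcc_of_le hL.le]
    exact (hH.sub continuousOn_const).mul hd.continuousOn
  have hi0 : IntervalIntegrable (fun t => H 0 * deriv (cutoff m) t) volume 0 L :=
    (continuous_const.mul hd).intervalIntegrable _ _
  rw [intervalIntegral.integral_congr e1, intervalIntegral.integral_add hi0 hi, intervalIntegral.integral_const_mul,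
    integral_deriv_cutoff, cutoff_eq_one (by linarith), mul_one, Real.dist_eq, add_sub_cancel_left]
  calc |∫ t in (0 : ℝ)..L, (H t - H 0) * deriv (cutoff m) t|
      ≤ ∫ t in (0 : ℝ)..L, ε / 2 * deriv (cutoff m) t := by
        rw [← Real.norm_eq_abs]
        refine intervalIntegral.norm_integral_le_of_norm_le hL.le (Filter.Eventually.of_forall ?_)
          ((continuous_const.mul hd).intervalIntegrable _ _)
        intro t ht
        by_cases h : 2 < m * t
        · simp [deriv_cutoff_eq_zero h]
        · rw [norm_mul, Real.norm_eq_abs (deriv _ _), abs_of_nonneg (deriv_cutoff_nonneg m t)]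
          refine mul_le_mul_of_nonneg_right ?_ (deriv_cutoff_nonneg m t)
          have := hδ' t ⟨ht.1.le, ht.2⟩ (by
            rw [Real.dist_eq, sub_zero, abs_of_pos ht.1]
            nlinarith [lt_of_mul_lt_mul_left ((not_lt.1 h).trans_lt h2) hm0.le])
          rw [Real.dist_eq] at this
          exact this.le
    _ = ε / 2 := by
        rw [intervalIntegral.integral_const_mul, integral_deriv_cutoff,
          cutoff_eq_one (by linarith), mul_one]
    _ < ε := by linarith

theorem hasDerivAt_cutoff_mul (m : ℕ) (L t : ℝ) :
    HasDerivAt (fun t => cutoff m t * cutoff m (L - t))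
      (deriv (cutoff m) t * cutoff m (L - t) - cutoff m t * deriv (cutoff m) (L - t)) t := by
  have hd : ∀ s, HasDerivAt (cutoff m) (deriv (cutoff m) s) s := fun s =>
    ((contDiff_cutoff m).differentiable (by simp) s).hasDerivAt
  have h2 : HasDerivAt (fun t => cutoff m (L - t)) (-deriv (cutoff m) (L - t)) t := by
    have := (hd (L - t)).comp_const_sub L t
    exact this
  exact ((hd t).mul h2).congr_deriv (by ring)

/-- Product rule; the reflection `t ↦ L - t` turns the contribution of the endpoint `L` into one at
`0`. -/
theorem integral_mul_deriv_cutoff_mul (hL : 0 < L) (hH : ContinuousOn H (Set.Icc 0 L)) (m : ℕ) :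
    ∫ t in (0 : ℝ)..L, H t * deriv (fun t => cutoff m t * cutoff m (L - t)) t =
      (∫ t in (0 : ℝ)..L, H t * (deriv (cutoff m) t * cutoff m (L - t))) -
        ∫ t in (0 : ℝ)..L, H (L - t) * (deriv (cutoff m) t * cutoff m (L - t)) := by
  have h1 := continuous_deriv_cutoff m
  have h2 := (contDiff_cutoff m).continuous
  have hi1 : IntervalIntegrable (fun t => H t * (deriv (cutoff m) t * cutoff m (L - t)))
      volume 0 L := by
    refine ContinuousOn.intervalIntegrable ?_
    rw [Set.uIcc_of_le hL.le]
    exact hH.mul (by fun_prop)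
  have hi2 : IntervalIntegrable (fun t => H t * (cutoff m t * deriv (cutoff m) (L - t)))
      volume 0 L := by
    refine ContinuousOn.intervalIntegrable ?_
    rw [Set.uIcc_of_le hL.le]
    exact hH.mul (by fun_prop)
  have e2 : ∫ t in (0 : ℝ)..L, H (L - t) * (deriv (cutoff m) t * cutoff m (L - t)) =
      ∫ t in (0 : ℝ)..L, H t * (cutoff m t * deriv (cutoff m) (L - t)) := by
    have := intervalIntegral.integral_comp_sub_left (a := 0) (b := L)
      (fun t => H t * (cutoff m t * deriv (cutoff m) (L - t))) L
    simp only [sub_zero, sub_self, sub_sub_cancel] at this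
    rw [← this]
    refine intervalIntegral.integral_congr fun t _ => ?_
    ring
  rw [e2, ← intervalIntegral.integral_sub hi1 hi2]
  refine intervalIntegral.integral_congr fun t _ => ?_
  simp only [(hasDerivAt_cutoff_mul m L t).deriv]
  ring

theorem abs_integral_mul_deriv_cutoff_mul_le (hL : 0 < L) (hH : ContinuousOn H (Set.Icc 0 L))
    {K : ℝ} (hK : ∀ t ∈ Set.Icc 0 L, |H t| ≤ K) (m : ℕ) :
    |∫ t in (0 : ℝ)..L, H t * deriv (fun t => cutoff m t * cutoff m (L - t)) t| ≤ 2 * K := by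
  rw [integral_mul_deriv_cutoff_mul hL hH]
  have h1 := abs_integral_mul_deriv_cutoff_le hL.le hK m
  have h2 := abs_integral_mul_deriv_cutoff_le (H := fun t => H (L - t)) hL.le
    (fun t ht => hK _ ⟨by linarith [ht.2], by linarith [ht.1]⟩) m
  exact (abs_sub _ _).trans (by linarith)

theorem tendsto_integral_mul_deriv_cutoff_mul (hL : 0 < L) (hH : ContinuousOn H (Set.Icc 0 L)) :
    Filter.Tendsto (fun m : ℕ =>
      ∫ t in (0 : ℝ)..L, H t * deriv (fun t => cutoff m t * cutoff m (L - t)) t)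
      Filter.atTop (nhds (H 0 - H L)) := by
  simp only [integral_mul_deriv_cutoff_mul hL hH]
  have h2 := tendsto_integral_mul_deriv_cutoff (H := fun t => H (L - t)) hL
    (hH.comp (by fun_prop) fun t ht => ⟨by linarith [ht.2], by linarith [ht.1]⟩)
  simp only [sub_zero] at h2
  exact (tendsto_integral_mul_deriv_cutoff hL hH).sub h2

/-- The half-open interval is the one underlying the interval integral; it may omit `0`, since the
cut-off vanishes in a whole neighbourhood of `0`. -/
theorem deriv_cutoff_mul_eq_zero {m : ℕ} (hm : 0 < m) {t : ℝ} (ht : t ∉ Set.Ioc 0 L) :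
    deriv (fun t => cutoff m t * cutoff m (L - t)) t = 0 := by
  have hm' : (0 : ℝ) < m := by exact_mod_cast hm
  have hz : (fun t => cutoff m t * cutoff m (L - t)) =ᶠ[nhds t] fun _ => 0 := by
    rw [Set.mem_Ioc, not_and_or, not_lt, not_le] at ht
    rcases ht with h | h
    · have : ∀ᶠ s in nhds t, s < 1 / (m : ℝ) := gt_mem_nhds (h.trans_lt (by positivity))
      filter_upwards [this] with s hs
      rw [lt_div_iff₀ hm'] at hs
      rw [cutoff_eq_zero (by linarith), zero_mul]
    · filter_upwards [lt_mem_nhds h] with s hs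
      rw [cutoff_eq_zero (t := L - s) (by nlinarith), mul_zero]
  rw [hz.deriv_eq, deriv_const]

end Cutoff

/-! ### Integration by parts up to the boundary of the reference simplex -/

section Corner
variable {k : ℕ}

/-- A test function on the corner simplex approximating `1`. -/
noncomputable def cornerCutoff (n m : ℕ) (x : Fin n → ℝ) : ℝ :=
  cutoff m (1 - ∑ i, x i) * ∏ i, cutoff m (x i)

theorem contDiff_cornerCutoff (n m : ℕ) : ContDiff ℝ ∞ (cornerCutoff n m) := by
  have h := contDiff_cutoff m
  exact (h.comp (contDiff_const.sub (ContDiff.sum fun i _ => contDiff_apply ℝ ℝ i))).mul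
    (contDiff_prod fun i _ => h.comp (contDiff_apply ℝ ℝ i))

theorem abs_cornerCutoff_le (n m : ℕ) (x : Fin n → ℝ) : |cornerCutoff n m x| ≤ 1 := by
  rw [cornerCutoff, abs_of_nonneg (mul_nonneg (cutoff_nonneg _ _)
    (Finset.prod_nonneg fun i _ => cutoff_nonneg _ _))]
  exact mul_le_one₀ (cutoff_le_one _ _) (Finset.prod_nonneg fun i _ => cutoff_nonneg _ _)
    (Finset.prod_le_one (fun i _ => cutoff_nonneg _ _) fun i _ => cutoff_le_one _ _)

theorem tsupport_cornerCutoff_subset (n : ℕ) {m : ℕ} (hm : 0 < m) :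
    tsupport (cornerCutoff n m) ⊆ openCornerSimplex n := by
  have hm' : (0 : ℝ) < m := by exact_mod_cast hm
  have hc : IsClosed {x : Fin n → ℝ | (∀ i, 1 / (m : ℝ) ≤ x i) ∧ 1 / (m : ℝ) ≤ 1 - ∑ i, x i} := by
    refine IsClosed.inter (s₁ := {x | ∀ i, 1 / (m : ℝ) ≤ x i}) ?_
      (isClosed_le continuous_const
        (continuous_const.sub (continuous_finsetSum _ fun i _ => continuous_apply i)))
    simp only [Set.ofPred_forall]
    exact isClosed_iInter fun i => isClosed_le continuous_const (continuous_apply i)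
  have hs : tsupport (cornerCutoff n m) ⊆
      {x : Fin n → ℝ | (∀ i, 1 / (m : ℝ) ≤ x i) ∧ 1 / (m : ℝ) ≤ 1 - ∑ i, x i} := by
    refine closure_minimal (fun x hx => ?_) hc
    rw [Function.mem_support, cornerCutoff, mul_ne_zero_iff, Finset.prod_ne_zero_iff] at hx
    have hh : ∀ t, cutoff m t ≠ 0 → 1 / (m : ℝ) ≤ t := by
      intro t ht
      by_contra h
      rw [not_le, lt_div_iff₀ hm'] at h
      exact ht (cutoff_eq_zero (by linarith))
    exact ⟨fun i => hh _ (hx.2 i (Finset.mem_univ i)), hh _ hx.1⟩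
  intro x hx
  have := hs hx
  have h0 : 0 < 1 / (m : ℝ) := by positivity
  exact ⟨fun i => h0.trans_le (this.1 i), by linarith [this.2]⟩

theorem hasCompactSupport_cornerCutoff (n : ℕ) {m : ℕ} (hm : 0 < m) :
    HasCompactSupport (cornerCutoff n m) :=
  (isCompact_cornerSimplex n).of_isClosed_subset (isClosed_tsupport _)
    ((tsupport_cornerCutoff_subset n hm).trans (openCornerSimplex_subset n))

theorem tendsto_cornerCutoff {n : ℕ} {x : Fin n → ℝ} (hx : x ∈ openCornerSimplex n) :
    Filter.Tendsto (fun m => cornerCutoff n m x) Filter.atTop (nhds 1) := by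
  have h : ∀ t : ℝ, 0 < t → Filter.Tendsto (fun m => cutoff m t) Filter.atTop (nhds 1) := by
    intro t ht
    refine tendsto_const_nhds.congr' ?_
    have := (tendsto_natCast_atTop_atTop (R := ℝ)).eventually_ge_atTop (2 / t)
    filter_upwards [this] with m hm
    rw [div_le_iff₀ ht] at hm
    exact (cutoff_eq_one hm).symm
  have h1 := (h (1 - ∑ i, x i) (by linarith [hx.2])).mul
    (tendsto_finsetProd Finset.univ fun i _ => h (x i) (hx.1 i))
  simpa [cornerCutoff] using h1

/-- On a line in the direction `e_0` the cut-off is a constant times the one-dimensional product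
above. This single direction suffices, because the vertices of a simplex can be renumbered. -/
theorem fderiv_cornerCutoff_cons (m : ℕ) (t : ℝ) (y : Fin k → ℝ) :
    fderiv ℝ (cornerCutoff (k + 1) m) (Fin.cons t y) (Pi.single 0 1) =
      (∏ i, cutoff m (y i)) *
        deriv (fun t => cutoff m t * cutoff m ((1 - ∑ i, y i) - t)) t := by
  have hl : HasDerivAt (fun s : ℝ => (Fin.cons s y : Fin (k + 1) → ℝ)) (Pi.single 0 1) t := by
    rw [hasDerivAt_pi]
    intro i
    refine Fin.cases ?_ (fun i => ?_) i
    · simpa using hasDerivAt_id' t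
    · simpa using hasDerivAt_const t (y i)
  have h1 := (((contDiff_cornerCutoff (k + 1) m).differentiable (by simp)
    (Fin.cons t y)).hasFDerivAt.comp_hasDerivAt t hl).deriv
  rw [← h1]
  have e : cornerCutoff (k + 1) m ∘ (fun s : ℝ => (Fin.cons s y : Fin (k + 1) → ℝ)) = fun s =>
      (∏ i, cutoff m (y i)) * (cutoff m s * cutoff m ((1 - ∑ i, y i) - s)) := by
    ext s
    simp only [Function.comp_apply, cornerCutoff, Fin.sum_univ_succ, Fin.prod_univ_succ,
      Fin.cons_zero, Fin.cons_succ]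
    rw [show 1 - (s + ∑ i, y i) = 1 - ∑ i, y i - s by ring]
    ring
  rw [e, deriv_const_mul]
  exact (hasDerivAt_cutoff_mul m _ t).differentiableAt

theorem cons_mem_cornerSimplex {y : Fin k → ℝ} (hy : y ∈ cornerSimplex k) {t : ℝ}
    (ht : t ∈ Set.Icc 0 (1 - ∑ i, y i)) : (Fin.cons t y : Fin (k + 1) → ℝ) ∈ cornerSimplex (k + 1) := by
  refine ⟨fun i => ?_, ?_⟩
  · refine Fin.cases ?_ (fun i => ?_) i
    · simpa using ht.1
    · simpa using hy.1 i
  · rw [Fin.sum_univ_succ]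
    simp only [Fin.cons_zero, Fin.cons_succ]
    linarith [ht.2]

theorem continuous_cons_left (y : Fin k → ℝ) :
    Continuous (fun t : ℝ => (Fin.cons t y : Fin (k + 1) → ℝ)) := by
  refine continuous_pi fun i => ?_
  refine Fin.cases ?_ (fun i => ?_) i
  · simpa using continuous_id'
  · simpa using continuous_const

/-- Fubini for the coordinate `0`. The measurability of the inner integral is recorded because
dominated convergence is applied to it. -/
theorem integral_eq_integral_cons {f : (Fin (k + 1) → ℝ) → ℝ} (hf : Integrable f) :
    ∫ x, f x = ∫ y : Fin k → ℝ, ∫ t : ℝ, f (Fin.cons t y) ∧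
      AEStronglyMeasurable (fun y : Fin k → ℝ => ∫ t : ℝ, f (Fin.cons t y)) := by
  have hmp := (volume_preserving_piFinSuccAbove (fun _ : Fin (k + 1) => ℝ) 0).symm
  have he := (MeasurableEquiv.piFinSuccAbove (fun _ : Fin (k + 1) => ℝ) 0).symm.measurableEmbedding
  have h1 : Integrable (fun z : ℝ × (Fin k → ℝ) => f (Fin.cons z.1 z.2)) (volume.prod volume) := by
    have := (hmp.integrable_comp_emb he).2 hf
    simpa [Function.comp_def, MeasurableEquiv.piFinSuccAbove_symm_apply, Measure.volume_eq_prod,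
      Fin.consEquiv] using this
  refine ⟨?_, h1.aestronglyMeasurable.prod_swap.integral_prod_right'⟩
  rw [← integral_prod_symm _ h1, ← hmp.integral_comp he]
  simp [MeasurableEquiv.piFinSuccAbove_symm_apply, Measure.volume_eq_prod, Fin.consEquiv]

end Corner
end Morley

namespace Morley
section Corner
variable {k : ℕ}

theorem openCornerSimplex_ae_eq (k : ℕ) : openCornerSimplex k =ᵐ[volume] cornerSimplex k := by
  rw [← interior_cornerSimplex]
  exact interior_ae_eq_of_null_frontier ((convex_cornerSimplex k).addHaar_frontier volume)

theorem exists_bound_cornerSimplex {F : (Fin k → ℝ) → ℝ} (hF : ContinuousOn F (cornerSimplex k)) :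
    ∃ K, 0 ≤ K ∧ ∀ x ∈ cornerSimplex k, |F x| ≤ K := by
  obtain ⟨K, hK⟩ := (isCompact_cornerSimplex k).exists_bound_of_continuousOn hF
  exact ⟨max K 0, le_max_right _ _, fun x hx => (hK x hx).trans (le_max_left _ _)⟩

theorem continuousOn_comp_cons {F : (Fin (k + 1) → ℝ) → ℝ}
    (hF : ContinuousOn F (cornerSimplex (k + 1))) {y : Fin k → ℝ} (hy : y ∈ cornerSimplex k) :
    ContinuousOn (fun t : ℝ => F (Fin.cons t y)) (Set.Icc 0 (1 - ∑ i, y i)) :=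
  hF.comp (continuous_cons_left y).continuousOn fun _ ht => cons_mem_cornerSimplex hy ht

theorem integral_line_cornerCutoff (F : (Fin (k + 1) → ℝ) → ℝ) {m : ℕ} (hm : 0 < m)
    (y : Fin k → ℝ) (hL : 0 ≤ 1 - ∑ i, y i) :
    ∫ t : ℝ, F (Fin.cons t y) * fderiv ℝ (cornerCutoff (k + 1) m) (Fin.cons t y) (Pi.single 0 1) =
      (∏ i, cutoff m (y i)) * ∫ t in (0 : ℝ)..(1 - ∑ i, y i),
        F (Fin.cons t y) * deriv (fun t => cutoff m t * cutoff m ((1 - ∑ i, y i) - t)) t := by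
  rw [intervalIntegral.integral_of_le hL, ← integral_const_mul]
  simp only [fderiv_cornerCutoff_cons]
  rw [← setIntegral_eq_integral_of_forall_compl_eq_zero (s := Set.Ioc 0 (1 - ∑ i, y i))]
  · refine integral_congr_ae (Filter.Eventually.of_forall fun t => ?_)
    simp only; ring
  · intro t ht
    rw [deriv_cutoff_mul_eq_zero hm ht]; ring

theorem integral_line_cornerCutoff_eq_zero (F : (Fin (k + 1) → ℝ) → ℝ) {m : ℕ} (hm : 0 < m)
    {y : Fin k → ℝ} (hy : y ∉ openCornerSimplex k) :
    ∫ t : ℝ, F (Fin.cons t y) * fderiv ℝ (cornerCutoff (k + 1) m) (Fin.cons t y) (Pi.single 0 1) =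
      0 := by
  have : ∀ t : ℝ, F (Fin.cons t y) *
      fderiv ℝ (cornerCutoff (k + 1) m) (Fin.cons t y) (Pi.single 0 1) = 0 := by
    intro t
    rw [fderiv_cornerCutoff_cons]
    have h2 : ¬ ((∀ i, 0 < y i) ∧ ∑ i, y i < 1) := hy
    rw [not_and_or] at h2
    rcases h2 with h | h
    · push Not at h
      obtain ⟨i, hi⟩ := h
      have hz : ∏ i, cutoff m (y i) = 0 := Finset.prod_eq_zero (Finset.mem_univ i)
        (cutoff_eq_zero ((mul_nonpos_of_nonneg_of_nonpos (Nat.cast_nonneg m) hi).trans one_pos.le))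
      rw [hz]; ring
    · rw [deriv_cutoff_mul_eq_zero hm fun ht => h (by linarith [ht.1, ht.2])]; ring
  simp [this]

/-- On almost every line in the direction `e_0` the inner integral tends to the difference of the
endpoint values and is bounded by `2 K`, where `K` bounds `F`. -/
theorem tendsto_integral_mul_fderiv_cornerCutoff {F : (Fin (k + 1) → ℝ) → ℝ}
    (hF : ContinuousOn F (cornerSimplex (k + 1))) :
    Filter.Tendsto (fun m : ℕ => ∫ x in openCornerSimplex (k + 1),
        F x * fderiv ℝ (cornerCutoff (k + 1) (m + 1)) x (Pi.single 0 1)) Filter.atTop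
      (nhds (∫ y in openCornerSimplex k,
        (F (Fin.cons 0 y) - F (Fin.cons (1 - ∑ i, y i) y)))) := by
  obtain ⟨K, hK0, hK⟩ := exists_bound_cornerSimplex hF
  have hFl : LocallyIntegrableOn F (openCornerSimplex (k + 1)) :=
    (hF.mono (openCornerSimplex_subset _)).locallyIntegrableOn
      (isOpen_openCornerSimplex _).measurableSet
  have hint : ∀ m : ℕ, Integrable fun x =>
      F x * fderiv ℝ (cornerCutoff (k + 1) (m + 1)) x (Pi.single 0 1) := by
    intro m
    have h := testFunction_fderiv (contDiff_cornerCutoff (k + 1) (m + 1))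
      (hasCompactSupport_cornerCutoff (k + 1) m.succ_pos) (Pi.single 0 1)
    exact integrable_mul_of_tsupport_subset hFl h.1.continuous h.2.1
      (h.2.2.trans (tsupport_cornerCutoff_subset _ m.succ_pos))
  have e : ∀ m : ℕ, ∫ x in openCornerSimplex (k + 1),
        F x * fderiv ℝ (cornerCutoff (k + 1) (m + 1)) x (Pi.single 0 1) =
      ∫ y in openCornerSimplex k, ∫ t : ℝ, F (Fin.cons t y) *
        fderiv ℝ (cornerCutoff (k + 1) (m + 1)) (Fin.cons t y) (Pi.single 0 1) := by
    intro m
    have h := testFunction_fderiv (contDiff_cornerCutoff (k + 1) (m + 1))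
      (hasCompactSupport_cornerCutoff (k + 1) m.succ_pos) (Pi.single 0 1)
    rw [setIntegral_mul_of_tsupport_subset
      (h.2.2.trans (tsupport_cornerCutoff_subset _ m.succ_pos)),
      (integral_eq_integral_cons (hint m)).1]
    refine (setIntegral_eq_integral_of_forall_compl_eq_zero fun y hy => ?_).symm
    exact integral_line_cornerCutoff_eq_zero F m.succ_pos hy
  simp only [e]
  refine tendsto_integral_of_dominated_convergence (fun _ => 2 * K)
    (fun m => (integral_eq_integral_cons (hint m)).2.restrict) (integrable_const _) ?_ ?_
  · intro m
    refine (ae_restrict_mem (isOpen_openCornerSimplex k).measurableSet).mono fun y hy => ?_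
    have hL : 0 < 1 - ∑ i, y i := by linarith [hy.2]
    have hy' := openCornerSimplex_subset k hy
    rw [integral_line_cornerCutoff F m.succ_pos y hL.le, norm_mul, Real.norm_eq_abs,
      Real.norm_eq_abs, abs_of_nonneg (Finset.prod_nonneg fun i _ => cutoff_nonneg _ _)]
    have h2 := abs_integral_mul_deriv_cutoff_mul_le hL (continuousOn_comp_cons hF hy')
      (fun t ht => hK _ (cons_mem_cornerSimplex hy' ht)) (m + 1)
    refine (mul_le_of_le_one_left (abs_nonneg _)
      (Finset.prod_le_one (fun i _ => cutoff_nonneg _ _) fun i _ => cutoff_le_one _ _)).trans h2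
  · refine (ae_restrict_mem (isOpen_openCornerSimplex k).measurableSet).mono fun y hy => ?_
    have hL : 0 < 1 - ∑ i, y i := by linarith [hy.2]
    have hy' := openCornerSimplex_subset k hy
    have h1 := tendsto_integral_mul_deriv_cutoff_mul hL (continuousOn_comp_cons hF hy')
    have h2 : Filter.Tendsto (fun m : ℕ => ∏ i, cutoff m (y i)) Filter.atTop (nhds 1) := by
      have := tendsto_cornerCutoff hy
      refine tendsto_const_nhds.congr' ?_
      have h3 : ∀ i, ∀ᶠ m : ℕ in Filter.atTop, 2 / y i ≤ m := fun i =>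
        (tendsto_natCast_atTop_atTop (R := ℝ)).eventually_ge_atTop (2 / y i)
      filter_upwards [Filter.eventually_all.2 h3] with m hm
      refine (Finset.prod_eq_one fun i _ => cutoff_eq_one ?_).symm
      exact (div_le_iff₀ (hy.1 i)).1 (hm i)
    have h3 := (h2.mul h1).comp (Filter.tendsto_add_atTop_nat 1)
    rw [one_mul] at h3
    refine h3.congr fun m => ?_
    rw [integral_line_cornerCutoff F m.succ_pos y hL.le]
    rfl

/-- Integration by parts on the corner simplex, for weak derivatives of functions that are
continuous up to the boundary. -/
theorem integral_weakDirDeriv_cornerSimplex {F G : (Fin (k + 1) → ℝ) → ℝ}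
    (hF : ContinuousOn F (cornerSimplex (k + 1)))
    (h : WeakDirDeriv (openCornerSimplex (k + 1)) (Pi.single 0 1) F G)
    (hG : IntegrableOn G (openCornerSimplex (k + 1))) :
    ∫ x in cornerSimplex (k + 1), G x =
      ∫ y in cornerSimplex k, (F (Fin.cons (1 - ∑ i, y i) y) - F (Fin.cons 0 y)) := by
  have h1 := tendsto_integral_mul_fderiv_cornerCutoff hF
  have h2 : Filter.Tendsto (fun m : ℕ => ∫ x in openCornerSimplex (k + 1),
      G x * cornerCutoff (k + 1) (m + 1) x) Filter.atTop
      (nhds (∫ x in openCornerSimplex (k + 1), G x)) := by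
    refine tendsto_integral_of_dominated_convergence (fun x => |G x|) (fun m => ?_) hG.abs ?_ ?_
    · exact hG.aestronglyMeasurable.mul
        (contDiff_cornerCutoff (k + 1) (m + 1)).continuous.aestronglyMeasurable
    · refine fun m => Filter.Eventually.of_forall fun x => ?_
      rw [norm_mul]
      exact mul_le_of_le_one_right (norm_nonneg _) (abs_cornerCutoff_le _ _ x)
    · refine (ae_restrict_mem (isOpen_openCornerSimplex _).measurableSet).mono fun x hx => ?_
      have := ((tendsto_cornerCutoff hx).comp (Filter.tendsto_add_atTop_nat 1)).const_mul (G x)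
      simpa using this
  have h3 := h2.neg.congr fun m => (h.2.2 _ (contDiff_cornerCutoff (k + 1) (m + 1))
    (hasCompactSupport_cornerCutoff (k + 1) m.succ_pos)
    (tsupport_cornerCutoff_subset _ m.succ_pos)).symm
  have h4 := tendsto_nhds_unique h3 h1
  rw [← setIntegral_congr_set (openCornerSimplex_ae_eq (k + 1)),
    ← setIntegral_congr_set (openCornerSimplex_ae_eq k)]
  have h5 : ∀ y : Fin k → ℝ, F (Fin.cons (1 - ∑ i, y i) y) - F (Fin.cons 0 y) =
      -(F (Fin.cons 0 y) - F (Fin.cons (1 - ∑ i, y i) y)) := fun y => by ring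
  simp only [h5]
  rw [integral_neg, ← h4, neg_neg]

theorem integrableOn_cornerSimplex {F : (Fin k → ℝ) → ℝ} (hF : Continuous F) :
    IntegrableOn F (cornerSimplex k) :=
  hF.continuousOn.integrableOn_compact (isCompact_cornerSimplex k)

/-- The swap of the vertices `0` and `e_i` exchanges the two barycentric coordinates. -/
theorem setIntegral_apply_cornerSimplex (i : Fin k) :
    ∫ x in cornerSimplex k, x i = ∫ x in cornerSimplex k, (1 - ∑ j, x j) := by
  have hΨ : cornerSwap i ⁻¹' cornerSimplex k = cornerSimplex k :=
    Set.ext fun x => cornerSwap_mem_iff i x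
  obtain ⟨c, h0, h1, h⟩ := exists_map_affineEquiv_volume (cornerSwap i)
  have hav := setAverage_comp_affineEquiv (cornerSwap i) (cornerSimplex k)
    (fun x => 1 - ∑ j, x j)
  rw [hΨ] at hav
  simp only [sum_cornerSwap, sub_sub_cancel, setAverage_eq, smul_eq_mul] at hav
  have hv : (volume.real (cornerSimplex k))⁻¹ ≠ 0 := inv_ne_zero
    (ENNReal.toReal_pos (volume_cornerSimplex_pos k).ne' (volume_cornerSimplex_lt_top k).ne).ne'
  exact mul_left_cancel₀ hv hav

/-- The ratio of the volumes of consecutive corner simplices. -/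
theorem volume_cornerSimplex_succ (k : ℕ) :
    (k + 1 : ℝ) * volume.real (cornerSimplex (k + 1)) = volume.real (cornerSimplex k) := by
  have hc : Continuous fun x : Fin (k + 1) → ℝ => x 0 := continuous_apply 0
  -- Integrating the derivative `1` of `x 0` expresses the volume in dimension `k + 1` as the
  -- integral of the coordinate `1 - ∑ y_i` over the simplex of dimension `k`.
  have h1 := integral_weakDirDeriv_cornerSimplex (k := k) (F := fun x => x 0) (G := fun _ => 1)
    hc.continuousOn ?_ ?_
  · simp only [Fin.cons_zero, sub_zero] at h1
    rw [setIntegral_const, smul_eq_mul, mul_one] at h1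
    rw [h1]
    -- All `k + 1` barycentric coordinates have the same integral, and they sum to `1`.
    have h2 : ∑ i : Fin k, ∫ x in cornerSimplex k, x i =
        k * ∫ x in cornerSimplex k, (1 - ∑ j, x j) := by
      simp [setIntegral_apply_cornerSimplex]
    have hi : ∀ i ∈ Finset.univ, Integrable (fun x : Fin k → ℝ => x i)
        (volume.restrict (cornerSimplex k)) := fun i _ =>
      integrableOn_cornerSimplex (continuous_apply i)
    rw [← integral_finsetSum _ hi] at h2
    have h3 : ∫ x in cornerSimplex k, (1 - ∑ j : Fin k, x j) =
        volume.real (cornerSimplex k) - ∫ x in cornerSimplex k, ∑ j : Fin k, x j := by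
      rw [integral_sub (integrable_const _) (integrable_finsetSum _ hi), setIntegral_const,
        smul_eq_mul, mul_one]
    linarith
  · have h := WeakDirDeriv.of_contDiffOn (isOpen_openCornerSimplex (k + 1))
      (contDiff_apply ℝ ℝ (0 : Fin (k + 1))).contDiffOn (Pi.single 0 1)
    have e : (fun x => fderiv ℝ (fun x : Fin (k + 1) → ℝ => x 0) x (Pi.single 0 1)) =
        fun _ => 1 := by
      ext x
      rw [(hasFDerivAt_apply (0 : Fin (k + 1)) x).fderiv]
      simp
    rw [← e]; exact h
  · exact (integrableOn_const (volume_openCornerSimplex_lt_top _).ne)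

end Corner
end Morley

namespace Morley
-- Mean values over simplices of lower dimension
section Hausdorff
variable {V : Type*} [NormedAddCommGroup V] [InnerProductSpace ℝ V] [FiniteDimensional ℝ V]
  [MeasurableSpace V] [BorelSpace V] {k : ℕ}

theorem continuous_simplexMap (P : Fin (k + 1) → V) : Continuous (simplexMap P) :=
  continuous_const.add (LinearMap.continuous_of_finiteDimensional (edgeMap P))

theorem simplexMap_injective {P : Fin (k + 1) → V} (hP : AffineIndependent ℝ P) :
    Function.Injective (simplexMap P) := fun _ _ h =>
  edgeMap_injective hP (add_left_cancel h)

theorem measurableEmbedding_simplexMap {P : Fin (k + 1) → V} (hP : AffineIndependent ℝ P) :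
    MeasurableEmbedding (simplexMap P) :=
  (continuous_simplexMap P).measurableEmbedding (simplexMap_injective hP)

/-- Translation invariance and the area formula for an injective linear map. The factor `normDet` is
irrelevant, since only mean values are used. -/
theorem exists_euclideanHausdorffMeasure_image_simplexMap {P : Fin (k + 1) → V}
    (hP : AffineIndependent ℝ P) : ∃ c : ENNReal, c ≠ 0 ∧ c ≠ ⊤ ∧ ∀ s : Set (Fin k → ℝ),
      Measure.euclideanHausdorffMeasure k (simplexMap P '' s) = c * volume s := by
  let L : EuclideanSpace ℝ (Fin k) →ₗ[ℝ] V :=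
    edgeMap P ∘ₗ (WithLp.linearEquiv 2 ℝ (Fin k → ℝ)).toLinearMap
  have hL : Function.Injective L := (edgeMap_injective hP).comp (LinearEquiv.injective _)
  have hdet : L.normDet ≠ 0 := by
    rw [Ne, LinearMap.normDet_eq_zero_iff_ker_ne_bot, not_not]
    exact LinearMap.ker_eq_bot.2 hL
  refine ⟨ENNReal.ofReal L.normDet, ?_, ENNReal.ofReal_ne_top, fun s => ?_⟩
  · rw [Ne, ENNReal.ofReal_eq_zero, not_le]
    exact lt_of_le_of_ne (LinearMap.normDet_nonneg L) hdet.symm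
  · have e1 : simplexMap P '' s = (fun x => P 0 + x) '' (L '' (WithLp.toLp 2 '' s)) := by
      rw [Set.image_image, Set.image_image]; rfl
    have h1 := L.euclideanHausdorffMeasure_image_eq_normDet_mul_volume (WithLp.toLp 2 '' s)
    rw [finrank_euclideanSpace_fin] at h1
    rw [e1, (isometry_add_left (P 0)).euclideanHausdorffMeasure_image, h1]
    congr 1
    have hp := PiLp.volume_preserving_toLp (Fin k)
    have he : MeasurableEmbedding (WithLp.toLp 2 : (Fin k → ℝ) → EuclideanSpace ℝ (Fin k)) :=
      (MeasurableEquiv.toLp 2 (Fin k → ℝ)).measurableEmbedding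
    rw [← hp.measure_preimage_emb he, Set.preimage_image_eq _ he.injective]

theorem restrict_euclideanHausdorffMeasure_simplexMap {P : Fin (k + 1) → V}
    (hP : AffineIndependent ℝ P) : ∃ c : ENNReal, c ≠ 0 ∧ c ≠ ⊤ ∧ ∀ s : Set (Fin k → ℝ),
      (Measure.euclideanHausdorffMeasure k : Measure V).restrict (simplexMap P '' s) =
        c • Measure.map (simplexMap P) (volume.restrict s) := by
  obtain ⟨c, h0, ht, h⟩ := exists_euclideanHausdorffMeasure_image_simplexMap hP
  have he := measurableEmbedding_simplexMap hP
  refine ⟨c, h0, ht, fun s => ?_⟩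
  have h1 : Measure.comap (simplexMap P) (Measure.euclideanHausdorffMeasure k : Measure V) =
      c • volume := by
    ext t _
    rw [he.comap_apply, h, Measure.smul_apply, smul_eq_mul]
  have h2 := he.map_comap (Measure.euclideanHausdorffMeasure k : Measure V)
  rw [h1] at h2
  have h3 := congrArg (fun m => m.restrict (simplexMap P '' s)) h2
  rw [Measure.restrict_restrict_of_subset (Set.image_subset_range _ _), he.restrict_map,
    Set.preimage_image_eq _ he.injective, Measure.restrict_smul, Measure.map_smul] at h3
  exact h3.symm

/-- The mean value over a `k`-simplex with respect to the `k`-dimensional measure. -/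
theorem average_convexHull_range {P : Fin (k + 1) → V} (hP : AffineIndependent ℝ P) (f : V → ℝ) :
    ⨍ x in convexHull ℝ (Set.range P), f x ∂(Measure.euclideanHausdorffMeasure k) =
      ⨍ x in cornerSimplex k, f (simplexMap P x) := by
  obtain ⟨c, h0, ht, h⟩ := restrict_euclideanHausdorffMeasure_simplexMap hP
  have he := measurableEmbedding_simplexMap hP
  have hc : c.toReal ≠ 0 := (ENNReal.toReal_pos h0 ht).ne'
  rw [← image_simplexMap, h, average_eq, average_eq, integral_smul_measure, he.integral_map]
  simp only [Measure.real, Measure.smul_apply, he.map_apply, Set.preimage_univ, smul_eq_mul,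
    ENNReal.toReal_mul, mul_inv]
  field_simp

/-- The coordinate `0` is the weight of `P 1`, so its zero set is the face without `P 1`. In the
next lemma the slanted face, where the weight of `P 0` vanishes, is the one without `P 0`. -/
theorem simplexMap_cons_zero (P : Fin (k + 2) → V) (y : Fin k → ℝ) :
    simplexMap P (Fin.cons 0 y) = simplexMap (P ∘ Fin.succAbove 1) y := by
  rw [simplexMap_eq_sum, simplexMap_eq_sum]
  simp only [Fin.sum_univ_succ (n := k), Fin.cons_zero, Fin.cons_succ, zero_smul, zero_add,
    Function.comp_apply]
  congr 1

theorem simplexMap_cons_one_sub (P : Fin (k + 2) → V) (y : Fin k → ℝ) :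
    simplexMap P (Fin.cons (1 - ∑ i, y i) y) = simplexMap (P ∘ Fin.succ) y := by
  rw [simplexMap_eq_sum, simplexMap_eq_sum]
  simp only [Fin.sum_univ_succ (n := k), Fin.cons_zero, Fin.cons_succ, Function.comp_apply]
  simp

theorem simplexMap_mem {P : Fin (k + 1) → V} {x : Fin k → ℝ} (hx : x ∈ cornerSimplex k) :
    simplexMap P x ∈ convexHull ℝ (Set.range P) := by
  rw [← image_simplexMap]; exact Set.mem_image_of_mem _ hx

/-- The mean value of the derivative along an edge of a simplex is a multiple of the difference
of the mean values over the faces opposite to its endpoints. -/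
theorem average_weakDirDeriv_simplexMap {P : Fin (k + 2) → V} (hP : AffineIndependent ℝ P)
    {f : V → ℝ} (hf : ContinuousOn f (convexHull ℝ (Set.range P))) {G : (Fin (k + 1) → ℝ) → ℝ}
    (h : WeakDirDeriv (openCornerSimplex (k + 1)) (Pi.single 0 1) (f ∘ simplexMap P) G)
    (hG : IntegrableOn G (openCornerSimplex (k + 1))) :
    ⨍ x in cornerSimplex (k + 1), G x = (k + 1 : ℝ) *
      ((⨍ x in convexHull ℝ (Set.range (P ∘ Fin.succ)), f x
          ∂(Measure.euclideanHausdorffMeasure k)) -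
        ⨍ x in convexHull ℝ (Set.range (P ∘ Fin.succAbove 1)), f x
          ∂(Measure.euclideanHausdorffMeasure k)) := by
  have hP1 : AffineIndependent ℝ (P ∘ Fin.succ) :=
    hP.comp_embedding ⟨Fin.succ, Fin.succ_injective _⟩
  have hP2 : AffineIndependent ℝ (P ∘ Fin.succAbove 1) :=
    hP.comp_embedding ⟨Fin.succAbove 1, Fin.succAbove_right_injective⟩
  rw [average_convexHull_range hP1, average_convexHull_range hP2]
  have hc : ContinuousOn (f ∘ simplexMap P) (cornerSimplex (k + 1)) :=
    hf.comp (continuous_simplexMap P).continuousOn fun x hx => simplexMap_mem hx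
  have key := integral_weakDirDeriv_cornerSimplex hc h hG
  simp only [Function.comp_apply, simplexMap_cons_zero, simplexMap_cons_one_sub] at key
  have hi : ∀ Q : Fin (k + 1) → V, Set.range Q ⊆ Set.range P →
      IntegrableOn (fun y => f (simplexMap Q y)) (cornerSimplex k) := fun Q hQ =>
    ContinuousOn.integrableOn_compact (isCompact_cornerSimplex k)
      (hf.comp (continuous_simplexMap Q).continuousOn
        fun x hx => convexHull_mono hQ (simplexMap_mem hx))
  -- The factor `k + 1` in the conclusion is the ratio of the volumes of the two reference
  -- simplices.
  have hv := volume_cornerSimplex_succ k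
  have hv1 : volume.real (cornerSimplex (k + 1)) ≠ 0 :=
    (ENNReal.toReal_pos (volume_cornerSimplex_pos _).ne' (volume_cornerSimplex_lt_top _).ne).ne'
  have hk : (k + 1 : ℝ) ≠ 0 := by positivity
  rw [setAverage_eq, setAverage_eq, setAverage_eq, key,
    integral_sub (hi _ (Set.range_comp_subset_range _ _)) (hi _ (Set.range_comp_subset_range _ _)),
    ← hv]
  simp only [smul_eq_mul]
  field_simp

end Hausdorff
end Morley

/-! ### Means of edge derivatives over a simplex and its faces -/

namespace Morley
variable {d : ℕ}

/-- Renumbers the vertices so that a prescribed edge runs from vertex `0` to vertex `1`, where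
integration by parts in the direction `e_0` applies. -/
theorem exists_enum {ι : Type*} [DecidableEq ι] {s : Finset ι} {k : ℕ} (hs : s.card = k + 2)
    {a b : ι} (ha : a ∈ s) (hb : b ∈ s) (hab : a ≠ b) :
    ∃ e : Fin (k + 2) → ι, Function.Injective e ∧ Set.range e = s ∧ e 0 = b ∧ e 1 = a := by
  let σ := (s.equivFinOfCardEq hs).symm
  let i := σ.symm ⟨b, hb⟩
  let j := σ.symm ⟨a, ha⟩
  have hij : j ≠ i := by
    intro h
    have := σ.symm.injective h
    exact hab (by simpa using this)
  let j' := Equiv.swap 0 i j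
  have hj' : j' ≠ 0 := by
    intro h
    have : Equiv.swap 0 i j = Equiv.swap 0 i i := by rw [Equiv.swap_apply_right]; exact h
    exact hij ((Equiv.swap 0 i).injective this)
  let π : Equiv.Perm (Fin (k + 2)) := (Equiv.swap 1 j').trans (Equiv.swap 0 i)
  have h0 : π 0 = i := by
    change Equiv.swap 0 i (Equiv.swap 1 j' 0) = i
    rw [Equiv.swap_apply_of_ne_of_ne (by simp) hj'.symm, Equiv.swap_apply_left]
  have h1 : π 1 = j := by
    change Equiv.swap 0 i (Equiv.swap 1 j' 1) = j
    rw [Equiv.swap_apply_left]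
    exact Equiv.swap_apply_self _ _ _
  refine ⟨fun x => (σ (π x) : ι), ?_, ?_, ?_, ?_⟩
  · exact Subtype.val_injective.comp (σ.injective.comp π.injective)
  · have : (fun x => (σ (π x) : ι)) = Subtype.val ∘ (π.trans σ) := rfl
    rw [this, Set.range_comp, (π.trans σ).surjective.range_eq]
    simp
  · simp only [h0]; simp [i]
  · simp only [h1]; simp [j]

theorem exists_enum' {ι : Type*} [DecidableEq ι] {s : Finset ι} {k : ℕ} (hs : s.card = k + 1) :
    ∃ e : Fin (k + 1) → ι, Function.Injective e ∧ Set.range e = s := by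
  let σ := (s.equivFinOfCardEq hs).symm
  refine ⟨Subtype.val ∘ σ, Subtype.val_injective.comp σ.injective, ?_⟩
  rw [Set.range_comp, σ.surjective.range_eq]
  simp

theorem range_comp_succ_eq {ι : Type*} [DecidableEq ι] {s : Finset ι} {k : ℕ}
    {e : Fin (k + 2) → ι} (he : Function.Injective e) (hs : Set.range e = s) :
    Set.range (e ∘ Fin.succ) = (s.erase (e 0) : Finset ι) ∧
      Set.range (e ∘ Fin.succAbove 1) = (s.erase (e 1) : Finset ι) := by
  constructor
  · rw [Set.range_comp, Fin.range_succ, Finset.coe_erase, ← hs, Set.compl_eq_univ_sdiff,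
      Set.image_sdiff he, Set.image_univ, Set.image_singleton]
  · rw [Set.range_comp, Fin.range_succAbove, Finset.coe_erase, ← hs, Set.compl_eq_univ_sdiff,
      Set.image_sdiff he, Set.image_univ, Set.image_singleton]

/-- The mean value over the subsimplex with vertices `T i`, `i ∈ s`. -/
noncomputable def meanOn (T : Simplex d) (s : Finset (Fin (d + 1))) (f : E d → ℝ) : ℝ :=
  ⨍ x in convexHull ℝ (T '' s), f x ∂(Measure.euclideanHausdorffMeasure (s.card - 1))

theorem meanOn_eq (T : Simplex d) {s : Finset (Fin (d + 1))} {k : ℕ} {e : Fin (k + 1) → Fin (d + 1)}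
    (he : Function.Injective e) (hs : Set.range e = s) (f : E d → ℝ) :
    meanOn T s f = ⨍ x in cornerSimplex k, f (simplexMap (T ∘ e) x) := by
  have hc : s.card - 1 = k := by
    have : s = Finset.univ.image e := by
      rw [← Finset.coe_inj, ← hs]; simp
    rw [this, Finset.card_image_of_injective _ he]; simp
  have hP : AffineIndependent ℝ (T ∘ e) := T.ind.comp_embedding ⟨e, he⟩
  rw [meanOn, hc, ← average_convexHull_range hP, ← hs, Set.range_comp]

theorem meanOn_eq' (T : Simplex d) {s : Finset (Fin (d + 1))} {k : ℕ} {e : Fin (k + 1) → Fin (d + 1)}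
    (he : Function.Injective e) (hs : Set.range e = s) (f : E d → ℝ) :
    meanOn T s f = ⨍ x in convexHull ℝ (Set.range (T ∘ e)), f x
      ∂(Measure.euclideanHausdorffMeasure k) := by
  have hP : AffineIndependent ℝ (T ∘ e) := T.ind.comp_embedding ⟨e, he⟩
  rw [meanOn_eq T he hs, average_convexHull_range hP]

theorem convexHull_range_comp_subset (T : Simplex d) {k : ℕ} (e : Fin (k + 1) → Fin (d + 1)) :
    convexHull ℝ (Set.range (T ∘ e)) ⊆ body T :=
  convexHull_mono (Set.range_comp_subset_range _ _)

theorem meanOn_sum (T : Simplex d) {s : Finset (Fin (d + 1))} (hs : s.Nonempty) {ι : Type*}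
    (t : Finset ι) (c : ι → ℝ) {f : ι → E d → ℝ} (hf : ∀ i ∈ t, ContinuousOn (f i) (body T)) :
    meanOn T s (fun x => ∑ i ∈ t, c i * f i x) = ∑ i ∈ t, c i * meanOn T s (f i) := by
  obtain ⟨k, hk⟩ : ∃ k, s.card = k + 1 := ⟨s.card - 1, by have := hs.card_pos; omega⟩
  obtain ⟨e, he, hes⟩ := exists_enum' hk
  simp only [meanOn_eq T he hes, setAverage_eq]
  rw [integral_finsetSum]
  · simp only [integral_const_mul, smul_eq_mul, Finset.mul_sum]
    exact Finset.sum_congr rfl fun i _ => by ring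
  · intro i hi
    refine Integrable.const_mul ?_ _
    exact ContinuousOn.integrableOn_compact (isCompact_cornerSimplex k)
      ((hf i hi).comp (continuous_simplexMap (T ∘ e)).continuousOn
        fun x hx => convexHull_range_comp_subset T e (simplexMap_mem hx))

theorem uniqueDiffOn_body (T : Simplex d) : UniqueDiffOn ℝ (body T) :=
  uniqueDiffOn_convex (convex_body T) (interior_body_nonempty T)

theorem continuousOn_fderivWithin_body {T : Simplex d} {f : E d → ℝ}
    (hf : ContDiffOn ℝ 1 f (body T)) (v : E d) :
    ContinuousOn (fun x => fderivWithin ℝ f (body T) x v) (body T) :=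
  (hf.continuousOn_fderivWithin (uniqueDiffOn_body T) le_rfl).clm_apply continuousOn_const

theorem hasFDerivAt_simplexMap {V : Type*} [NormedAddCommGroup V] [NormedSpace ℝ V]
    {k : ℕ} (P : Fin (k + 1) → V) (x : Fin k → ℝ) :
    HasFDerivAt (simplexMap P) (LinearMap.toContinuousLinearMap (edgeMap P)) x :=
  (LinearMap.toContinuousLinearMap (edgeMap P)).hasFDerivAt.const_add (P 0)

theorem contDiff_simplexMap {V : Type*} [NormedAddCommGroup V] [NormedSpace ℝ V]
    {k : ℕ} (P : Fin (k + 1) → V) : ContDiff ℝ 1 (simplexMap P) :=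
  contDiff_const.add (LinearMap.toContinuousLinearMap (edgeMap P)).contDiff

/-- The mean over a subsimplex of the derivative along one of its edges. -/
theorem meanOn_fderivWithin_edge {T : Simplex d} {f : E d → ℝ} (hf : ContDiffOn ℝ 1 f (body T))
    {s : Finset (Fin (d + 1))} {a b : Fin (d + 1)} (ha : a ∈ s) (hb : b ∈ s) :
    meanOn T s (fun x => fderivWithin ℝ f (body T) x (T a - T b)) =
      ((s.card : ℝ) - 1) * (meanOn T (s.erase b) f - meanOn T (s.erase a) f) := by
  have hne : s.Nonempty := ⟨a, ha⟩
  by_cases hab : a = b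
  · subst hab
    -- The empty sum expresses that the mean of the zero function is zero.
    have := meanOn_sum T hne (∅ : Finset ℕ) (fun _ => 0) (f := fun _ => f) (by simp)
    simpa using this
  obtain ⟨k, hk⟩ : ∃ k, s.card = k + 2 := by
    have : 1 < s.card := Finset.one_lt_card.2 ⟨a, ha, b, hb, hab⟩
    exact ⟨s.card - 2, by omega⟩
  obtain ⟨e, he, hes, h0, h1⟩ := exists_enum hk ha hb hab
  obtain ⟨hr0, hr1⟩ := range_comp_succ_eq he hes
  set P := T ∘ e with hP
  have hPi : AffineIndependent ℝ P := T.ind.comp_embedding ⟨e, he⟩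
  have hmaps : Set.MapsTo (simplexMap P) (cornerSimplex (k + 1)) (body T) := fun x hx =>
    convexHull_range_comp_subset T e (simplexMap_mem hx)
  have hmaps' : Set.MapsTo (simplexMap P) (openCornerSimplex (k + 1)) (body T) :=
    hmaps.mono_left (openCornerSimplex_subset _)
  have hGc : ContinuousOn (fun x => fderivWithin ℝ f (body T) (simplexMap P x) (T a - T b))
      (cornerSimplex (k + 1)) :=
    (continuousOn_fderivWithin_body hf (T a - T b)).comp
      (continuous_simplexMap P).continuousOn hmaps
  have hGi := ContinuousOn.integrableOn_compact (isCompact_cornerSimplex (k + 1)) hGc (μ := volume)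
  have hw := WeakDirDeriv.of_contDiffOn (isOpen_openCornerSimplex (k + 1))
    (hf.comp (contDiff_simplexMap P).contDiffOn hmaps') (Pi.single 0 1)
  have hder : ∀ x ∈ openCornerSimplex (k + 1), fderiv ℝ (f ∘ simplexMap P) x (Pi.single 0 1) =
      fderivWithin ℝ f (body T) (simplexMap P x) (T a - T b) := by
    intro x hx
    have hd := (((hf.differentiableOn (by simp)) _ (hmaps' hx)).hasFDerivWithinAt.comp x
      (hasFDerivAt_simplexMap P x).hasFDerivWithinAt hmaps').hasFDerivAt
      ((isOpen_openCornerSimplex _).mem_nhds hx)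
    rw [hd.fderiv]
    simp only [ContinuousLinearMap.comp_apply, LinearMap.coe_toContinuousLinearMap', edgeMap_single]
    simp [hP, h0, h1]
  have hw' := hw.congr_ae (f' := f ∘ simplexMap P)
    (g' := fun x => fderivWithin ℝ f (body T) (simplexMap P x) (T a - T b))
    Filter.EventuallyEq.rfl
    ((ae_restrict_mem (isOpen_openCornerSimplex _).measurableSet).mono fun x hx => hder x hx)
  have key := average_weakDirDeriv_simplexMap hPi
    (hf.continuousOn.mono (convexHull_range_comp_subset T e)) hw'
    (hGi.mono_set (openCornerSimplex_subset _))
  rw [meanOn_eq T he hes, key, ← h0, ← h1,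
    meanOn_eq' T (he.comp (Fin.succ_injective _)) hr0,
    meanOn_eq' T (he.comp (Fin.succAbove_right_injective (p := 1))) hr1, hk]
  push_cast
  rw [hP, Function.comp_assoc, Function.comp_assoc]
  ring

/-- The mean over a simplex of the weak derivative along one of its edges. -/
theorem average_weakDirDeriv_edge {T : Simplex d} {f g : E d → ℝ} (hf : ContinuousOn f (body T))
    {a b : Fin (d + 1)} (hab : a ≠ b) (h : WeakDirDeriv (interior (body T)) (T a - T b) f g)
    (hg : IntegrableOn g (interior (body T))) :
    ⨍ x in interior (body T), g x =
      d * (meanOn T {b}ᶜ f - meanOn T {a}ᶜ f) := by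
  obtain ⟨k, rfl⟩ : ∃ k, d = k + 1 := by
    rcases d with _ | k
    · exact absurd (Fin.ext (by omega)) hab
    · exact ⟨k, rfl⟩
  obtain ⟨e, he, hes, h0, h1⟩ := exists_enum (s := Finset.univ) (k := k) (by simp)
    (Finset.mem_univ a) (Finset.mem_univ b) hab
  obtain ⟨hr0, hr1⟩ := range_comp_succ_eq he hes
  set P := T ∘ e with hP
  have hPi : AffineIndependent ℝ P := T.ind.comp_embedding ⟨e, he⟩
  have hrange : Set.range P = Set.range T := by
    rw [hP, Set.range_comp, hes]; simp
  have hrank : Module.finrank ℝ (E (k + 1)) = k + 1 := by simp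
  have hbody : convexHull ℝ (Set.range P) = body T := by rw [hrange]; rfl
  have hpre : simplexEquiv P hPi hrank ⁻¹' interior (body T) = openCornerSimplex (k + 1) := by
    rw [← hbody]; exact preimage_simplexEquiv_interior P hPi hrank
  have hw := WeakDirDeriv.comp_affineEquiv (simplexEquiv P hPi hrank) (v := Pi.single 0 1)
    (Ω := interior (body T)) (f := f) (g := g) (by
      rw [simplexEquiv_linear_single]
      simpa [hP, h0, h1] using h)
  rw [hpre, coe_simplexEquiv] at hw
  have hgi : IntegrableOn (g ∘ simplexMap P) (openCornerSimplex (k + 1)) := by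
    have := MemLp.comp_affineEquiv (simplexEquiv P hPi hrank) (memLp_one_iff_integrable.2 hg)
    rw [hpre, coe_simplexEquiv] at this
    exact memLp_one_iff_integrable.1 this
  have key := average_weakDirDeriv_simplexMap hPi (by rw [hbody]; exact hf) hw hgi
  have e1 : ⨍ x in cornerSimplex (k + 1), (g ∘ simplexMap P) x = ⨍ x in interior (body T), g x := by
    rw [← setAverage_comp_affineEquiv (simplexEquiv P hPi hrank), hpre, coe_simplexEquiv,
      setAverage_congr (openCornerSimplex_ae_eq _)]
    rfl
  have hb' : ({b}ᶜ : Finset (Fin (k + 1 + 1))) = Finset.univ.erase (e 0) := by rw [h0]; ext; simp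
  have ha' : ({a}ᶜ : Finset (Fin (k + 1 + 1))) = Finset.univ.erase (e 1) := by rw [h1]; ext; simp
  rw [← e1, key, ha', hb',
    meanOn_eq' T (he.comp (Fin.succ_injective _)) hr0,
    meanOn_eq' T (he.comp (Fin.succAbove_right_injective (p := 1))) hr1]
  push_cast
  rw [hP, Function.comp_assoc, Function.comp_assoc]

end Morley

namespace Morley
variable {d : ℕ}

/-! ### Gradients of the barycentric coordinates -/

section Bary

theorem hasFDerivAt_bary (T : Simplex d) (i : Fin (d + 1)) (x : E d) :
    HasFDerivAt (bary T i) (innerSL ℝ (baryGrad T i)) x := by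
  have h : ∀ y, HasFDerivAt (bary T i) (LinearMap.toContinuousLinearMap (T.coord i).linear) y := by
    intro y
    have e : bary T i = fun z =>
        LinearMap.toContinuousLinearMap (T.coord i).linear z + T.coord i 0 := by
      ext z
      rw [bary, AffineMap.decomp (T.coord i)]
      simp
    rw [e]
    exact (LinearMap.toContinuousLinearMap (T.coord i).linear).hasFDerivAt.add_const _
  have e2 : innerSL ℝ (baryGrad T i) = LinearMap.toContinuousLinearMap (T.coord i).linear := by
    ext v
    rw [innerSL_apply_apply, baryGrad, gradient, InnerProductSpace.toDual_symm_apply, (h (T i)).fderiv]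
  rw [e2]
  exact h x

theorem inner_baryGrad (T : Simplex d) (i : Fin (d + 1)) (v : E d) :
    inner ℝ (baryGrad T i) v = T.coord i v - T.coord i 0 := by
  have e : (fun z : E d => T.coord i z) = fun z => (T.coord i).linear z + T.coord i 0 := by
    ext z; conv_lhs => rw [AffineMap.decomp (T.coord i)]
    simp
  have h : HasFDerivAt (bary T i) (LinearMap.toContinuousLinearMap (T.coord i).linear) 0 := by
    have : bary T i = fun z =>
        LinearMap.toContinuousLinearMap (T.coord i).linear z + T.coord i 0 := e
    rw [this]
    exact (LinearMap.toContinuousLinearMap (T.coord i).linear).hasFDerivAt.add_const _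
  have := congrArg (fun L : E d →L[ℝ] ℝ => L v) ((hasFDerivAt_bary T i 0).unique h)
  simp only [innerSL_apply_apply, LinearMap.coe_toContinuousLinearMap'] at this
  rw [this, congrFun e v]; ring

theorem sum_inner_baryGrad (T : Simplex d) (v : E d) : ∑ i, inner ℝ (baryGrad T i) v = 0 := by
  simp [inner_baryGrad, Finset.sum_sub_distrib]

theorem sum_inner_baryGrad_smul (T : Simplex d) (v : E d) :
    ∑ i, inner ℝ (baryGrad T i) v • T i = v := by
  simp [inner_baryGrad, sub_smul, Finset.sum_sub_distrib, T.linear_combination_coord_eq_self]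

/-- Every direction is a combination of edge vectors at `T b` with coefficients `∇λ_i · v`; this
extends the edge formulas to arbitrary directions. -/
theorem sum_inner_baryGrad_smul_sub (T : Simplex d) (b : Fin (d + 1)) (v : E d) :
    ∑ i, inner ℝ (baryGrad T i) v • (T i - T b) = v := by
  simp only [smul_sub, Finset.sum_sub_distrib, ← Finset.sum_smul, sum_inner_baryGrad,
    sum_inner_baryGrad_smul, zero_smul, sub_zero]

theorem baryGrad_ne_zero (hd : 1 ≤ d) (T : Simplex d) (i : Fin (d + 1)) : baryGrad T i ≠ 0 := by
  obtain ⟨j, hj⟩ : ∃ j : Fin (d + 1), j ≠ i := by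
    have : Nontrivial (Fin (d + 1)) := Fin.nontrivial_iff_two_le.2 (by omega)
    exact exists_ne i
  intro h
  have h1 := inner_baryGrad T i (T i)
  have h2 := inner_baryGrad T i (T j)
  rw [h, inner_zero_left] at h1 h2
  rw [T.coord_apply_eq] at h1
  rw [T.coord_apply_ne hj.symm] at h2
  linarith

end Bary

/-! ### Mean second derivatives expressed by the Morley degrees of freedom -/

section Identity

/-- The mean of a weak directional derivative in terms of the means over the faces. -/
theorem average_weakDirDeriv {T : Simplex d} {f : E d → ℝ} (hf : ContinuousOn f (body T))
    {D : E d → E d → ℝ} (hD : ∀ v, WeakDirDeriv (interior (body T)) v f (D v))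
    (hDi : ∀ v, IntegrableOn (D v) (interior (body T))) (v : E d) :
    ⨍ x in interior (body T), D v x =
      -(d * ∑ i, inner ℝ (baryGrad T i) v * meanOn T {i}ᶜ f) := by
  have h1 : WeakDirDeriv (interior (body T)) v f
      (fun x => ∑ i, inner ℝ (baryGrad T i) v * D (T i - T 0) x) := by
    have := WeakDirDeriv.sum_left (s := Finset.univ) (V := fun i => T i - T 0)
      (c := fun i => inner ℝ (baryGrad T i) v) (hD 0).1 (fun i _ => hD (T i - T 0))
    rwa [sum_inner_baryGrad_smul_sub] at this
  have h2 := WeakDirDeriv.ae_eq isOpen_interior (hD v) h1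
  have h3 : ∀ i, ⨍ x in interior (body T), D (T i - T 0) x =
      d * (meanOn T {0}ᶜ f - meanOn T {i}ᶜ f) := by
    intro i
    -- For the degenerate edge, `D 0` vanishes almost everywhere by uniqueness of the weak
    -- derivative in the direction `0`.
    by_cases h0 : i = 0
    · subst h0
      have h4 := hD (T 0 - T 0)
      rw [sub_self] at h4 ⊢
      have h5 : WeakDirDeriv (interior (body T)) 0 f (fun _ => 0) :=
        ⟨h4.1, (integrable_zero _ _ _).locallyIntegrable.locallyIntegrableOn _, by simp⟩
      rw [average_congr (WeakDirDeriv.ae_eq isOpen_interior h4 h5)]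
      simp [average_eq]
    · exact average_weakDirDeriv_edge hf h0 (hD _) (hDi _)
  have h4 : ⨍ x in interior (body T), ∑ i, inner ℝ (baryGrad T i) v * D (T i - T 0) x =
      ∑ i, inner ℝ (baryGrad T i) v * ⨍ x in interior (body T), D (T i - T 0) x := by
    simp only [setAverage_eq]
    rw [integral_finsetSum _ fun i _ => (hDi _).const_mul _]
    simp only [integral_const_mul, smul_eq_mul, Finset.mul_sum]
    exact Finset.sum_congr rfl fun i _ => by ring
  rw [average_congr h2, h4]
  simp only [h3]
  have h5 := sum_inner_baryGrad T v
  calc ∑ i, inner ℝ (baryGrad T i) v * (d * (meanOn T {0}ᶜ f - meanOn T {i}ᶜ f))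
      = (∑ i, inner ℝ (baryGrad T i) v) * (d * meanOn T {0}ᶜ f) -
        d * ∑ i, inner ℝ (baryGrad T i) v * meanOn T {i}ᶜ f := by
        rw [Finset.sum_mul, Finset.mul_sum, ← Finset.sum_sub_distrib]
        exact Finset.sum_congr rfl fun i _ => by ring
    _ = _ := by rw [h5]; ring

theorem compl_singleton_erase {ι : Type*} [Fintype ι] [DecidableEq ι] (i j : ι) :
    ({i}ᶜ : Finset ι).erase j = {i, j}ᶜ := by
  ext; simp; tauto

/-- The mean over a face of a tangential derivative. -/
theorem meanOn_fderivWithin_tangent (hd : 1 ≤ d) {T : Simplex d} {f : E d → ℝ}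
    (hf : ContDiffOn ℝ 1 f (body T)) (i : Fin (d + 1)) {v : E d}
    (hv : inner ℝ (baryGrad T i) v = 0) :
    meanOn T {i}ᶜ (fun x => fderivWithin ℝ f (body T) x v) =
      -((d - 1 : ℝ) * ∑ j ∈ {i}ᶜ, inner ℝ (baryGrad T j) v * meanOn T {i, j}ᶜ f) := by
  obtain ⟨b, hb⟩ : ∃ b : Fin (d + 1), b ≠ i := by
    have : Nontrivial (Fin (d + 1)) := Fin.nontrivial_iff_two_le.2 (by omega)
    exact exists_ne i
  have hbm : b ∈ ({i}ᶜ : Finset (Fin (d + 1))) := by simpa using hb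
  have hcard : ((({i}ᶜ : Finset (Fin (d + 1))).card : ℕ) : ℝ) - 1 = d - 1 := by
    rw [Finset.card_compl]; simp
  -- The term of index `i` drops out because `v` is tangential to `F_i`, so only edges within the
  -- face contribute.
  have e : ∀ F : Fin (d + 1) → ℝ, ∑ j, inner ℝ (baryGrad T j) v * F j =
      ∑ j ∈ {i}ᶜ, inner ℝ (baryGrad T j) v * F j := by
    intro F
    rw [← Finset.add_sum_erase _ _ (Finset.mem_univ i), hv, zero_mul, zero_add]
    refine Finset.sum_congr ?_ fun _ _ => rfl
    ext; simp
  have h1 : ∀ x, fderivWithin ℝ f (body T) x v =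
      ∑ j ∈ {i}ᶜ, inner ℝ (baryGrad T j) v * fderivWithin ℝ f (body T) x (T j - T b) := by
    intro x
    rw [← e fun j => fderivWithin ℝ f (body T) x (T j - T b)]
    conv_lhs => rw [← sum_inner_baryGrad_smul_sub T b v]
    simp
  simp only [h1]
  rw [meanOn_sum T ⟨b, hbm⟩ _ _ fun j _ => continuousOn_fderivWithin_body hf _]
  have h2 : ∀ j ∈ ({i}ᶜ : Finset (Fin (d + 1))),
      inner ℝ (baryGrad T j) v * meanOn T {i}ᶜ (fun x => fderivWithin ℝ f (body T) x (T j - T b)) =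
      inner ℝ (baryGrad T j) v * ((d - 1) * meanOn T {i, b}ᶜ f) -
        (d - 1) * (inner ℝ (baryGrad T j) v * meanOn T {i, j}ᶜ f) := by
    intro j hj
    rw [meanOn_fderivWithin_edge hf hj hbm, hcard, compl_singleton_erase, compl_singleton_erase]
    ring
  rw [Finset.sum_congr rfl h2, Finset.sum_sub_distrib, ← Finset.mul_sum,
    ← e fun _ => (d - 1) * meanOn T {i, b}ᶜ f, ← Finset.sum_mul, sum_inner_baryGrad]
  ring

theorem dofSub_eq_meanOn (T : Simplex d) {i j : Fin (d + 1)} (hij : i ≠ j) (f : E d → ℝ) :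
    dofSub T i j f = meanOn T {i, j}ᶜ f := by
  have : ({i, j}ᶜ : Finset (Fin (d + 1))).card - 1 = d - 2 := by
    rw [Finset.card_compl, Finset.card_pair hij]; simp; omega
  rw [dofSub, meanOn, this, subface, Finset.coe_compl, Finset.coe_pair]

theorem dofNormal_eq_meanOn (T : Simplex d) (i : Fin (d + 1)) (f : E d → ℝ) :
    dofNormal T i f =
      meanOn T {i}ᶜ (fun x => fderivWithin ℝ f (body T) x (outerNormal T i)) := by
  have : ({i}ᶜ : Finset (Fin (d + 1))).card - 1 = d - 1 := by
    rw [Finset.card_compl]; simp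
  rw [dofNormal, meanOn, this, face]
  simp

theorem dofSub_comm (T : Simplex d) (i j : Fin (d + 1)) (f : E d → ℝ) :
    dofSub T i j f = dofSub T j i f := by
  rw [dofSub, dofSub, subface, subface, Set.pair_comm]

/-- The mean over a face of an arbitrary derivative, in terms of the Morley degrees of freedom. -/
theorem meanOn_fderivWithin (hd : 1 ≤ d) {T : Simplex d} {f : E d → ℝ}
    (hf : ContDiffOn ℝ 1 f (body T)) (i : Fin (d + 1)) (v : E d) :
    meanOn T {i}ᶜ (fun x => fderivWithin ℝ f (body T) x v) =
      -(inner ℝ (baryGrad T i) v / ‖baryGrad T i‖ * dofNormal T i f +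
        (d - 1 : ℝ) * ∑ j ∈ {i}ᶜ, dofSub T i j f * (inner ℝ (baryGrad T j) v -
          inner ℝ (baryGrad T i) (baryGrad T j) * inner ℝ (baryGrad T i) v /
            ‖baryGrad T i‖ ^ 2)) := by
  obtain ⟨b, hb⟩ : ∃ b : Fin (d + 1), b ≠ i := by
    have : Nontrivial (Fin (d + 1)) := Fin.nontrivial_iff_two_le.2 (by omega)
    exact exists_ne i
  have hne : ({i}ᶜ : Finset (Fin (d + 1))).Nonempty := ⟨b, by simpa using hb⟩
  have hg : ‖baryGrad T i‖ ≠ 0 := norm_ne_zero_iff.2 (baryGrad_ne_zero hd T i)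
  set g := baryGrad T i with hgdef
  -- Then `v - κ g` is tangential to `F_i`, and the remaining part `κ g` is `-(κ ‖g‖)` times the
  -- outer normal.
  set κ : ℝ := inner ℝ g v / ‖g‖ ^ 2 with hκ
  have hτ : inner ℝ g (v - κ • g) = 0 := by
    rw [inner_sub_right, inner_smul_right, real_inner_self_eq_norm_sq, hκ]
    field_simp; ring
  have h1 := meanOn_fderivWithin_tangent hd hf i hτ
  have h2 : ∀ x, fderivWithin ℝ f (body T) x v = ∑ l : Fin 2,
      (![1, -(κ * ‖g‖)] : Fin 2 → ℝ) l *
        fderivWithin ℝ f (body T) x ((![v - κ • g, outerNormal T i] : Fin 2 → E d) l) := by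
    intro x
    simp only [Fin.sum_univ_two, Matrix.cons_val_zero, Matrix.cons_val_one, outerNormal,
      ← hgdef, map_sub, map_neg, map_smul, smul_eq_mul]
    field_simp; ring
  simp only [h2]
  rw [meanOn_sum T hne _ _ fun j _ => continuousOn_fderivWithin_body hf _]
  simp only [Fin.sum_univ_two, Matrix.cons_val_zero, Matrix.cons_val_one, one_mul]
  rw [h1, ← dofNormal_eq_meanOn]
  have h3 : ∑ j ∈ {i}ᶜ, inner ℝ (baryGrad T j) (v - κ • g) * meanOn T {i, j}ᶜ f =
      ∑ j ∈ {i}ᶜ, dofSub T i j f * (inner ℝ (baryGrad T j) v -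
          inner ℝ g (baryGrad T j) * inner ℝ g v / ‖g‖ ^ 2) := by
    refine Finset.sum_congr rfl fun j hj => ?_
    have hij : i ≠ j := by
      have := hj
      simp only [Finset.mem_compl, Finset.mem_singleton] at this
      exact fun h => this h.symm
    rw [dofSub_eq_meanOn T hij, inner_sub_right, inner_smul_right,
      real_inner_comm (baryGrad T j) g, hκ]
    ring
  rw [h3, hκ]
  generalize ∑ j ∈ {i}ᶜ, dofSub T i j f * (inner ℝ (baryGrad T j) v -
    inner ℝ g (baryGrad T j) * inner ℝ g v / ‖g‖ ^ 2) = Z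
  field_simp; ring

/-- The mean of the second derivatives of a function is determined by its Morley degrees of
freedom. -/
theorem average_secondDeriv (hd : 1 ≤ d) {T : Simplex d} {f : E d → ℝ}
    (hf : ContDiffOn ℝ 1 f (body T)) (v : E d) {D : E d → E d → ℝ}
    (hD : ∀ w, WeakDirDeriv (interior (body T)) w (fun x => fderivWithin ℝ f (body T) x v) (D w))
    (hDi : ∀ w, IntegrableOn (D w) (interior (body T))) (w : E d) :
    ⨍ x in interior (body T), D w x = d * ∑ i, inner ℝ (baryGrad T i) w *
      (inner ℝ (baryGrad T i) v / ‖baryGrad T i‖ * dofNormal T i f +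
        (d - 1 : ℝ) * ∑ j ∈ {i}ᶜ, dofSub T i j f * (inner ℝ (baryGrad T j) v -
          inner ℝ (baryGrad T i) (baryGrad T j) * inner ℝ (baryGrad T i) v /
            ‖baryGrad T i‖ ^ 2)) := by
  rw [average_weakDirDeriv (continuousOn_fderivWithin_body hf v) hD hDi w]
  simp only [meanOn_fderivWithin hd hf, mul_neg, Finset.sum_neg_distrib, neg_neg]

end Identity

/-! ### Derivatives of the Morley interpolant -/

section Interp

theorem contDiff_bary (T : Simplex d) (i : Fin (d + 1)) : ContDiff ℝ ∞ (bary T i) := by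
  have e : bary T i = fun z =>
      LinearMap.toContinuousLinearMap (T.coord i).linear z + T.coord i 0 := by
    ext z
    rw [bary, AffineMap.decomp (T.coord i)]
    simp
  rw [e]
  exact (LinearMap.toContinuousLinearMap (T.coord i).linear).contDiff.add contDiff_const

theorem hasFDerivAt_thetaNormal (T : Simplex d) (i : Fin (d + 1)) (x : E d) :
    HasFDerivAt (thetaNormal T i)
      (((d * bary T i x - 1) / ‖baryGrad T i‖) • innerSL ℝ (baryGrad T i)) x := by
  have h := hasFDerivAt_bary T i x
  refine ((h.mul ((h.const_mul (d : ℝ)).sub_const 2)).mul_const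
    (2 * ‖baryGrad T i‖)⁻¹).congr_fderiv ?_
  ext v
  simp only [add_apply, smul_apply, smul_eq_mul,
    innerSL_apply_apply, mul_inv]
  ring

theorem hasFDerivAt_thetaSub (T : Simplex d) (i j : Fin (d + 1)) (x : E d) :
    HasFDerivAt (thetaSub T i j)
      ((-((d : ℝ) - 1) + d * ((d : ℝ) - 1) * bary T j x -
          (d - 1) * inner ℝ (baryGrad T i) (baryGrad T j) * (d * bary T i x - 1) /
            ‖baryGrad T i‖ ^ 2) • innerSL ℝ (baryGrad T i) +
        (-((d : ℝ) - 1) + d * ((d : ℝ) - 1) * bary T i x -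
          (d - 1) * inner ℝ (baryGrad T i) (baryGrad T j) * (d * bary T j x - 1) /
            ‖baryGrad T j‖ ^ 2) • innerSL ℝ (baryGrad T j)) x := by
  have hi := hasFDerivAt_bary T i x
  have hj := hasFDerivAt_bary T j x
  have h1 := (((hi.add hj).const_mul ((d : ℝ) - 1)).const_sub 1).add
    ((hi.const_mul (d * ((d : ℝ) - 1))).mul hj)
  have hq : ∀ {i}, HasFDerivAt (bary T i) (innerSL ℝ (baryGrad T i)) x →
    HasFDerivAt (fun x => bary T i x * (d * bary T i x - 2) * (2 * ‖baryGrad T i‖ ^ 2)⁻¹) _ x :=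
    fun h => (h.mul ((h.const_mul (d : ℝ)).sub_const 2)).mul_const _
  have h2 := h1.sub (((hq hi).add (hq hj)).const_mul
    (((d : ℝ) - 1) * inner ℝ (baryGrad T i) (baryGrad T j)))
  refine h2.congr_fderiv ?_
  ext v
  simp only [add_apply, sub_apply,
    neg_apply, smul_apply, smul_eq_mul,
    innerSL_apply_apply, mul_inv]
  ring

theorem fderiv_interp_apply (T : Simplex d) (f : E d → ℝ) (x v : E d) :
    fderiv ℝ (interp T f) x v =
      (∑ i, ∑ j ∈ Finset.Ioi i, dofSub T i j f *
        ((-((d : ℝ) - 1) + d * ((d : ℝ) - 1) * bary T j x -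
          (d - 1) * inner ℝ (baryGrad T i) (baryGrad T j) * (d * bary T i x - 1) /
            ‖baryGrad T i‖ ^ 2) * inner ℝ (baryGrad T i) v +
        (-((d : ℝ) - 1) + d * ((d : ℝ) - 1) * bary T i x -
          (d - 1) * inner ℝ (baryGrad T i) (baryGrad T j) * (d * bary T j x - 1) /
            ‖baryGrad T j‖ ^ 2) * inner ℝ (baryGrad T j) v)) +
      ∑ i, dofNormal T i f *
        ((d * bary T i x - 1) / ‖baryGrad T i‖ * inner ℝ (baryGrad T i) v) := by
  have h1 := HasFDerivAt.fun_sum (u := Finset.univ) fun (i : Fin (d + 1)) _ =>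
    HasFDerivAt.fun_sum (u := Finset.Ioi i) fun (j : Fin (d + 1)) _ =>
      (hasFDerivAt_thetaSub T i j x).const_mul (dofSub T i j f)
  have h2 := HasFDerivAt.fun_sum (u := Finset.univ) fun (i : Fin (d + 1)) _ =>
    (hasFDerivAt_thetaNormal T i x).const_mul (dofNormal T i f)
  have h3 : HasFDerivAt (interp T f) _ x := h1.add h2
  rw [h3.fderiv]
  simp only [add_apply, sum_apply, smul_apply, smul_eq_mul,
    innerSL_apply_apply]

/-- The second derivatives of the Morley interpolant. -/
theorem fderiv_fderiv_interp_apply (T : Simplex d) (f : E d → ℝ) (x v w : E d) :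
    fderiv ℝ (fun x => fderiv ℝ (interp T f) x v) x w =
      d * ∑ i, inner ℝ (baryGrad T i) w *
      (inner ℝ (baryGrad T i) v / ‖baryGrad T i‖ * dofNormal T i f +
        (d - 1 : ℝ) * ∑ j ∈ {i}ᶜ, dofSub T i j f * (inner ℝ (baryGrad T j) v -
          inner ℝ (baryGrad T i) (baryGrad T j) * inner ℝ (baryGrad T i) v /
            ‖baryGrad T i‖ ^ 2)) := by
  simp only [fderiv_interp_apply]
  have hb := fun i => hasFDerivAt_bary T i x
  have hq : ∀ i j, HasFDerivAt (fun x => (-((d : ℝ) - 1) + d * ((d : ℝ) - 1) * bary T j x -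
          (d - 1) * inner ℝ (baryGrad T i) (baryGrad T j) * (d * bary T i x - 1) /
            ‖baryGrad T i‖ ^ 2) * inner ℝ (baryGrad T i) v)
      (inner ℝ (baryGrad T i) v • ((d * ((d : ℝ) - 1)) • innerSL ℝ (baryGrad T j) -
        (d * (d - 1) * inner ℝ (baryGrad T i) (baryGrad T j) / ‖baryGrad T i‖ ^ 2) •
          innerSL ℝ (baryGrad T i))) x := by
    intro i j
    refine ((((hb j).const_mul (d * ((d : ℝ) - 1))).const_add (-((d : ℝ) - 1))).sub
      (((((hb i).const_mul (d : ℝ)).sub_const 1).const_mul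
        ((d - 1) * inner ℝ (baryGrad T i) (baryGrad T j))).mul_const
          (‖baryGrad T i‖ ^ 2)⁻¹)).mul_const _ |>.congr_fderiv ?_
    ext u
    simp only [sub_apply, smul_apply, smul_eq_mul, innerSL_apply_apply]
    ring
  have hq' : ∀ i j, HasFDerivAt (fun x => (-((d : ℝ) - 1) + d * ((d : ℝ) - 1) * bary T i x -
          (d - 1) * inner ℝ (baryGrad T i) (baryGrad T j) * (d * bary T j x - 1) /
            ‖baryGrad T j‖ ^ 2) * inner ℝ (baryGrad T j) v)
      (inner ℝ (baryGrad T j) v • ((d * ((d : ℝ) - 1)) • innerSL ℝ (baryGrad T i) -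
        (d * (d - 1) * inner ℝ (baryGrad T i) (baryGrad T j) / ‖baryGrad T j‖ ^ 2) •
          innerSL ℝ (baryGrad T j))) x := by
    intro i j
    have := hq j i
    rwa [real_inner_comm (baryGrad T i) (baryGrad T j)] at this
  have hn : ∀ i, HasFDerivAt
      (fun x => (d * bary T i x - 1) / ‖baryGrad T i‖ * inner ℝ (baryGrad T i) v)
      ((d * inner ℝ (baryGrad T i) v / ‖baryGrad T i‖) • innerSL ℝ (baryGrad T i)) x := by
    intro i
    refine (((((hb i).const_mul (d : ℝ)).sub_const 1).mul_const
      ‖baryGrad T i‖⁻¹).mul_const _).congr_fderiv ?_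
    ext u
    simp only [smul_apply, smul_eq_mul, innerSL_apply_apply]
    ring
  have h1 := HasFDerivAt.fun_sum (u := Finset.univ) fun (i : Fin (d + 1)) _ =>
    HasFDerivAt.fun_sum (u := Finset.Ioi i) fun (j : Fin (d + 1)) _ =>
      ((hq i j).add (hq' i j)).const_mul (dofSub T i j f)
  have h2 := HasFDerivAt.fun_sum (u := Finset.univ) fun (i : Fin (d + 1)) _ =>
    (hn i).const_mul (dofNormal T i f)
  refine (congrArg (fun L : E d →L[ℝ] ℝ => L w) (h1.add h2).fderiv).trans ?_
  simp only [add_apply, sub_apply, sum_apply, smul_apply, smul_eq_mul,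
    innerSL_apply_apply]
  -- The contribution of a pair `i < j` is `F i j + F j i`, so the sum over pairs becomes a sum over
  -- all off-diagonal indices, as in `average_secondDeriv`.
  set F : Fin (d + 1) → Fin (d + 1) → ℝ := fun i j =>
    d * (d - 1) * inner ℝ (baryGrad T i) w * (dofSub T i j f * (inner ℝ (baryGrad T j) v -
      inner ℝ (baryGrad T i) (baryGrad T j) * inner ℝ (baryGrad T i) v / ‖baryGrad T i‖ ^ 2))
    with hF
  have hsym : ∀ i j, dofSub T i j f *
      (inner ℝ (baryGrad T i) v * (d * ((d : ℝ) - 1) * inner ℝ (baryGrad T j) w -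
        d * (d - 1) * inner ℝ (baryGrad T i) (baryGrad T j) / ‖baryGrad T i‖ ^ 2 *
          inner ℝ (baryGrad T i) w) +
      inner ℝ (baryGrad T j) v * (d * ((d : ℝ) - 1) * inner ℝ (baryGrad T i) w -
        d * (d - 1) * inner ℝ (baryGrad T i) (baryGrad T j) / ‖baryGrad T j‖ ^ 2 *
          inner ℝ (baryGrad T j) w)) = F i j + F j i := by
    intro i j
    simp only [hF, dofSub_comm T j i, real_inner_comm (baryGrad T i) (baryGrad T j)]
    ring
  simp only [hsym]
  rw [Finset.sum_sum_Ioi_add_eq_sum_sum_off_diag (fun i j => F j i), ← Finset.sum_add_distrib, Finset.mul_sum]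
  refine Finset.sum_congr rfl fun i _ => ?_
  simp only [hF, ← Finset.mul_sum]
  ring

theorem contDiff_interp (T : Simplex d) (f : E d → ℝ) : ContDiff ℝ ∞ (interp T f) := by
  have hb := contDiff_bary T
  refine ContDiff.add (ContDiff.sum fun i _ => ContDiff.sum fun j _ => contDiff_const.mul ?_)
    (ContDiff.sum fun i _ => contDiff_const.mul ?_)
  · have h1 := hb i
    have h2 := hb j
    unfold thetaSub
    fun_prop
  · have h1 := hb i
    unfold thetaNormal
    fun_prop

end Interp
end Morley

namespace Morley
variable {d : ℕ}

/-! ### Sobolev seminorms and `L^p` norms -/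

section Seminorm

theorem mem_piAntidiag_univ_iff {k : ℕ} {α : Fin d → ℕ} :
    α ∈ Finset.piAntidiag (Finset.univ : Finset (Fin d)) k ↔ order α = k := by
  simp [Finset.mem_piAntidiag, order]

theorem integral_abs_rpow_eq_lpNorm {α : Type*} [MeasurableSpace α] {μ : Measure α} {f : α → ℝ}
    (hf : AEStronglyMeasurable f μ) {p : ℝ} (hp : 0 < p) :
    (∫ x, |f x| ^ p ∂μ) ^ (1 / p) = lpNorm f (ENNReal.ofReal p) μ := by
  rw [lpNorm_eq_integral_norm_rpow_toReal (by simpa using hp) (by simp) hf,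
    ENNReal.toReal_ofReal hp.le, one_div]
  simp [Real.norm_eq_abs]

theorem integral_abs_rpow_nonneg {α : Type*} [MeasurableSpace α] {μ : Measure α} (f : α → ℝ)
    (p : ℝ) : 0 ≤ ∫ x, |f x| ^ p ∂μ :=
  integral_nonneg fun _ => Real.rpow_nonneg (abs_nonneg _) _

theorem sobolevSeminorm_nonneg (k : ℕ) (p : ℝ) (Ω : Set (E d)) (f : E d → ℝ) :
    0 ≤ sobolevSeminorm k p Ω f :=
  Real.rpow_nonneg (Finset.sum_nonneg fun _ _ => integral_abs_rpow_nonneg _ _) _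

theorem lpNorm_weakDeriv_le_sobolevSeminorm {k : ℕ} {p : ℝ} (hp : 0 < p) {Ω : Set (E d)}
    {f : E d → ℝ} {α : Fin d → ℕ} (hα : order α = k) :
    lpNorm (weakDeriv Ω α f) (ENNReal.ofReal p) (volume.restrict Ω) ≤ sobolevSeminorm k p Ω f := by
  by_cases hm : AEStronglyMeasurable (weakDeriv Ω α f) (volume.restrict Ω)
  · rw [← integral_abs_rpow_eq_lpNorm hm hp]
    refine Real.rpow_le_rpow (integral_abs_rpow_nonneg _ _) ?_ (by positivity)
    exact Finset.single_le_sum (f := fun α => ∫ x in Ω, |weakDeriv Ω α f x| ^ p)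
      (fun _ _ => integral_abs_rpow_nonneg _ _) (mem_piAntidiag_univ_iff.2 hα)
  -- By convention `lpNorm` is zero for a function that is not almost everywhere strongly
  -- measurable.
  · rw [lpNorm_of_not_aestronglyMeasurable hm]
    exact sobolevSeminorm_nonneg _ _ _ _

/-- The `ℓ^q` norm is at most the `ℓ^1` norm: each `a i ^ (q - 1)` is bounded by the same power of
the sum. -/
theorem sum_rpow_rpow_one_div_le {ι : Type*} (s : Finset ι) {a : ι → ℝ} (ha : ∀ i ∈ s, 0 ≤ a i)
    {q : ℝ} (hq : 1 ≤ q) : (∑ i ∈ s, a i ^ q) ^ (1 / q) ≤ ∑ i ∈ s, a i := by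
  have hS : 0 ≤ ∑ i ∈ s, a i := Finset.sum_nonneg ha
  have h1 : ∑ i ∈ s, a i ^ q ≤ (∑ i ∈ s, a i) ^ q := by
    calc ∑ i ∈ s, a i ^ q ≤ ∑ i ∈ s, a i * (∑ i ∈ s, a i) ^ (q - 1) := by
          refine Finset.sum_le_sum fun i hi => ?_
          rcases (ha i hi).eq_or_lt with h0 | h0
          · rw [← h0, Real.zero_rpow (by linarith), zero_mul]
          · calc a i ^ q = a i * a i ^ (q - 1) := by
                  rw [Real.rpow_sub_one h0.ne']; field_simp
              _ ≤ _ := by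
                  gcongr
                  exact Finset.single_le_sum ha hi
      _ = (∑ i ∈ s, a i) * (∑ i ∈ s, a i) ^ (q - 1) := by rw [Finset.sum_mul]
      _ = (∑ i ∈ s, a i) ^ q := by
          rcases hS.eq_or_lt with h0 | h0
          · rw [← h0, zero_mul, Real.zero_rpow (by linarith)]
          · rw [Real.rpow_sub_one h0.ne']; field_simp
  calc _ ≤ ((∑ i ∈ s, a i) ^ q) ^ (1 / q) := Real.rpow_le_rpow
        (Finset.sum_nonneg fun i hi => Real.rpow_nonneg (ha i hi) _) h1 (by positivity)
    _ = _ := by rw [← Real.rpow_mul hS, mul_one_div_cancel (by linarith), Real.rpow_one]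

theorem sobolevSeminorm_le_sum {k : ℕ} {q : ℝ} (hq : 1 ≤ q) {Ω : Set (E d)} {f : E d → ℝ}
    (hf : ∀ α, order α = k → AEStronglyMeasurable (weakDeriv Ω α f) (volume.restrict Ω)) :
    sobolevSeminorm k q Ω f ≤ ∑ α ∈ Finset.piAntidiag (Finset.univ : Finset (Fin d)) k,
      lpNorm (weakDeriv Ω α f) (ENNReal.ofReal q) (volume.restrict Ω) := by
  have hq0 : 0 < q := by linarith
  refine le_trans (le_of_eq ?_) (sum_rpow_rpow_one_div_le _ (fun _ _ => lpNorm_nonneg) hq)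
  rw [sobolevSeminorm]
  congr 1
  refine Finset.sum_congr rfl fun α hα => ?_
  rw [← integral_abs_rpow_eq_lpNorm (hf α (mem_piAntidiag_univ_iff.1 hα)) hq0,
    ← Real.rpow_mul (integral_abs_rpow_nonneg _ _), one_div_mul_cancel hq0.ne', Real.rpow_one]

theorem lpNorm_congr_ae {α : Type*} [MeasurableSpace α] {μ : Measure α} {f g : α → ℝ}
    {p : ENNReal} (h : f =ᵐ[μ] g) : lpNorm f p μ = lpNorm g p μ := by
  by_cases hf : AEStronglyMeasurable f μ
  · rw [← toReal_eLpNorm hf, ← toReal_eLpNorm (hf.congr h), eLpNorm_congr_ae h]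
  · rw [lpNorm_of_not_aestronglyMeasurable hf,
      lpNorm_of_not_aestronglyMeasurable fun hg => hf (hg.congr h.symm)]

theorem lpNorm_sum_const_mul_le {α : Type*} [MeasurableSpace α] {μ : Measure α} {ι : Type*}
    (s : Finset ι) (c : ι → ℝ) {f : ι → α → ℝ} {p : ℝ} (hp : 1 ≤ p)
    (hf : ∀ i ∈ s, MemLp (f i) (ENNReal.ofReal p) μ) :
    lpNorm (fun x => ∑ i ∈ s, c i * f i x) (ENNReal.ofReal p) μ ≤
      ∑ i ∈ s, |c i| * lpNorm (f i) (ENNReal.ofReal p) μ := by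
  have e : (fun x => ∑ i ∈ s, c i * f i x) = ∑ i ∈ s, c i • f i := by
    ext x; simp [Finset.sum_apply]
  rw [e]
  refine (lpNorm_sum_le (fun i hi => (hf i hi).const_smul (c i)) (by simpa using hp)).trans ?_
  refine le_of_eq (Finset.sum_congr rfl fun i _ => ?_)
  rw [lpNorm_const_smul]; simp

end Seminorm

/-! ### Second and third weak derivatives in arbitrary directions -/

section Directional

/-- The second weak derivative of `φ` in the directions `c`, `b`. -/
noncomputable def dirDeriv₂ (Ω : Set (E d)) (b c : E d) (φ : E d → ℝ) : E d → ℝ := fun x =>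
  ∑ k, c k * ∑ j, b j * weakDeriv Ω (unitIndex k + unitIndex j) φ x

/-- The third weak derivative of `φ` in the directions `c`, `b`, `a`. -/
noncomputable def dirDeriv₃ (Ω : Set (E d)) (a b c : E d) (φ : E d → ℝ) : E d → ℝ := fun x =>
  ∑ k, c k * ∑ j, b j * ∑ i, a i * weakDeriv Ω (unitIndex k + unitIndex j + unitIndex i) φ x

variable {Ω : Set (E d)} {φ : E d → ℝ} {p : ℝ}

theorem MemSobolev.hasWeakDeriv {k : ℕ} (hφ : MemSobolev k p Ω φ) {α : Fin d → ℕ}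
    (hα : order α ≤ k) : HasWeakDeriv Ω α φ (weakDeriv Ω α φ) := by
  obtain ⟨g, hg, _⟩ := hφ α hα
  exact hg.hasWeakDeriv_weakDeriv

theorem MemSobolev.memLp (hΩ : IsOpen Ω) {k : ℕ} (hφ : MemSobolev k p Ω φ) {α : Fin d → ℕ}
    (hα : order α ≤ k) :
    MemLp (weakDeriv Ω α φ) (ENNReal.ofReal p) (volume.restrict Ω) := by
  obtain ⟨g, hg, hg'⟩ := hφ α hα
  exact hg'.ae_eq (hg.weakDeriv_ae_eq hΩ).symm

theorem sum_smul_single (v : E d) : ∑ j, v j • (EuclideanSpace.single j 1 : E d) = v := by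
  ext i
  simp [Finset.sum_apply, Pi.single_apply]

theorem MemSobolev.weakDirDeriv {k : ℕ} (hφ : MemSobolev k p Ω φ) {α : Fin d → ℕ}
    (hα : order α + 1 ≤ k) (v : E d) :
    WeakDirDeriv Ω v (weakDeriv Ω α φ)
      (fun x => ∑ j, v j * weakDeriv Ω (α + unitIndex j) φ x) := by
  have h := hφ.hasWeakDeriv (α := α) (by omega)
  have := WeakDirDeriv.sum_left (s := Finset.univ) (V := fun j : Fin d => EuclideanSpace.single j 1)
    (c := fun j => v j) h.2.1 fun j _ => h.weakDirDeriv
      (hφ.hasWeakDeriv (α := α + unitIndex j) (by rw [order_add, order_unitIndex]; omega))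
  rwa [sum_smul_single] at this

theorem order_two (k j : Fin d) : order (unitIndex k + unitIndex j) = 2 := by
  simp [order_add, order_unitIndex]

theorem order_three (k j i : Fin d) : order (unitIndex k + unitIndex j + unitIndex i) = 3 := by
  simp [order_add, order_unitIndex]

theorem weakDirDeriv_dirDeriv (hφ : MemSobolev 3 p Ω φ) (c : E d) :
    WeakDirDeriv Ω c φ (dirDeriv Ω c φ) := by
  have h0 := hφ.hasWeakDeriv (α := 0) (by simp [order_zero])
  have := WeakDirDeriv.sum_left (s := Finset.univ) (V := fun j : Fin d => EuclideanSpace.single j 1)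
    (c := fun j => c j) h0.1 fun j _ => hasWeakDeriv_unitIndex_iff.1
      (hφ.hasWeakDeriv (α := unitIndex j) (by rw [order_unitIndex]; omega))
  rwa [sum_smul_single] at this

theorem weakDirDeriv_dirDeriv₂ (hφ : MemSobolev 3 p Ω φ) (b c : E d) :
    WeakDirDeriv Ω b (dirDeriv Ω c φ) (dirDeriv₂ Ω b c φ) :=
  WeakDirDeriv.sum_right (s := Finset.univ) fun k _ =>
    hφ.weakDirDeriv (by rw [order_unitIndex]; omega) b

theorem weakDirDeriv_dirDeriv₃ (hφ : MemSobolev 3 p Ω φ) (a b c : E d) :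
    WeakDirDeriv Ω a (dirDeriv₂ Ω b c φ) (dirDeriv₃ Ω a b c φ) :=
  WeakDirDeriv.sum_right (s := Finset.univ) fun k _ =>
    WeakDirDeriv.sum_right (s := Finset.univ) fun j _ =>
      hφ.weakDirDeriv (by rw [order_two]) a

theorem memLp_dirDeriv₃ (hΩ : IsOpen Ω) (hφ : MemSobolev 3 p Ω φ) (a b c : E d) :
    MemLp (dirDeriv₃ Ω a b c φ) (ENNReal.ofReal p) (volume.restrict Ω) :=
  memLp_finsetSum _ fun k _ => (memLp_finsetSum _ fun j _ => (memLp_finsetSum _ fun i _ =>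
    (hφ.memLp hΩ (order_three k j i).le).const_mul (a i)).const_mul (b j)).const_mul (c k)

theorem memLp_dirDeriv₂ (hΩ : IsOpen Ω) (hφ : MemSobolev 3 p Ω φ) (b c : E d) :
    MemLp (dirDeriv₂ Ω b c φ) (ENNReal.ofReal p) (volume.restrict Ω) :=
  memLp_finsetSum _ fun k _ => (memLp_finsetSum _ fun j _ =>
    (hφ.memLp hΩ ((order_two k j).le.trans (by norm_num))).const_mul (b j)).const_mul (c k)

theorem dirDeriv₂_single (k j : Fin d) :
    dirDeriv₂ Ω (EuclideanSpace.single j 1) (EuclideanSpace.single k 1) φ =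
      weakDeriv Ω (unitIndex k + unitIndex j) φ := by
  ext x
  simp [dirDeriv₂]

/-- Holds at every point, not just almost everywhere, because addition of multi-indices commutes and
each multi-index has one chosen representative. -/
theorem dirDeriv₃_comm_left (a b c : E d) :
    dirDeriv₃ Ω a b c φ = dirDeriv₃ Ω b a c φ := by
  ext x
  simp only [dirDeriv₃, Finset.mul_sum]
  refine Finset.sum_congr rfl fun k _ => ?_
  rw [Finset.sum_comm]
  refine Finset.sum_congr rfl fun j _ => Finset.sum_congr rfl fun i _ => ?_
  rw [add_right_comm]; ring

theorem dirDeriv₃_comm_right (a b c : E d) :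
    dirDeriv₃ Ω a b c φ = dirDeriv₃ Ω a c b φ := by
  ext x
  simp only [dirDeriv₃, Finset.mul_sum]
  rw [Finset.sum_comm]
  refine Finset.sum_congr rfl fun j _ => Finset.sum_congr rfl fun k _ =>
    Finset.sum_congr rfl fun i _ => ?_
  rw [add_comm (unitIndex k)]; ring

theorem dirDeriv₃_sum_left {ι : Type*} (s : Finset ι) (t : ι → ℝ) (a : ι → E d) (b c : E d)
    (x : E d) : dirDeriv₃ Ω (∑ l ∈ s, t l • a l) b c φ x =
      ∑ l ∈ s, t l * dirDeriv₃ Ω (a l) b c φ x := by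
  simp only [dirDeriv₃, WithLp.ofLp_sum, WithLp.ofLp_smul, Finset.sum_apply, Pi.smul_apply,
    smul_eq_mul, Finset.sum_mul, Finset.mul_sum]
  conv_rhs => rw [Finset.sum_comm]
  refine Finset.sum_congr rfl fun k _ => ?_
  conv_rhs => rw [Finset.sum_comm]
  refine Finset.sum_congr rfl fun j _ => ?_
  conv_rhs => rw [Finset.sum_comm]
  refine Finset.sum_congr rfl fun i _ => Finset.sum_congr rfl fun l _ => ?_
  ring

/-- The weak second derivatives of a directional derivative. -/
theorem hasWeakDeriv_dirDeriv (hφ : MemSobolev 3 p Ω φ) (c : E d) (k l : Fin d) :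
    HasWeakDeriv Ω (unitIndex k + unitIndex l) (dirDeriv Ω c φ)
      (dirDeriv₃ Ω (EuclideanSpace.single l 1) (EuclideanSpace.single k 1) c φ) :=
  (hasWeakDeriv_unitIndex_iff.2 (weakDirDeriv_dirDeriv₂ hφ _ c)).comp_weakDirDeriv
    (weakDirDeriv_dirDeriv₃ hφ _ _ c)

/-- By symmetry the direction `c` is differentiated first, which exhibits the third derivative as a
second derivative of `∂φ/∂c`. -/
theorem lpNorm_dirDeriv₃_le (hΩ : IsOpen Ω) (hp : 1 ≤ p) (hφ : MemSobolev 3 p Ω φ) (c : E d)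
    (k l : Fin d) :
    lpNorm (dirDeriv₃ Ω c (EuclideanSpace.single l 1) (EuclideanSpace.single k 1) φ)
      (ENNReal.ofReal p) (volume.restrict Ω) ≤ sobolevSeminorm 2 p Ω (dirDeriv Ω c φ) := by
  rw [dirDeriv₃_comm_left, dirDeriv₃_comm_right,
    ← lpNorm_congr_ae ((hasWeakDeriv_dirDeriv hφ c k l).weakDeriv_ae_eq hΩ)]
  exact lpNorm_weakDeriv_le_sobolevSeminorm (by linarith) (order_two k l)

end Directional
end Morley

/-! ### Preservation of mean second derivatives and the general error estimate -/

namespace Morley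
variable {d : ℕ} {p q : ℝ} {T : Simplex d} {φ : E d → ℝ}

theorem exists_eq_unitIndex_add {α : Fin d → ℕ} (h : order α = 2) :
    ∃ k l, α = unitIndex k + unitIndex l := by
  obtain ⟨β, l, hβ, rfl⟩ := exists_eq_add_unitIndex (k := 1) h
  obtain ⟨γ, k, hγ, rfl⟩ := exists_eq_add_unitIndex (k := 0) hβ
  have : γ = 0 := by
    ext i
    have := (Finset.sum_eq_zero_iff.1 hγ) i (Finset.mem_univ i)
    simpa using this
  exact ⟨k, l, by rw [this, zero_add]⟩

theorem multiDeriv_unitIndex_add {g : E d → ℝ} (hg : ContDiff ℝ ∞ g) (k l : Fin d) :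
    multiDeriv (unitIndex k + unitIndex l) g = pderiv l (pderiv k g) := by
  rw [multiDeriv_add_unitIndex _ hg, ← zero_add (unitIndex k), multiDeriv_add_unitIndex _ hg,
    multiDeriv_zero]

/-- Identifies the weak first derivatives with the classical ones, which are continuous up to the
boundary and enter the degrees of freedom. -/
theorem dirDeriv_ae_eq_fderivWithin (hφ : MemSobolev 3 p (interior (body T)) φ)
    (hφ1 : ContDiffOn ℝ 1 φ (body T)) (v : E d) :
    dirDeriv (interior (body T)) v φ =ᵐ[volume.restrict (interior (body T))]
      fun x => fderivWithin ℝ φ (body T) x v := by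
  have h1 := weakDirDeriv_dirDeriv hφ v
  have h2 := WeakDirDeriv.of_contDiffOn isOpen_interior (hφ1.mono interior_subset) v
  refine (h1.ae_eq isOpen_interior h2).trans ?_
  refine (ae_restrict_mem isOpen_interior.measurableSet).mono fun x hx => ?_
  simp only [fderivWithin_of_mem_nhds (mem_interior_iff_mem_nhds.1 hx)]

theorem one_le_ofReal (hp : 1 ≤ p) : 1 ≤ ENNReal.ofReal p := by simpa using hp

/-- The second derivatives of the Morley interpolant of `φ` are the means of the second
derivatives of `φ`. -/
theorem average_dirDeriv₂ (hd : 1 ≤ d) (hp : 1 ≤ p) (hφ : MemSobolev 3 p (interior (body T)) φ)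
    (hφ1 : ContDiffOn ℝ 1 φ (body T)) (v w x : E d) :
    ⨍ y in interior (body T), dirDeriv₂ (interior (body T)) w v φ y =
      fderiv ℝ (fun x => fderiv ℝ (interp T φ) x v) x w := by
  rw [fderiv_fderiv_interp_apply]
  exact average_secondDeriv hd hφ1 v
    (D := fun w => dirDeriv₂ (interior (body T)) w v φ)
    (fun w => (weakDirDeriv_dirDeriv₂ hφ w v).congr_ae (dirDeriv_ae_eq_fderivWithin hφ hφ1 v)
      Filter.EventuallyEq.rfl)
    (fun w => (memLp_dirDeriv₂ isOpen_interior hφ w v).integrable (one_le_ofReal hp)) w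

theorem hasWeakDeriv_interp_sub (hd : 1 ≤ d) (hp : 1 ≤ p)
    (hφ : MemSobolev 3 p (interior (body T)) φ) (hφ1 : ContDiffOn ℝ 1 φ (body T)) (k l : Fin d) :
    HasWeakDeriv (interior (body T)) (unitIndex k + unitIndex l) (fun x => interp T φ x - φ x)
      (fun x => (⨍ y in interior (body T),
          dirDeriv₂ (interior (body T)) (EuclideanSpace.single l 1) (EuclideanSpace.single k 1) φ y) -
        dirDeriv₂ (interior (body T)) (EuclideanSpace.single l 1) (EuclideanSpace.single k 1) φ x) := by
  have h1 := hasWeakDeriv_of_contDiff (isOpen_interior (s := body T)) (contDiff_interp T φ)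
    (unitIndex k + unitIndex l)
  have h2 := hφ.hasWeakDeriv (α := unitIndex k + unitIndex l)
    ((order_two k l).le.trans (by norm_num))
  have h3 := h1.sub h2
  rw [multiDeriv_unitIndex_add (contDiff_interp T φ), ← dirDeriv₂_single] at h3
  convert h3 using 2 with x
  rw [average_dirDeriv₂ hd hp hφ hφ1 _ _ x]
  rfl

theorem memLp_of_continuous {g : E d → ℝ} (hg : Continuous g) (r : ENNReal) :
    MemLp g r (volume.restrict (interior (body T))) := by
  obtain ⟨C, hC⟩ := (isCompact_body T).exists_bound_of_continuousOn hg.continuousOn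
  refine MemLp.of_bound hg.aestronglyMeasurable C ?_
  exact (ae_restrict_mem isOpen_interior.measurableSet).mono fun x hx => hC x (interior_subset hx)

/-- The anisotropic interpolation error estimate, for derivatives in general directions `u j`. -/
theorem exists_sobolevSeminorm_interp_sub_le (hd : 2 ≤ d) (hp : 1 ≤ p) (hq : 1 ≤ q)
    (hpq : -(d / q : ℝ) ≤ 1 - d / p) :
    ∃ C : ℝ, 0 < C ∧ ∀ (T : Simplex d) (φ : E d → ℝ), MemSobolev 3 p (interior (body T)) φ →
      ContDiffOn ℝ 1 φ (body T) →
      MemSobolev 2 q (interior (body T)) (fun x => interp T φ x - φ x) ∧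
      ∀ (u : Fin d → E d) (H N : Fin d → ℝ) (K : ℝ) (κ : Fin d → Fin d → ℝ),
        (∀ i, T i.succ - T 0 = ∑ j, κ i j • u j) → (∀ i j, |κ i j| ≤ K * H j) →
        (∀ j k l, lpNorm (dirDeriv₃ (interior (body T)) (u j) (EuclideanSpace.single l 1)
          (EuclideanSpace.single k 1) φ) (ENNReal.ofReal p)
            (volume.restrict (interior (body T))) ≤ N j) →
        sobolevSeminorm 2 q (interior (body T)) (fun x => interp T φ x - φ x) ≤
          C * K * vol T ^ (1 / q - 1 / p) * ∑ j, H j * N j := by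
  obtain ⟨C, hC0, hC⟩ := exists_lpNorm_sub_average_le hd hp hq hpq
  have hd1 : 1 ≤ d := by omega
  set A : ℝ := ((Finset.piAntidiag (Finset.univ : Finset (Fin d)) 2).card : ℝ) with hA
  have hA0 : 0 < A := by
    rw [hA]
    have : unitIndex (⟨0, by omega⟩ : Fin d) + unitIndex ⟨0, by omega⟩ ∈
        Finset.piAntidiag (Finset.univ : Finset (Fin d)) 2 :=
      mem_piAntidiag_univ_iff.2 (order_two _ _)
    exact_mod_cast Finset.card_pos.2 ⟨_, this⟩
  have hdr : (0 : ℝ) < d := by exact_mod_cast hd1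
  -- `A` counts the multi-indices of order two, and `d` counts the edges at the first vertex.
  refine ⟨A * (C * d), by positivity, fun T φ hφ hφ1 => ⟨fun α hα => ?_, ?_⟩⟩
  · refine ⟨_, (hasWeakDeriv_of_contDiff (isOpen_interior (s := body T)) (contDiff_interp T φ)
      α).sub (hφ.hasWeakDeriv (α := α) (by omega)), ?_⟩
    refine (memLp_of_continuous (multiDeriv_contDiff α (contDiff_interp T φ)).continuous _).sub ?_
    -- Each derivative of `φ` of order at most two has first derivatives in `L^p`, hence lies in
    -- `L^q` by the Sobolev-Poincaré estimate; the polynomial part is bounded.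
    refine (hC T (weakDeriv (interior (body T)) α φ) _
      (fun i => hφ.weakDirDeriv (by omega) (T i.succ - T 0)) ?_ fun i => ?_).1
    · exact (hφ.memLp isOpen_interior (by omega)).integrable (one_le_ofReal hp)
    · exact memLp_finsetSum _ fun j _ => (hφ.memLp isOpen_interior
        (by rw [order_add, order_unitIndex]; omega)).const_mul _
  · intro u H N K κ hκ hκH hN
    set Ω := interior (body T) with hΩ
    set e : Fin d → E d := fun k => EuclideanSpace.single k 1 with he
    have hedge : ∀ (i k l : Fin d), lpNorm (dirDeriv₃ Ω (T i.succ - T 0) (e l) (e k) φ) (ENNReal.ofReal p)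
        (volume.restrict Ω) ≤ K * ∑ j, H j * N j := by
      intro i k l
      have e1 : dirDeriv₃ Ω (T i.succ - T 0) (e l) (e k) φ =
          fun x => ∑ j, κ i j * dirDeriv₃ Ω (u j) (e l) (e k) φ x := by
        ext x; rw [hκ, dirDeriv₃_sum_left]
      rw [e1]
      refine (lpNorm_sum_const_mul_le _ _ hp fun j _ =>
        memLp_dirDeriv₃ isOpen_interior hφ _ _ _).trans ?_
      rw [Finset.mul_sum]
      refine Finset.sum_le_sum fun j _ => ?_
      rw [← mul_assoc]
      exact mul_le_mul (hκH i j) (hN j k l) lpNorm_nonneg ((abs_nonneg _).trans (hκH i j))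
    have hterm : ∀ k l, lpNorm (fun x => (⨍ y in Ω, dirDeriv₂ Ω (e l) (e k) φ y) -
        dirDeriv₂ Ω (e l) (e k) φ x) (ENNReal.ofReal q) (volume.restrict Ω) ≤
          C * vol T ^ (1 / q - 1 / p) * (d * (K * ∑ j, H j * N j)) := by
      intro k l
      have h1 := (hC T (dirDeriv₂ Ω (e l) (e k) φ)
        (fun i => dirDeriv₃ Ω (T i.succ - T 0) (e l) (e k) φ)
        (fun i => weakDirDeriv_dirDeriv₃ hφ _ _ _)
        ((memLp_dirDeriv₂ isOpen_interior hφ _ _).integrable (one_le_ofReal hp))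
        (fun i => memLp_dirDeriv₃ isOpen_interior hφ _ _ _)).2
      have h2 : lpNorm (fun x => (⨍ y in Ω, dirDeriv₂ Ω (e l) (e k) φ y) -
          dirDeriv₂ Ω (e l) (e k) φ x) (ENNReal.ofReal q) (volume.restrict Ω) =
          lpNorm (fun x => dirDeriv₂ Ω (e l) (e k) φ x -
            (⨍ y in Ω, dirDeriv₂ Ω (e l) (e k) φ y)) (ENNReal.ofReal q) (volume.restrict Ω) :=
        lpNorm_sub_comm _ _ _ _
      rw [h2]
      refine h1.trans ?_
      have hv : 0 ≤ C * vol T ^ (1 / q - 1 / p) :=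
        mul_nonneg hC0.le (Real.rpow_nonneg (vol_pos T).le _)
      refine mul_le_mul_of_nonneg_left ?_ hv
      refine (Finset.sum_le_sum fun i _ => hedge i k l).trans ?_
      simp
    have hw := fun k l => hasWeakDeriv_interp_sub hd1 hp hφ hφ1 k l
    refine (sobolevSeminorm_le_sum hq fun α hα => ?_).trans ?_
    · obtain ⟨k, l, rfl⟩ := exists_eq_unitIndex_add hα
      exact (hw k l).hasWeakDeriv_weakDeriv.2.1.aestronglyMeasurable
    · refine (Finset.sum_le_card_nsmul _ _
        (C * vol T ^ (1 / q - 1 / p) * (d * (K * ∑ j, H j * N j))) fun α hα => ?_).trans ?_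
      · obtain ⟨k, l, rfl⟩ := exists_eq_unitIndex_add (mem_piAntidiag_univ_iff.1 hα)
        rw [lpNorm_congr_ae ((hw k l).weakDeriv_ae_eq isOpen_interior)]
        exact hterm k l
      · rw [nsmul_eq_mul, ← hA]
        exact le_of_eq (by ring)

end Morley

namespace Morley
variable {d : ℕ} {p : ℝ}

/-! ### Transport to standard position -/

section Isometry

theorem measurePreserving_affineIsometryEquiv (Φ : E d ≃ᵃⁱ[ℝ] E d) : MeasurePreserving Φ := by
  have := Φ.toIsometryEquiv.measurePreserving_euclideanHausdorffMeasure d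
  rwa [EuclideanSpace.euclideanHausdorffMeasure_eq_volume] at this

theorem lpNorm_comp_affineIsometryEquiv (Φ : E d ≃ᵃⁱ[ℝ] E d) {Ω : Set (E d)} {f : E d → ℝ}
    {r : ENNReal} (hf : AEStronglyMeasurable f (volume.restrict Ω)) :
    lpNorm (f ∘ Φ) r (volume.restrict (Φ ⁻¹' Ω)) = lpNorm f r (volume.restrict Ω) := by
  have hp := (measurePreserving_affineIsometryEquiv Φ).restrict_preimage_emb
    Φ.toHomeomorph.measurableEmbedding Ω
  rw [← toReal_eLpNorm hf, ← toReal_eLpNorm (hf.comp_measurePreserving hp),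
    eLpNorm_comp_measurePreserving hf hp]

theorem WeakDirDeriv.comp_affineIsometryEquiv (Φ : E d ≃ᵃⁱ[ℝ] E d) {Ω : Set (E d)} {v : E d}
    {f g : E d → ℝ} (h : WeakDirDeriv Ω (Φ.linearIsometryEquiv v) f g) :
    WeakDirDeriv (Φ ⁻¹' Ω) v (f ∘ Φ) (g ∘ Φ) :=
  WeakDirDeriv.comp_affineEquiv Φ.toAffineEquiv h

theorem sum_smul_linearIsometryEquiv (A : E d ≃ₗᵢ[ℝ] E d) (v : E d) :
    ∑ n, A.symm v n • A (EuclideanSpace.single n 1) = v := by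
  have := congrArg A (sum_smul_single (A.symm v))
  simpa [map_sum] using this

theorem abs_symm_single_le (A : E d ≃ₗᵢ[ℝ] E d) (l n : Fin d) :
    |A.symm (EuclideanSpace.single l 1) n| ≤ 1 := by
  have h := PiLp.norm_apply_le (A.symm (EuclideanSpace.single l (1 : ℝ))) n
  rw [A.symm.norm_map] at h
  simpa using h

variable {Ω : Set (E d)} {φ : E d → ℝ}

/-- Coordinate derivatives of `φ ∘ Φ` are derivatives of `φ` in the rotated coordinate directions.
-/
theorem hasWeakDeriv_comp_affineIsometryEquiv (hΩ : IsOpen Ω) (hφ : MemSobolev 3 p Ω φ)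
    (Φ : E d ≃ᵃⁱ[ℝ] E d) (j m n : Fin d) :
    HasWeakDeriv (Φ ⁻¹' Ω) (unitIndex m + unitIndex n)
      (weakDeriv (Φ ⁻¹' Ω) (unitIndex j) (φ ∘ Φ))
      (dirDeriv₃ Ω (Φ.linearIsometryEquiv (EuclideanSpace.single n 1))
        (Φ.linearIsometryEquiv (EuclideanSpace.single m 1))
        (Φ.linearIsometryEquiv (EuclideanSpace.single j 1)) φ ∘ Φ) := by
  have hΩ' : IsOpen (Φ ⁻¹' Ω) := hΩ.preimage Φ.continuous
  have h1 := hasWeakDeriv_unitIndex_iff.2 ((weakDirDeriv_dirDeriv hφ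
    (Φ.linearIsometryEquiv (EuclideanSpace.single j 1))).comp_affineIsometryEquiv Φ)
  have h2 := hasWeakDeriv_unitIndex_iff.2 ((weakDirDeriv_dirDeriv₂ hφ
    (Φ.linearIsometryEquiv (EuclideanSpace.single m 1))
    (Φ.linearIsometryEquiv (EuclideanSpace.single j 1))).comp_affineIsometryEquiv Φ)
  have h3 := h2.comp_weakDirDeriv ((weakDirDeriv_dirDeriv₃ hφ
    (Φ.linearIsometryEquiv (EuclideanSpace.single n 1))
    (Φ.linearIsometryEquiv (EuclideanSpace.single m 1))
    (Φ.linearIsometryEquiv (EuclideanSpace.single j 1))).comp_affineIsometryEquiv Φ)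
  exact h3.congr_ae (h1.weakDeriv_ae_eq hΩ').symm Filter.EventuallyEq.rfl

/-- The two directions `e_l`, `e_k` are expanded in the rotated basis with coefficients at most `1`
in absolute value; each expansion costs a factor `d`. -/
theorem lpNorm_dirDeriv₃_le_comp (hΩ : IsOpen Ω) (hp : 1 ≤ p) (hφ : MemSobolev 3 p Ω φ)
    (Φ : E d ≃ᵃⁱ[ℝ] E d) (j k l : Fin d) :
    lpNorm (dirDeriv₃ Ω (Φ.linearIsometryEquiv (EuclideanSpace.single j 1))
      (EuclideanSpace.single l 1) (EuclideanSpace.single k 1) φ)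
      (ENNReal.ofReal p) (volume.restrict Ω) ≤
      (d : ℝ) ^ 2 * sobolevSeminorm 2 p (Φ ⁻¹' Ω)
        (weakDeriv (Φ ⁻¹' Ω) (unitIndex j) (φ ∘ Φ)) := by
  set A := Φ.linearIsometryEquiv with hA
  set a : Fin d → E d := fun n => A (EuclideanSpace.single n 1) with ha
  set S := sobolevSeminorm 2 p (Φ ⁻¹' Ω) (weakDeriv (Φ ⁻¹' Ω) (unitIndex j) (φ ∘ Φ)) with hS
  have hS0 : 0 ≤ S := sobolevSeminorm_nonneg _ _ _ _
  have hΩ' : IsOpen (Φ ⁻¹' Ω) := hΩ.preimage Φ.continuous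
  have h1 : ∀ m n, lpNorm (dirDeriv₃ Ω (a n) (a m) (a j) φ) (ENNReal.ofReal p)
      (volume.restrict Ω) ≤ S := by
    intro m n
    rw [← lpNorm_comp_affineIsometryEquiv Φ (memLp_dirDeriv₃ hΩ hφ _ _ _).1,
      ← lpNorm_congr_ae ((hasWeakDeriv_comp_affineIsometryEquiv hΩ hφ Φ j m n).weakDeriv_ae_eq hΩ')]
    exact lpNorm_weakDeriv_le_sobolevSeminorm (by linarith) (order_two m n)
  -- Replaces one rotated direction by a standard one; it is applied twice, with the symmetry of
  -- `dirDeriv₃` moving the relevant slot to the front.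
  have h2 : ∀ (b : E d) (l : Fin d) (R : ℝ), 0 ≤ R →
      (∀ n, lpNorm (dirDeriv₃ Ω (a n) b (a j) φ) (ENNReal.ofReal p) (volume.restrict Ω) ≤ R) →
      lpNorm (dirDeriv₃ Ω (EuclideanSpace.single l 1) b (a j) φ) (ENNReal.ofReal p)
        (volume.restrict Ω) ≤ d * R := by
    intro b l R hR hb
    have e : dirDeriv₃ Ω (EuclideanSpace.single l 1) b (a j) φ = fun x =>
        ∑ n, A.symm (EuclideanSpace.single l 1) n * dirDeriv₃ Ω (a n) b (a j) φ x := by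
      ext x
      conv_lhs => rw [← sum_smul_linearIsometryEquiv A (EuclideanSpace.single l 1)]
      rw [dirDeriv₃_sum_left]
    rw [e]
    refine (lpNorm_sum_const_mul_le _ _ hp fun n _ => memLp_dirDeriv₃ hΩ hφ _ _ _).trans ?_
    refine (Finset.sum_le_card_nsmul _ _ R fun n _ => ?_).trans (by simp)
    exact (mul_le_of_le_one_left lpNorm_nonneg (abs_symm_single_le A l n)).trans (hb n)
  rw [dirDeriv₃_comm_left, dirDeriv₃_comm_right, pow_two, mul_assoc]
  refine h2 _ l _ (by positivity) fun n => ?_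
  rw [dirDeriv₃_comm_left]
  exact h2 _ k _ hS0 fun m => h1 n m

end Isometry

/-! ### Expansion of the edge vectors -/

section Geometry

theorem Shape.norm_vertex_sub (S : Shape d) (hS : S.Admissible) (i : Fin d) :
    ‖S.vertex i.succ - S.vertex (S.startVertex i)‖ = S.h i := by
  cases S with
  | tri h₁ h₂ s t =>
    obtain ⟨a, b, c, e⟩ := hS
    fin_cases i
    · simp [Shape.vertex, Shape.h, Shape.startVertex, EuclideanSpace.norm_eq, Fin.sum_univ_two,
        Real.sqrt_sq a.le]
    · simp [Shape.vertex, Shape.h, Shape.startVertex, EuclideanSpace.norm_eq, Fin.sum_univ_two]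
      rw [← Real.sqrt_sq b.le]
      congr 1
      rw [Real.sqrt_sq b.le]
      linear_combination h₂ ^ 2 * c
  | tetI h₁ h₂ h₃ s₁ t₁ s₂₁ s₂₂ t₂ =>
    obtain ⟨a, b, c, e, _, _, _, f, _⟩ := hS
    fin_cases i
    · simp [Shape.vertex, Shape.h, Shape.startVertex, EuclideanSpace.norm_eq, Fin.sum_univ_three,
        Real.sqrt_sq a.le]
    · simp [Shape.vertex, Shape.h, Shape.startVertex, EuclideanSpace.norm_eq, Fin.sum_univ_three]
      rw [← Real.sqrt_sq b.le]
      congr 1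
      rw [Real.sqrt_sq b.le]
      linear_combination h₂ ^ 2 * e
    · simp [Shape.vertex, Shape.h, Shape.startVertex, EuclideanSpace.norm_eq, Fin.sum_univ_three]
      rw [← Real.sqrt_sq c.le]
      congr 1
      rw [Real.sqrt_sq c.le]
      linear_combination h₃ ^ 2 * f
  | tetII h₁ h₂ h₃ s₁ t₁ s₂₁ s₂₂ t₂ =>
    obtain ⟨a, b, c, e, _, _, _, f, _⟩ := hS
    fin_cases i
    · simp [Shape.vertex, Shape.h, Shape.startVertex, EuclideanSpace.norm_eq, Fin.sum_univ_three,
        Real.sqrt_sq a.le]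
    · simp [Shape.vertex, Shape.h, Shape.startVertex, EuclideanSpace.norm_eq, Fin.sum_univ_three]
      rw [← Real.sqrt_sq b.le]
      congr 1
      rw [Real.sqrt_sq b.le]
      linear_combination h₂ ^ 2 * e
    · simp [Shape.vertex, Shape.h, Shape.startVertex, EuclideanSpace.norm_eq, Fin.sum_univ_three]
      rw [← Real.sqrt_sq c.le]
      congr 1
      rw [Real.sqrt_sq c.le]
      linear_combination h₃ ^ 2 * f

theorem Shape.h_pos (S : Shape d) (hS : S.Admissible) (i : Fin d) : 0 < S.h i := by
  cases S with
  | tri h₁ h₂ s t =>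
    obtain ⟨a, b, _⟩ := hS
    fin_cases i
    exacts [a, b]
  | tetI h₁ h₂ h₃ s₁ t₁ s₂₁ s₂₂ t₂ =>
    obtain ⟨a, b, c, _⟩ := hS
    fin_cases i
    exacts [a, b, c]
  | tetII h₁ h₂ h₃ s₁ t₁ s₂₁ s₂₂ t₂ =>
    obtain ⟨a, b, c, _⟩ := hS
    fin_cases i
    exacts [a, b, c]

variable {S : Shape d} {T : Simplex d} {Φ : E d ≃ᵃⁱ[ℝ] E d}

theorem IsConfiguration.norm_sub (h : IsConfiguration S T Φ) (i : Fin d) :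
    ‖T i.succ - T (S.startVertex i)‖ = S.h i := by
  rw [h.vertex_eq, h.vertex_eq, ← dist_eq_norm, Φ.dist_map, dist_eq_norm,
    S.norm_vertex_sub h.admissible]

theorem IsConfiguration.smul_edgeDir (h : IsConfiguration S T Φ) (i : Fin d) :
    S.h i • S.edgeDir T i = T i.succ - T (S.startVertex i) := by
  rw [Shape.edgeDir, h.norm_sub, smul_smul, mul_inv_cancel₀ (S.h_pos h.admissible i).ne', one_smul]

/-- The edges at the first vertex in terms of the directions `r_i`. -/
theorem IsConfiguration.exists_edge_eq_sum_edgeDir (h : IsConfiguration S T Φ) :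
    ∃ κ : Fin d → Fin d → ℝ, (∀ i, T i.succ - T 0 = ∑ j, κ i j • S.edgeDir T j) ∧
      ∀ i j, |κ i j| ≤ S.h j := by
  have hpos := S.h_pos h.admissible
  -- For triangles and type (i) every `r_i` starts at the first vertex, so the expansion is
  -- diagonal.
  have hdiag : (∀ i, S.startVertex i = 0) → ∃ κ : Fin d → Fin d → ℝ,
      (∀ i, T i.succ - T 0 = ∑ j, κ i j • S.edgeDir T j) ∧ ∀ i j, |κ i j| ≤ S.h j := by
    intro h0
    refine ⟨fun i j => if i = j then S.h j else 0, fun i => ?_, fun i j => ?_⟩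
    · have := h.smul_edgeDir i
      rw [h0] at this
      simp [← this]
    · dsimp only
      split_ifs
      · rw [abs_of_pos (hpos j)]
      · simpa using (hpos j).le
  cases S with
  | tri h₁ h₂ s t => exact hdiag fun i => by fin_cases i <;> rfl
  | tetI h₁ h₂ h₃ s₁ t₁ s₂₁ s₂₂ t₂ => exact hdiag fun i => by fin_cases i <;> rfl
  | tetII h₁ h₂ h₃ s₁ t₁ s₂₁ s₂₂ t₂ =>
    have e0 : h₁ • Shape.edgeDir (.tetII h₁ h₂ h₃ s₁ t₁ s₂₁ s₂₂ t₂) T 0 = T 1 - T 0 :=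
      h.smul_edgeDir 0
    have e1 : h₂ • Shape.edgeDir (.tetII h₁ h₂ h₃ s₁ t₁ s₂₁ s₂₂ t₂) T 1 = T 2 - T 1 :=
      h.smul_edgeDir 1
    have e2 : h₃ • Shape.edgeDir (.tetII h₁ h₂ h₃ s₁ t₁ s₂₁ s₂₂ t₂) T 2 = T 3 - T 0 :=
      h.smul_edgeDir 2
    have p0 : 0 < h₁ := hpos 0
    have p1 : 0 < h₂ := hpos 1
    have p2 : 0 < h₃ := hpos 2
    -- For type (ii) the second edge at the first vertex is `p_3 - p_1 = (p_2 - p_1) + (p_3 - p_2)`.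
    refine ⟨![![h₁, 0, 0], ![h₁, h₂, 0], ![0, 0, h₃]], fun i => ?_, fun i j => ?_⟩
    · fin_cases i
      · simp [Fin.sum_univ_three, e0]
      · simp [Fin.sum_univ_three, e0, e1]
      · simp [Fin.sum_univ_three, e2]
    · fin_cases i <;> fin_cases j <;>
        simp [Shape.h, abs_of_pos, p0, p1, p2, p0.le, p1.le, p2.le]

theorem abs_mul_le_of_sq_le {h s : ℝ} (hh : 0 < h) (hs : s ^ 2 ≤ 1) : |h * s| ≤ h := by
  rw [abs_mul, abs_of_pos hh]
  exact mul_le_of_le_one_right hh.le (by rwa [← sq_le_one_iff_abs_le_one])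

/-- The components of the edges at the first vertex in standard position. -/
theorem IsConfiguration.abs_vertex_le (h : IsConfiguration S T Φ) {M : ℝ} (hM : 0 < M)
    (hG : GeometricAssumption M S) (i j : Fin d) :
    |S.vertex i.succ j| ≤ (1 + M) * S.hTilde j := by
  have hle : ∀ {a b : ℝ}, |a| ≤ b → |a| ≤ (1 + M) * b := fun {a b} hab => by
    nlinarith [abs_nonneg a]
  have hn := h.norm_sub
  cases S with
  | tri h₁ h₂ s t =>
    obtain ⟨a, b, c, e⟩ := h.admissible
    obtain ⟨_, _, h21⟩ := h.numbering
    have e1 : |h₂ * s| ≤ h₁ := (abs_mul_le_of_sq_le b (by nlinarith)).trans h21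
    refine hle ?_
    have p1 : 0 < h₂ * t := by positivity
    fin_cases i <;> fin_cases j
    · exact (abs_of_pos a).le
    · simpa [Shape.vertex, Shape.hTilde] using p1.le
    · exact e1
    · exact (abs_of_pos p1).le
  | tetI h₁ h₂ h₃ s₁ t₁ s₂₁ s₂₂ t₂ =>
    obtain ⟨a, b, c, e, hs1, ht1, hs1', f, ht2, _⟩ := h.admissible
    obtain ⟨_, hl, _, _⟩ := h.numbering
    have h3 : ‖T 3 - T 0‖ = h₃ := hn 2
    have h1 : ‖T 1 - T 0‖ = h₁ := hn 0
    -- For type (i) the edge `p_1 p_4` shares exactly one endpoint with the shortest edge `p_1 p_3`,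
    -- so `p_1 p_2` is at least as long.
    have h31 : h₃ ≤ h₁ := by
      have := (hl 3 (by decide) (by decide)).1
      rwa [dist_comm, dist_comm (T 0), dist_eq_norm, dist_eq_norm, h3, h1] at this
    have e1 : |h₂ * s₁| ≤ h₁ := by rw [abs_of_pos (by positivity)]; linarith
    have e2 : |h₃ * s₂₁| ≤ h₁ :=
      (abs_mul_le_of_sq_le c (by nlinarith [sq_nonneg s₂₂, sq_nonneg t₂])).trans h31
    have hG' : |s₂₂| ≤ M * (h₂ * t₁ / h₃) := hG
    -- Of all the components, only this one needs the geometric assumption.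
    have e3 : |h₃ * s₂₂| ≤ (1 + M) * (h₂ * t₁) := by
      rw [abs_mul, abs_of_pos c]
      calc h₃ * |s₂₂| ≤ h₃ * (M * (h₂ * t₁ / h₃)) := by gcongr
        _ = M * (h₂ * t₁) := by field_simp
        _ ≤ _ := by nlinarith [mul_pos b ht1]
    have p1 : 0 < h₂ * t₁ := by positivity
    have p2 : 0 < h₃ * t₂ := by positivity
    have p3 : 0 < 1 + M := by linarith
    fin_cases i <;> fin_cases j
    · exact hle (abs_of_pos a).le
    · exact hle (by simpa [Shape.vertex, Shape.hTilde] using p1.le)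
    · exact hle (by simpa [Shape.vertex, Shape.hTilde] using p2.le)
    · exact hle e1
    · exact hle (abs_of_pos p1).le
    · exact hle (by simpa [Shape.vertex, Shape.hTilde] using p2.le)
    · exact hle e2
    · exact e3
    · exact hle (abs_of_pos p2).le
  | tetII h₁ h₂ h₃ s₁ t₁ s₂₁ s₂₂ t₂ =>
    obtain ⟨a, b, c, e, hs1, ht1, hs1', f, ht2, _⟩ := h.admissible
    obtain ⟨_, hl, hs, _⟩ := h.numbering
    have h3 : ‖T 3 - T 0‖ = h₃ := hn 2
    have h1 : ‖T 1 - T 0‖ = h₁ := hn 0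
    -- For type (ii) the edge `p_1 p_4` is not adjacent to the shortest edge `p_2 p_3`; the
    -- half-space condition compares it with `p_2 p_4`, which is adjacent.
    have h31 : h₃ ≤ h₁ := by
      have h4 := (hl 3 (by decide) (by decide)).1
      have h5 : dist (T 3) (T 0) ≤ dist (T 3) (T 1) := hs
      rw [dist_comm (T 1), dist_comm (T 0), dist_eq_norm (T 1), h1] at h4
      rw [dist_eq_norm, h3] at h5
      exact h5.trans h4
    have e1 : |h₁ - h₂ * s₁| ≤ h₁ := by
      have := mul_pos b hs1
      rw [abs_of_nonneg (by linarith)]; linarith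
    have e2 : |h₃ * s₂₁| ≤ h₁ :=
      (abs_mul_le_of_sq_le c (by nlinarith [sq_nonneg s₂₂, sq_nonneg t₂])).trans h31
    have hG' : |s₂₂| ≤ M * (h₂ * t₁ / h₃) := hG
    have e3 : |h₃ * s₂₂| ≤ (1 + M) * (h₂ * t₁) := by
      rw [abs_mul, abs_of_pos c]
      calc h₃ * |s₂₂| ≤ h₃ * (M * (h₂ * t₁ / h₃)) := by gcongr
        _ = M * (h₂ * t₁) := by field_simp
        _ ≤ _ := by nlinarith [mul_pos b ht1]
    have p1 : 0 < h₂ * t₁ := by positivity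
    have p2 : 0 < h₃ * t₂ := by positivity
    have p3 : 0 < 1 + M := by linarith
    fin_cases i <;> fin_cases j
    · exact hle (abs_of_pos a).le
    · exact hle (by simpa [Shape.vertex, Shape.hTilde] using p1.le)
    · exact hle (by simpa [Shape.vertex, Shape.hTilde] using p2.le)
    · exact hle e1
    · exact hle (abs_of_pos p1).le
    · exact hle (by simpa [Shape.vertex, Shape.hTilde] using p2.le)
    · exact hle e2
    · exact e3
    · exact hle (abs_of_pos p2).le

theorem Shape.vertex_zero (S : Shape d) : S.vertex 0 = 0 := by
  cases S <;> ext i <;> fin_cases i <;> rfl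

theorem IsConfiguration.edge_eq_sum (h : IsConfiguration S T Φ) (i : Fin d) :
    T i.succ - T 0 = ∑ j, S.vertex i.succ j •
      Φ.linearIsometryEquiv (EuclideanSpace.single j 1) := by
  have h1 := congrArg Φ.linearIsometryEquiv (sum_smul_single (S.vertex i.succ))
  simp only [map_sum, map_smul] at h1
  rw [h1, h.vertex_eq, h.vertex_eq, S.vertex_zero]
  have := Φ.map_vsub (S.vertex i.succ) 0
  simpa using this.symm

end Geometry
end Morley

theorem theorem3 (d : ℕ) (hd : d = 2 ∨ d = 3) (p q : ℝ) (hp : 1 ≤ p) (hq : 1 ≤ q)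
    (hpq : -(d / q : ℝ) ≤ 1 - d / p) :
    (∃ c : ℝ, 0 < c ∧
      ∀ (S : Shape d) (T : Simplex d) (Φ : E d ≃ᵃⁱ[ℝ] E d), IsConfiguration S T Φ →
      ∀ φ : E d → ℝ, MemSobolev 3 p (interior (body T)) φ → ContDiffOn ℝ 1 φ (body T) →
        MemSobolev 2 q (interior (body T)) (fun x => interp T φ x - φ x) ∧
        sobolevSeminorm 2 q (interior (body T)) (fun x => interp T φ x - φ x) ≤
          c * vol T ^ (1 / q - 1 / p) *
            ∑ i, S.h i * sobolevSeminorm 2 p (interior (body T))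
              (dirDeriv (interior (body T)) (S.edgeDir T i) φ)) ∧
    (∀ M : ℝ, 0 < M → ∃ c : ℝ, 0 < c ∧
      ∀ (S : Shape d) (T : Simplex d) (Φ : E d ≃ᵃⁱ[ℝ] E d), IsConfiguration S T Φ →
      GeometricAssumption M S →
      ∀ φ : E d → ℝ, MemSobolev 3 p (interior (body T)) φ → ContDiffOn ℝ 1 φ (body T) →
        sobolevSeminorm 2 q (interior (body T)) (fun x => interp T φ x - φ x) ≤
          c * vol T ^ (1 / q - 1 / p) *
            ∑ i, S.hTilde i * sobolevSeminorm 2 p (interior (Φ ⁻¹' body T))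
              (weakDeriv (interior (Φ ⁻¹' body T)) (unitIndex i) (φ ∘ Φ))) := by
  have hd2 : 2 ≤ d := by omega
  obtain ⟨C, hC0, hC⟩ := exists_sobolevSeminorm_interp_sub_le hd2 hp hq hpq
  refine ⟨⟨C, hC0, fun S T Φ h φ hφ hφ1 => ⟨(hC T φ hφ hφ1).1, ?_⟩⟩, fun M hM =>
    ⟨C * (1 + M) * (d : ℝ) ^ 2, by positivity, fun S T Φ h hG φ hφ hφ1 => ?_⟩⟩
  · obtain ⟨κ, hκ, hκ'⟩ := h.exists_edge_eq_sum_edgeDir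
    -- Directions `r_j`, weights `h_j`, and `K = 1`.
    have := (hC T φ hφ hφ1).2 (S.edgeDir T) S.h _ 1 κ hκ (by simpa using hκ')
      fun j k l => lpNorm_dirDeriv₃_le isOpen_interior hp hφ _ k l
    simpa using this
  · have hpre : interior (Φ ⁻¹' body T) = Φ ⁻¹' interior (body T) :=
      (Φ.toHomeomorph.preimage_interior (body T)).symm
    -- Rotated coordinate directions: as the first vertex is at the origin in standard position, the
    -- coefficients are the coordinates of the other vertices.
    have := (hC T φ hφ hφ1).2 _ S.hTilde _ (1 + M) (fun i j => S.vertex i.succ j)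
      h.edge_eq_sum (h.abs_vertex_le hM hG)
      fun j k l => lpNorm_dirDeriv₃_le_comp isOpen_interior hp hφ Φ j k l
    rw [hpre]
    refine this.trans (le_of_eq ?_)
    simp only [Finset.mul_sum]
    exact Finset.sum_congr rfl fun j _ => by ring
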